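/- Let $M\ge 2$ and consider coordinates $(t_1,\dots,t_M)$ in $\mathbb{C}^M$. Let $T\subset\mathbb{C}$ be a finite set, let $\lambda\colon T\to(\mathbb{C}^*)^M$, $\lambda(\tau)=(\lambda_1(\tau),\dots,\lambda_M(\tau))$, and let $k\in\mathbb{N}$. A germ $h$ of biholomorphism of $(\mathbb{C}^M,0)$ is called $k$-tangent to the identity if $h-\mathrm{id}$ has vanishing order greater than $k$ at $0$. Let $\pi\colon\widehat{\mathbb{C}^M}\to\mathbb{C}^M$ be the blow-up at the origin, with the chart $(t_1,\dots,t_M)$ in which $\pi(t)=(t_1,t_1t_2,\dots,t_1t_M)$. Foliations are one-dimensional singular holomorphic foliations, with singular set of codimension at least $2$. Then there is a foliation $\mathcal{G}$ on $\mathbb{C}^M$ with the following properties. 1. There are $P\in\mathbb{N}$, $\nu_{ij}\in\mathbb{C}^*$ and pairwise distinct $b_j\in\mathbb{C}$ ($1\le i\le M-1$, $1\le j\le P$) such that $\mathcal{G}$ is defined by the system $$t_i'=\Big(\sum_{j=1}^P\frac{\nu_{ij}}{t_M-b_j}\Big)t_i\quad(1\le i\le M-1),\qquad t_M'=1,$$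 and the singular set of $\mathcal{G}$ on $\mathbb{C}^M$ consists of the points $(0,\dots,0,b_j)$, $j=1,\dots,P$. 2. $T\subset\{b_1,\dots,b_P\}$, and for each $\tau\in T$ there is a germ of biholomorphism $h_\tau$ of $(\mathbb{C}^M,0)$, $k$-tangent to the identity, such that, with $p_\tau=(0,\dots,0,\tau)$ and $f_\tau(s)=p_\tau+h_\tau(s)$, the foliation $\mathcal{G}$ at $p_\tau$ is generated by the pushforward by $f_\tau$ of the linear system $s_i'=\lambda_i(\tau)s_i$, $i=1,\dots,M$. 3. There is a foliation $\mathcal{F}$ on $\mathbb{C}^M$, generated by a polynomial vector field, of which $\mathcal{G}$ is the strict transform by $\pi$; that is, $\mathcal{F}$ is the pushforward of $\mathcal{G}$ by $(t_1,\dots,t_M)\mapsto(t_1,t_1t_2,\dots,t_1t_M)$ (a biholomorphism from $\{t_1\ne 0\}$ onto $\{x_1\neq0\}$). 4. Let $S$ be the hypersurface $x_1\cdots x_{M-1}\prod_{j=1}^P(x_M-b_jx_1)=0$. Then (a) $S$ is invariant by $\mathcal{F}$; (b) the leaves of $\mathcal{F}$ in $\mathbb{C}^M\setminus S$ are dense in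 $\mathbb{C}^M$; (c) for each $\tau\in T$, the germ of $\pi^{-1}(S)$ at $p_\tau$ is the image by $f_\tau$ of the germ at $0$ of $\{s_1\cdots s_M=0\}$. 5. For every $\epsilon>0$ and every neighborhood $\Delta$ of the origin in $\mathbb{C}^M$ there is an open set $U\subset\Delta\setminus S$ such that: (a) for each $p\in U$ there is a set $E\subset U$, dense in $U$ and contained in the leaf $L_p$ of $\mathcal{F}|_\Delta$ through $p$, such that every $q\in E$ can be connected to $p$ by a curve in $L_p$ of Euclidean length smaller than $\epsilon$; (b) $\pi^{-1}(U\cup S)$ is a neighborhood of each point of the exceptional divisor $\pi^{-1}(0)$ outside the tangent cone of $\prod_{\tau\in T}(x_M-\tau x_1)=0$; (c) if $\tau\in T$ is such that some real line through $0\in\mathbb{C}$ separates $\lambda_M(\tau)$ from the set $\{\lambda_1(\tau),\lambda_1(\tau)+\lambda_2(\tau),\dots,\lambda_1(\tau)+\lambda_{M-1}(\tau)\}$ (the point and the set lie in opposite open half-planes), then $\pi^{-1}(U\cup S)$ is a neighborhood of each point of the affine space $\{t_1=0,\,t_M=\tau\}$; if this separation property holds for all $\tau\in T$, then $U\cup S$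 is a neighborhood of the origin. If $M=2$, the separation property at $\tau$ is equivalent to $\lambda_2(\tau)/\lambda_1(\tau)\in\mathbb{C}\setminus[0,+\infty)$. -/

import Mathlib

open scoped Topology LinearAlgebra.Projectivization

noncomputable section

/-- The space `ℂ^M` with its Euclidean norm, where `M = n + 2 ≥ 2`. The coordinates
`t_1, …, t_M` are indexed by `Fin (n + 2)`: `t_1` is `t 0`, `t_M` is `t (Fin.last (n + 1))`, and
`t_1, …, t_{M-1}` are the `t i.castSucc` with `i : Fin (n + 1)`. -/
abbrev CSpace (n : ℕ) : Type := EuclideanSpace ℂ (Fin (n + 2))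

/-- A one-dimensional singular holomorphic foliation on `ℂ^M`, given by its direction field:
`dir p` is the tangent line of the foliation at a regular point `p` and `⊥` at a singular point.
Near every point the foliation is generated by a holomorphic vector field, and the singular set
(which is an analytic set) has codimension at least two: at each of its points `p` there is a
complex plane `p + L` in which `p` is an isolated singular point. -/
structure HolFoliation (n : ℕ) where
  dir : CSpace n → Submodule ℂ (CSpace n)
  locally_generated : ∀ p, ∃ Z : CSpace n → CSpace n, AnalyticAt ℂ Z p ∧
    ∀ᶠ q in 𝓝 p, dir q = Submodule.span ℂ {Z q}
  codim_sing : ∀ p, dir p = ⊥ → ∃ L : Submodule ℂ (CSpace n), Module.finrank ℂ L = 2 ∧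
    ∀ᶠ v in 𝓝[≠] (0 : CSpace n), v ∈ L → dir (p + v) ≠ ⊥

namespace HolFoliation

variable {n : ℕ}

/-- The singular set. -/
def sing (F : HolFoliation n) : Set (CSpace n) := {p | F.dir p = ⊥}

/-- `γ : [0,1] → Δ` is a piecewise `C¹` path that lies in a leaf of the restriction of `F` to `Δ`:
it avoids the singular set and is tangent to `F`. -/
structure IsLeafPath (F : HolFoliation n) (Δ : Set (CSpace n)) (γ : ℝ → CSpace n) : Prop where
  continuousOn : ContinuousOn γ (Set.Icc 0 1)
  mem : ∀ s ∈ Set.Icc (0 : ℝ) 1, γ s ∈ Δ ∧ γ s ∉ F.sing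
  piecewise_tangent : ∃ B : Finset ℝ, ∀ a c : ℝ, 0 ≤ a → a < c → c ≤ 1 →
    Disjoint (B : Set ℝ) (Set.Ioo a c) →
      ContDiffOn ℝ 1 γ (Set.Icc a c) ∧ ∀ s ∈ Set.Ioo a c, deriv γ s ∈ F.dir (γ s)

/-- The leaf through `p` of the restriction of `F` to `Δ` (empty if `p` is singular). -/
def leaf (F : HolFoliation n) (Δ : Set (CSpace n)) (p : CSpace n) : Set (CSpace n) :=
  {q | ∃ γ, F.IsLeafPath Δ γ ∧ γ 0 = p ∧ γ 1 = q}

/-- `S` is invariant: it contains the whole leaf through each of its regular points. -/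
def IsInvariant (F : HolFoliation n) (S : Set (CSpace n)) : Prop :=
  ∀ p ∈ S, p ∉ F.sing → F.leaf Set.univ p ⊆ S

end HolFoliation

/-- The rational vector field
`∑_{i<M} (∑_j ν_ij / (t_M - b_j)) t_i ∂/∂t_i + ∂/∂t_M`, to be used off its poles `t_M = b_j`. -/
def rationalField {n P : ℕ} (ν : Fin (n + 1) → Fin P → ℂ) (b : Fin P → ℂ) (t : CSpace n) :
    CSpace n :=
  WithLp.toLp 2 (Fin.snoc (α := fun _ => ℂ)
    (fun i : Fin (n + 1) => (∑ j, ν i j / (t (Fin.last (n + 1)) - b j)) * t i.castSucc) 1)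

/-- The polynomial vector field with components `X i`. -/
def polyField {n : ℕ} (X : Fin (n + 2) → MvPolynomial (Fin (n + 2)) ℂ) (x : CSpace n) :
    CSpace n :=
  WithLp.toLp 2 fun i => MvPolynomial.eval (fun j => x j) (X i)

/-- The diagonal linear vector field `∑ λ_i s_i ∂/∂s_i`. -/
def diagField {n : ℕ} (l : Fin (n + 2) → ℂ) (s : CSpace n) : CSpace n :=
  WithLp.toLp 2 fun i => l i * s i

/-- The point `(0, …, 0, τ)`. -/
def axisPoint (n : ℕ) (τ : ℂ) : CSpace n := EuclideanSpace.single (Fin.last (n + 1)) τ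

/-- `h` is a germ of biholomorphism of `(ℂ^M, 0)`. -/
def IsBiholGerm {n : ℕ} (h : CSpace n → CSpace n) : Prop :=
  h 0 = 0 ∧ AnalyticAt ℂ h 0 ∧ Function.Bijective (fderiv ℂ h 0)

/-- `h - id` has vanishing order greater than `k` at `0`. -/
def IsTangentToId {n : ℕ} (k : ℕ) (h : CSpace n → CSpace n) : Prop :=
  (fun s => h s - s) =O[𝓝 0] fun s => ‖s‖ ^ (k + 1)

/-- The blow-up map in the first chart: `(t_1, …, t_M) ↦ (t_1, t_1 t_2, …, t_1 t_M)`. -/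
def blowMap {n : ℕ} (t : CSpace n) : CSpace n :=
  WithLp.toLp 2 fun i => if i = 0 then t 0 else t 0 * t i

/-- The complex projective space of lines of `ℂ^M` carries the quotient topology. -/
instance projTopology (n : ℕ) : TopologicalSpace (ℙ ℂ (CSpace n)) :=
  TopologicalSpace.coinduced (Projectivization.mk' ℂ) inferInstance

/-- The blow-up of `ℂ^M` at the origin: pairs `(x, ℓ)` of a point and a line through the origin
with `x ∈ ℓ`, as a subspace of `ℂ^M × ℙ(ℂ^M)`. -/
abbrev BlowUp (n : ℕ) : Type :=
  {z : CSpace n × ℙ ℂ (CSpace n) // z.1 ∈ z.2.submodule}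

/-- The projection `π` of the blow-up to `ℂ^M`. -/
def BlowUp.proj {n : ℕ} (z : BlowUp n) : CSpace n := z.1.1

/-- The direction vector `(1, t_2, …, t_M)`. -/
def chartDir {n : ℕ} (t : CSpace n) : CSpace n :=
  WithLp.toLp 2 fun i => if i = 0 then 1 else t i

theorem chartDir_ne_zero {n : ℕ} (t : CSpace n) : chartDir t ≠ 0 := by
  intro h
  have h0 := congrArg (fun v : CSpace n => v 0) h
  simp [chartDir] at h0

theorem blowMap_eq_smul {n : ℕ} (t : CSpace n) : blowMap t = t 0 • chartDir t := by
  ext i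
  by_cases hi : i = 0 <;> simp [blowMap, chartDir, hi]

/-- The point of the blow-up with coordinates `(t_1, …, t_M)` in the first chart, namely
`((t_1, t_1 t_2, …, t_1 t_M), [1 : t_2 : … : t_M])`; the exceptional divisor is `t_1 = 0`. -/
def BlowUp.chart {n : ℕ} (t : CSpace n) : BlowUp n :=
  ⟨(blowMap t, Projectivization.mk ℂ (chartDir t) (chartDir_ne_zero t)), by
    rw [Projectivization.submodule_mk, blowMap_eq_smul]
    exact Submodule.smul_mem _ _ (Submodule.mem_span_singleton_self _)⟩

/-- The hypersurface `x_1 ⋯ x_{M-1} ∏_j (x_M - b_j x_1) = 0`. -/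
def hypersurfaceS {n P : ℕ} (b : Fin P → ℂ) : Set (CSpace n) :=
  {x | (∏ i : Fin (n + 1), x i.castSucc) * ∏ j, (x (Fin.last (n + 1)) - b j * x 0) = 0}

/-- The tangent cone of `∏_{τ ∈ T} (x_M - τ x_1) = 0`, as a set of lines. The polynomial is
homogeneous, so these are the lines on which it vanishes (none if `T` is empty). -/
def tangentConeT {n : ℕ} (T : Finset ℂ) : Set (ℙ ℂ (CSpace n)) :=
  {l | ∀ v ∈ l.submodule, ∏ τ ∈ T, (v (Fin.last (n + 1)) - τ * v 0) = 0}

/-- Some real line `{z | Re (θ z) = 0}` through `0` separates `a` from the set `B`, that is, `a`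
and `B` lie in the two opposite open half-planes. -/
def SeparatedByRealLine (a : ℂ) (B : Set ℂ) : Prop :=
  ∃ θ : ℂ, θ ≠ 0 ∧ 0 < (θ * a).re ∧ ∀ z ∈ B, (θ * z).re < 0

/-- A real line through `0` separates `λ_M` from `{λ_1, λ_1 + λ_2, …, λ_1 + λ_{M-1}}`. -/
def SeparationCondition {n : ℕ} (l : Fin (n + 2) → ℂ) : Prop :=
  SeparatedByRealLine (l (Fin.last (n + 1)))
    ({l 0} ∪ {z | ∃ i, i ≠ 0 ∧ i ≠ Fin.last (n + 1) ∧ z = l 0 + l i})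

end

/-! Off the hypersurface S the quotient z = x_M/x_1 = t_M is a local parameter on each leaf, and x_1
= t_1, x_i = t_1 t_i (1 < i < M) satisfy dx_i/dz = (∑_j ρ_ij/(z - b_j)) x_i with weights ρ_1j = ν_1j
and ρ_ij = ν_1j + ν_ij. Thus leaves are obtained by lifting paths of the z-plane minus the nodes
b_j. Diagonal scalings of the x_i preserve the foliation, so the monodromy over a base point w acts
by multipliers in (ℂ^*)^(M-1); a small loop around b_j has multiplier (exp(2πi ρ_ij))_i.

Short connections. If the multipliers are dense (`dense_monodromyGroup`), one of them is close to
(1/2, …, 1/2). Iterating it shrinks a point at a total cost given by a geometric series, hence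
proportional to the initial norm (`exists_contraction`). At a tiny scale any other multiplier costs
almost nothing. So one contracts the first point, applies a suitable multiplier, and then runs the
contraction of the second point backwards, which ends as close to the second point as desired
(`exists_reach_near`).

Reaching the base point. A path from z to w must cost a uniform multiple of the norm
(`exists_mv_uniform`). This is compactness away from the nodes and infinity. At a node, if Re ω > 0
and Re(ω ρ_ij) < 0 for all i, the spiral b_j + u exp(ωs) leaves the node while all x_i decay
exponentially (`exists_mv_node`); at a node of T the separation condition provides such an ω. At
infinity an inward spiral works because the sums ∑_j ρ_ij lie in a suitable cone
(`exists_mv_infty`). Nodes of T without separation are avoided by cones around the corresponding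
directions.

Choice of data (`exists_nodes`). The residues at τ ∈ T are the ratios λ_i/λ_M. The regular parts
vanish to order k at τ, so multiplying the coordinates by exponentials of their primitives
linearizes G by a map k-tangent to the identity. All other nodes have weights in a cone compatible
with the spirals, and differences of weights realize √2, i and √2 i in one coordinate at a time,
which makes the monodromy dense. -/

open scoped Topology LinearAlgebra.Projectivization

noncomputable section

/-! ### Leaf paths and their lengths -/

namespace HolFoliation

variable {n : ℕ}

/-- `q` can be joined to `p` by a leaf path of length at most `ℓ`. -/
def Reach (F : HolFoliation n) (p q : CSpace n) (ℓ : ℝ) : Prop :=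
  0 ≤ ℓ ∧ ∃ γ, F.IsLeafPath Set.univ γ ∧ γ 0 = p ∧ γ 1 = q ∧
    eVariationOn γ (Set.Icc 0 1) ≤ ENNReal.ofReal ℓ

variable {F : HolFoliation n}

theorem Reach.mono {p q : CSpace n} {ℓ ℓ' : ℝ} (h : F.Reach p q ℓ) (hl : ℓ ≤ ℓ') :
    F.Reach p q ℓ' := by
  obtain ⟨h0, γ, h1, h2, h3, h4⟩ := h
  exact ⟨h0.trans hl, γ, h1, h2, h3, h4.trans (ENNReal.ofReal_le_ofReal hl)⟩

theorem Reach.refl {p : CSpace n} (hp : p ∉ F.sing) : F.Reach p p 0 := by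
  refine ⟨le_rfl, fun _ => p, ⟨continuousOn_const, fun s _ => ⟨trivial, hp⟩, ∅, ?_⟩, rfl, rfl, ?_⟩
  · intro a c _ _ _ _
    exact ⟨contDiffOn_const, fun s _ => by simp⟩
  · rw [eVariationOn.constant_on]
    · simp
    · rintro _ ⟨x, _, rfl⟩ _ ⟨y, _, rfl⟩
      rfl

theorem IsLeafPath.reverse {γ : ℝ → CSpace n} (h : F.IsLeafPath Set.univ γ) :
    F.IsLeafPath Set.univ (fun s => γ (1 - s)) := by
  obtain ⟨B, hB⟩ := h.piecewise_tangent
  refine ⟨?_, ?_, B.image (fun x => 1 - x), ?_⟩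
  · refine h.continuousOn.comp (by fun_prop) ?_
    intro s hs
    exact ⟨by linarith [hs.2], by linarith [hs.1]⟩
  · intro s hs
    exact h.mem (1 - s) ⟨by linarith [hs.2], by linarith [hs.1]⟩
  · intro a c ha hac hc hd
    obtain ⟨h1, h2⟩ := hB (1 - c) (1 - a) (by linarith) (by linarith) (by linarith) (by
      rw [Set.disjoint_left] at hd ⊢
      intro x hx hx'
      refine hd (a := 1 - x) ?_ ⟨by linarith [hx'.2], by linarith [hx'.1]⟩
      simp only [Finset.coe_image]
      exact ⟨x, hx, rfl⟩)
    refine ⟨h1.comp (by fun_prop) ?_, ?_⟩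
    · intro s hs
      exact ⟨by linarith [hs.2], by linarith [hs.1]⟩
    · intro s hs
      rw [deriv_comp_const_sub]
      exact Submodule.neg_mem _ (h2 (1 - s) ⟨by linarith [hs.2], by linarith [hs.1]⟩)

theorem Reach.symm {p q : CSpace n} {ℓ : ℝ} (h : F.Reach p q ℓ) : F.Reach q p ℓ := by
  obtain ⟨h0, γ, h1, h2, h3, h4⟩ := h
  refine ⟨h0, fun s => γ (1 - s), h1.reverse, by simpa using h3, by simpa using h2, ?_⟩
  refine le_trans (eVariationOn.comp_le_of_antitoneOn γ (fun s : ℝ => 1 - s) ?_ ?_) h4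
  · intro x _ y _ hxy
    exact sub_le_sub_left hxy 1
  · intro s hs
    exact ⟨by linarith [hs.2], by linarith [hs.1]⟩

/-- Concatenation of two paths parametrized by `[0,1]`. -/
def concat (γ₁ γ₂ : ℝ → CSpace n) (s : ℝ) : CSpace n :=
  if s ≤ 1 / 2 then γ₁ (2 * s) else γ₂ (2 * s - 1)

theorem concat_eqOn_left (γ₁ γ₂ : ℝ → CSpace n) :
    Set.EqOn (concat γ₁ γ₂) (fun s => γ₁ (2 * s)) (Set.Iic (1 / 2)) := fun s hs => by
  have hs' : s ≤ 1 / 2 := hs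
  simp only [concat, if_pos hs']

theorem concat_eqOn_right {γ₁ γ₂ : ℝ → CSpace n} (h : γ₁ 1 = γ₂ 0) :
    Set.EqOn (concat γ₁ γ₂) (fun s => γ₂ (2 * s - 1)) (Set.Ici (1 / 2)) := fun s hs => by
  have hs' : 1 / 2 ≤ s := hs
  rcases hs'.eq_or_lt with h' | h'
  · subst h'
    simp [concat, h]
  · simp only [concat, if_neg (not_le.2 h')]

theorem IsLeafPath.concat {γ₁ γ₂ : ℝ → CSpace n} (h₁ : F.IsLeafPath Set.univ γ₁)
    (h₂ : F.IsLeafPath Set.univ γ₂) (h : γ₁ 1 = γ₂ 0) :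
    F.IsLeafPath Set.univ (concat γ₁ γ₂) := by
  obtain ⟨B₁, hB₁⟩ := h₁.piecewise_tangent
  obtain ⟨B₂, hB₂⟩ := h₂.piecewise_tangent
  have eL := concat_eqOn_left γ₁ γ₂
  have eR := concat_eqOn_right h
  refine ⟨?_, ?_, B₁.image (fun x => x / 2) ∪ {1 / 2} ∪ B₂.image (fun x => (x + 1) / 2), ?_⟩
  · have : Set.Icc (0 : ℝ) 1 = Set.Icc 0 (1 / 2) ∪ Set.Icc (1 / 2) 1 :=
      (Set.Icc_union_Icc_eq_Icc (by norm_num) (by norm_num)).symm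
    rw [this]
    refine ContinuousOn.union_of_isClosed ?_ ?_ isClosed_Icc isClosed_Icc
    · refine ContinuousOn.congr (h₁.continuousOn.comp (f := fun s : ℝ => 2 * s) (by fun_prop) ?_)
        (eL.mono fun s hs => hs.2)
      intro s hs
      exact ⟨by linarith [hs.1], by linarith [hs.2]⟩
    · refine ContinuousOn.congr (h₂.continuousOn.comp (f := fun s : ℝ => 2 * s - 1) (by fun_prop) ?_)
        (eR.mono fun s hs => hs.1)
      intro s hs
      exact ⟨by linarith [hs.1], by linarith [hs.2]⟩
  · intro s hs
    rcases le_total s (1 / 2) with h' | h'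
    · rw [eL h']
      exact h₁.mem _ ⟨by linarith [hs.1], by linarith⟩
    · rw [eR h']
      exact h₂.mem _ ⟨by linarith, by linarith [hs.2]⟩
  · intro a c ha hac hc hd
    rw [Set.disjoint_left] at hd
    have hhalf : c ≤ 1 / 2 ∨ 1 / 2 ≤ a := by
      by_contra hcon
      push Not at hcon
      exact hd (a := 1 / 2) (by simp) ⟨hcon.2, hcon.1⟩
    rcases hhalf with h' | h'
    · obtain ⟨k1, k2⟩ := hB₁ (2 * a) (2 * c) (by linarith) (by linarith) (by linarith) (by
        rw [Set.disjoint_left]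
        intro x hx hx'
        refine hd (a := x / 2) ?_ ⟨by linarith [hx'.1], by linarith [hx'.2]⟩
        simp only [Finset.coe_union, Finset.coe_image, Set.mem_union]
        exact Or.inl (Or.inl ⟨x, hx, rfl⟩))
      refine ⟨ContDiffOn.congr (k1.comp (f := fun s : ℝ => 2 * s) (by fun_prop) ?_)
        (eL.mono fun s hs => hs.2.trans h'), ?_⟩
      · intro s hs
        exact ⟨by linarith [hs.1], by linarith [hs.2]⟩
      · intro s hs
        have hse : HolFoliation.concat γ₁ γ₂ =ᶠ[𝓝 s] fun s => γ₁ (2 * s) :=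
          eL.eventuallyEq_of_mem (Iic_mem_nhds (hs.2.trans_le h'))
        rw [hse.deriv_eq, hse.eq_of_nhds, deriv_comp_mul_left]
        exact Submodule.smul_of_tower_mem _ _ (k2 (2 * s) ⟨by linarith [hs.1], by linarith [hs.2]⟩)
    · obtain ⟨k1, k2⟩ := hB₂ (2 * a - 1) (2 * c - 1) (by linarith) (by linarith) (by linarith) (by
        rw [Set.disjoint_left]
        intro x hx hx'
        refine hd (a := (x + 1) / 2) ?_ ⟨by linarith [hx'.1], by linarith [hx'.2]⟩
        simp only [Finset.coe_union, Finset.coe_image, Set.mem_union]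
        exact Or.inr ⟨x, hx, rfl⟩)
      refine ⟨ContDiffOn.congr (k1.comp (f := fun s : ℝ => 2 * s - 1) (by fun_prop) ?_)
        (eR.mono fun s hs => h'.trans hs.1), ?_⟩
      · intro s hs
        exact ⟨by linarith [hs.1], by linarith [hs.2]⟩
      · intro s hs
        have hse : HolFoliation.concat γ₁ γ₂ =ᶠ[𝓝 s] fun s => γ₂ (2 * s - 1) :=
          eR.eventuallyEq_of_mem (Ici_mem_nhds (h'.trans_lt hs.1))
        rw [hse.deriv_eq, hse.eq_of_nhds, deriv_comp_mul_left (f := fun y => γ₂ (y - 1)),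
          deriv_comp_sub_const]
        exact Submodule.smul_of_tower_mem _ _
          (k2 (2 * s - 1) ⟨by linarith [hs.1], by linarith [hs.2]⟩)

theorem Reach.trans {p q r : CSpace n} {ℓ ℓ' : ℝ} (h : F.Reach p q ℓ) (h' : F.Reach q r ℓ') :
    F.Reach p r (ℓ + ℓ') := by
  obtain ⟨h0, γ, h1, h2, h3, h4⟩ := h
  obtain ⟨k0, δ, k1, k2, k3, k4⟩ := h'
  have hm : γ 1 = δ 0 := by rw [h3, k2]
  refine ⟨add_nonneg h0 k0, concat γ δ, h1.concat k1 hm, ?_, ?_, ?_⟩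
  · simp [concat, h2]
  · rw [concat_eqOn_right hm (show (1 : ℝ) ∈ Set.Ici (1 / 2) by norm_num)]
    norm_num [k3]
  · have e := eVariationOn.Icc_add_Icc (concat γ δ) (s := Set.univ) (a := 0) (b := 1 / 2) (c := 1)
      (by norm_num) (by norm_num) trivial
    simp only [Set.univ_inter] at e
    rw [← e, ENNReal.ofReal_add h0 k0]
    refine add_le_add ?_ ?_
    · rw [eVariationOn.congr ((concat_eqOn_left γ δ).mono Set.Icc_subset_Iic_self)]
      refine le_trans (eVariationOn.comp_le_of_monotoneOn γ (fun s : ℝ => 2 * s) ?_ ?_) h4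
      · intro x _ y _ hxy
        simpa using hxy
      · intro s hs
        exact ⟨by linarith [hs.1], by linarith [hs.2]⟩
    · rw [eVariationOn.congr ((concat_eqOn_right hm).mono Set.Icc_subset_Ici_self)]
      refine le_trans (eVariationOn.comp_le_of_monotoneOn δ (fun s : ℝ => 2 * s - 1) ?_ ?_) k4
      · intro x _ y _ hxy
        simpa using hxy
      · intro s hs
        exact ⟨by linarith [hs.1], by linarith [hs.2]⟩

/-- Leaf paths are carried to leaf paths by the linear symmetries of the foliation. -/
theorem Reach.map {p q : CSpace n} {ℓ K : ℝ} (h : F.Reach p q ℓ) (D : CSpace n →L[ℂ] CSpace n)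
    (hK : 0 ≤ K) (hDK : ∀ v, ‖D v‖ ≤ K * ‖v‖)
    (hD : ∀ x ∉ F.sing, D x ∉ F.sing ∧ ∀ v ∈ F.dir x, D v ∈ F.dir (D x)) :
    F.Reach (D p) (D q) (K * ℓ) := by
  obtain ⟨h0, γ, h1, h2, h3, h4⟩ := h
  obtain ⟨B, hB⟩ := h1.piecewise_tangent
  refine ⟨mul_nonneg hK h0, fun s => D (γ s), ⟨?_, ?_, B, ?_⟩, by simp [h2], by simp [h3], ?_⟩
  · exact D.continuous.comp_continuousOn h1.continuousOn
  · exact fun s hs => ⟨trivial, (hD _ (h1.mem s hs).2).1⟩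
  · intro a c ha hac hc hd
    obtain ⟨k1, k2⟩ := hB a c ha hac hc hd
    refine ⟨(D.restrictScalars ℝ).contDiff.comp_contDiffOn k1, fun s hs => ?_⟩
    have hd : DifferentiableAt ℝ γ s :=
      ((k1 s ⟨hs.1.le, hs.2.le⟩).contDiffAt (Icc_mem_nhds hs.1 hs.2)).differentiableAt one_ne_zero
    have : HasDerivAt (fun s => D (γ s)) (D (deriv γ s)) s :=
      (D.restrictScalars ℝ).hasFDerivAt.comp_hasDerivAt s hd.hasDerivAt
    rw [this.deriv]
    exact (hD _ (h1.mem s ⟨ha.trans hs.1.le, hs.2.le.trans hc⟩).2).2 _ (k2 s hs)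
  · have hL : LipschitzOnWith (Real.toNNReal K) D (Set.univ : Set (CSpace n)) := by
      refine LipschitzOnWith.of_dist_le_mul fun x _ y _ => ?_
      rw [dist_eq_norm, dist_eq_norm, ← map_sub, Real.coe_toNNReal K hK]
      exact hDK _
    refine (hL.comp_eVariationOn_le (Set.mapsTo_univ _ _)).trans ?_
    rw [ENNReal.ofReal_mul hK]
    exact mul_le_mul' le_rfl h4

/-- The endpoint of a path is at distance at most its length. -/
theorem Reach.norm_sub_le {p q : CSpace n} {ℓ : ℝ} (h : F.Reach p q ℓ) : ‖q - p‖ ≤ ℓ := by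
  obtain ⟨h0, γ, h1, h2, h3, h4⟩ := h
  have := (eVariationOn.edist_le γ (s := Set.Icc (0 : ℝ) 1) (x := 1) (y := 0) (by simp)
    (by simp)).trans h4
  rw [h2, h3, edist_dist, dist_eq_norm] at this
  exact (ENNReal.ofReal_le_ofReal_iff h0).1 this

theorem Reach.norm_le {p q : CSpace n} {ℓ : ℝ} (h : F.Reach p q ℓ) : ‖q‖ ≤ ‖p‖ + ℓ := by
  have := norm_add_le (q - p) p
  rw [sub_add_cancel] at this
  linarith [h.norm_sub_le]

/-- A short path stays in a given ball around its starting point. -/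
theorem Reach.exists_isLeafPath {p q : CSpace n} {ℓ : ℝ} (h : F.Reach p q ℓ)
    {Δ : Set (CSpace n)} (hΔ : Metric.closedBall p ℓ ⊆ Δ) :
    ∃ γ, F.IsLeafPath Δ γ ∧ γ 0 = p ∧ γ 1 = q ∧
      eVariationOn γ (Set.Icc 0 1) ≤ ENNReal.ofReal ℓ := by
  obtain ⟨h0, γ, h1, h2, h3, h4⟩ := h
  refine ⟨γ, ⟨h1.continuousOn, fun s hs => ⟨hΔ ?_, (h1.mem s hs).2⟩, h1.piecewise_tangent⟩,
    h2, h3, h4⟩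
  have := (eVariationOn.edist_le γ (s := Set.Icc (0 : ℝ) 1) (x := s) (y := 0) hs (by simp)).trans h4
  rw [h2, edist_dist] at this
  exact (ENNReal.ofReal_le_ofReal_iff h0).1 this

/-- A differentiable curve tangent to the foliation, with a bound for its length. -/
theorem reach_of_hasDerivAt {γ γ' : ℝ → CSpace n} {g g' : ℝ → ℝ} {S ℓ : ℝ} (hS : 0 ≤ S)
    (hγ : ∀ s ∈ Set.Icc 0 S, HasDerivAt γ (γ' s) s) (hγ' : ContinuousOn γ' (Set.Icc 0 S))
    (hreg : ∀ s ∈ Set.Icc 0 S, γ s ∉ F.sing) (htan : ∀ s ∈ Set.Icc 0 S, γ' s ∈ F.dir (γ s))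
    (hg : ∀ s ∈ Set.Icc 0 S, HasDerivAt g (g' s) s) (hgb : ∀ s ∈ Set.Icc 0 S, ‖γ' s‖ ≤ g' s)
    (hℓ : g S - g 0 ≤ ℓ) : F.Reach (γ 0) (γ S) ℓ := by
  have hmaps : ∀ s ∈ Set.Icc (0 : ℝ) 1, S * s ∈ Set.Icc 0 S := fun s hs =>
    ⟨mul_nonneg hS hs.1, mul_le_of_le_one_right hS hs.2⟩
  have hder : ∀ s ∈ Set.Icc (0 : ℝ) 1,
      HasDerivAt (fun s => γ (S * s)) (S • γ' (S * s)) s := fun s hs => by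
    have h1 : HasDerivAt (fun s : ℝ => S * s) S s := by
      simpa using (hasDerivAt_id s).const_mul S
    exact (hγ _ (hmaps s hs)).scomp s h1
  -- The mean value inequality against the scalar function `g` bounds every chord; the variation is
  -- then bounded by a telescoping sum.
  have hpair : ∀ x ∈ Set.Icc 0 S, ∀ y ∈ Set.Icc 0 S, x ≤ y → ‖γ y - γ x‖ ≤ g y - g x := by
    intro x hx y hy hxy
    have key := image_norm_le_of_norm_deriv_right_le_deriv_boundary' (a := x) (b := y)
      (f := fun s => γ s - γ x) (f' := γ') (B := fun s => g s - g x) (B' := g')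
      (fun s hs => ((hγ s ⟨hx.1.trans hs.1, hs.2.trans hy.2⟩).sub_const _).continuousAt.continuousWithinAt)
      (fun s hs => ((hγ s ⟨hx.1.trans hs.1, hs.2.le.trans hy.2⟩).sub_const _).hasDerivWithinAt)
      (by simp)
      (fun s hs => ((hg s ⟨hx.1.trans hs.1, hs.2.trans hy.2⟩).sub_const _).continuousAt.continuousWithinAt)
      (fun s hs => ((hg s ⟨hx.1.trans hs.1, hs.2.le.trans hy.2⟩).sub_const _).hasDerivWithinAt)
      (fun s hs => hgb s ⟨hx.1.trans hs.1, hs.2.le.trans hy.2⟩)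
    exact key ⟨hxy, le_rfl⟩
  have h0S : (0 : ℝ) ∈ Set.Icc 0 S := ⟨le_rfl, hS⟩
  have hSS : S ∈ Set.Icc 0 S := ⟨hS, le_rfl⟩
  refine ⟨?_, fun s => γ (S * s), ⟨?_, ?_, ∅, ?_⟩, by simp, by simp, ?_⟩
  · exact (norm_nonneg _).trans ((hpair 0 h0S S hSS hS).trans hℓ)
  · exact fun s hs => (hder s hs).continuousAt.continuousWithinAt
  · exact fun s hs => ⟨trivial, hreg _ (hmaps s hs)⟩
  · intro a c ha hac hc _
    have hsub : Set.Icc a c ⊆ Set.Icc 0 1 := Set.Icc_subset_Icc ha hc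
    refine ⟨?_, fun s hs => ?_⟩
    · rw [show (1 : WithTop ℕ∞) = 0 + 1 from (zero_add 1).symm,
        contDiffOn_succ_iff_derivWithin (uniqueDiffOn_Icc hac)]
      refine ⟨fun s hs => (hder s (hsub hs)).differentiableAt.differentiableWithinAt,
        by simp, ?_⟩
      rw [contDiffOn_zero]
      refine ContinuousOn.congr (f := fun s => S • γ' (S * s)) ?_ fun s hs =>
        (hder s (hsub hs)).hasDerivWithinAt.derivWithin (uniqueDiffOn_Icc hac s hs)
      exact (hγ'.comp (by fun_prop) fun s hs => hmaps s (hsub hs)).const_smul S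
    · have hs' := hsub ⟨hs.1.le, hs.2.le⟩
      rw [(hder s hs').deriv]
      exact Submodule.smul_of_tower_mem _ _ (htan _ (hmaps s hs'))
  · have hmono : MonotoneOn (fun s : ℝ => S * s) (Set.Icc 0 1) := fun x _ y _ hxy =>
      mul_le_mul_of_nonneg_left hxy hS
    refine (eVariationOn.comp_le_of_monotoneOn γ _ hmono hmaps).trans ?_
    refine iSup_le ?_
    rintro ⟨N, u, hu, hus⟩
    calc ∑ i ∈ Finset.range N, edist (γ (u (i + 1))) (γ (u i))
        ≤ ∑ i ∈ Finset.range N, ENNReal.ofReal (g (u (i + 1)) - g (u i)) := by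
          refine Finset.sum_le_sum fun i _ => ?_
          rw [edist_dist, dist_eq_norm]
          exact ENNReal.ofReal_le_ofReal (hpair _ (hus i) _ (hus _) (hu i.le_succ))
      _ = ENNReal.ofReal (g (u N) - g (u 0)) := by
          rw [← ENNReal.ofReal_sum_of_nonneg, Finset.sum_range_sub (fun i => g (u i))]
          exact fun i _ => (norm_nonneg _).trans (hpair _ (hus i) _ (hus _) (hu i.le_succ))
      _ ≤ ENNReal.ofReal ℓ := by
          refine ENNReal.ofReal_le_ofReal (le_trans ?_ hℓ)
          have a1 := (norm_nonneg _).trans (hpair 0 h0S (u 0) (hus 0) (hus 0).1)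
          have a2 := (norm_nonneg _).trans (hpair (u N) (hus N) S hSS (hus N).2)
          linarith

/-- A linear form that is an eigenvector of the generating field, up to a factor, vanishes on the
whole leaf as soon as it vanishes at one point. -/
theorem IsLeafPath.eq_zero {X : CSpace n → CSpace n} (hX : Continuous X)
    (hF : ∀ x, F.dir x = Submodule.span ℂ {X x}) (f : CSpace n →L[ℂ] ℂ) {g : CSpace n → ℂ}
    (hg : Continuous g) (hfg : ∀ x, f (X x) = g x * f x) {γ : ℝ → CSpace n}
    (h : F.IsLeafPath Set.univ γ) (h0 : f (γ 0) = 0) : f (γ 1) = 0 := by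
  have hcont : ContinuousOn (fun s => f (γ s)) (Set.Icc 0 1) :=
    f.continuous.comp_continuousOn h.continuousOn
  -- Continuous induction: the zero set of `f ∘ γ` is closed, so it is enough to extend it a little
  -- to the right of each of its points. This also takes care of the break points.
  suffices hsub : Set.Icc (0 : ℝ) 1 ⊆ {s | f (γ s) = 0} from hsub ⟨zero_le_one, le_rfl⟩
  refine IsClosed.Icc_subset_of_forall_exists_gt ?_ h0 ?_
  · rw [Set.inter_comm]
    exact hcont.preimage_isClosed_of_isClosed isClosed_Icc isClosed_singleton
  rintro x ⟨hx0, hx⟩ y hy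
  obtain ⟨B, hB⟩ := h.piecewise_tangent
  obtain ⟨c, hxc, hcB⟩ : ∃ c > x, Disjoint (B : Set ℝ) (Set.Ioo x c) := by
    have : ((B : Set ℝ) \ {x})ᶜ ∈ 𝓝 x :=
      ((B.finite_toSet.sdiff).isClosed.isOpen_compl).mem_nhds (by simp)
    obtain ⟨l, u, hxu, hlu⟩ := mem_nhds_iff_exists_Ioo_subset.1 this
    refine ⟨u, hxu.2, Set.disjoint_left.2 fun z hz hz' => ?_⟩
    exact hlu ⟨hxu.1.trans hz'.1, hz'.2⟩ ⟨hz, fun e => hz'.1.ne' e⟩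
  set d := min c (min y 1) with hd
  have hxd : x < d := lt_min hxc (lt_min hy hx.2)
  have hd1 : d ≤ 1 := (min_le_right _ _).trans (min_le_right _ _)
  have hdy : d ≤ y := (min_le_right _ _).trans (min_le_left _ _)
  obtain ⟨k1, k2⟩ := hB x d hx.1 hxd hd1
    (hcB.mono_right (Set.Ioo_subset_Ioo_right (min_le_left _ _)))
  have hsub : Set.Icc x d ⊆ Set.Icc 0 1 := Set.Icc_subset_Icc hx.1 hd1
  have hX0 : ∀ s ∈ Set.Icc x d, X (γ s) ≠ 0 := fun s hs e => by
    refine (h.mem s (hsub hs)).2 ?_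
    change F.dir _ = ⊥
    rw [hF, e, Submodule.span_zero_singleton]
  have hγc : ContinuousOn γ (Set.Icc x d) := h.continuousOn.mono hsub
  have hdc : ContinuousOn (derivWithin γ (Set.Icc x d)) (Set.Icc x d) :=
    k1.continuousOn_derivWithin (uniqueDiffOn_Icc hxd) le_rfl
  -- Where γ' = a X(γ), one has |a g(γ)| = |γ'| |g(γ)| / |X(γ)|. The quotient is continuous because
  -- γ avoids the singular set, and its bound is the constant for Gronwall's lemma.
  obtain ⟨K, hK⟩ := isCompact_Icc.exists_bound_of_continuousOn
    (f := fun s => ‖derivWithin γ (Set.Icc x d) s‖ * ‖g (γ s)‖ / ‖X (γ s)‖)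
    ((hdc.norm.mul (hg.comp_continuousOn hγc).norm).div (hX.comp_continuousOn hγc).norm
      fun s hs => norm_ne_zero_iff.2 (hX0 s hs))
  have hbound : ∀ s ∈ Set.Icc x d, ‖f (derivWithin γ (Set.Icc x d) s)‖ ≤ K * ‖f (γ s)‖ := by
    intro s hs
    have hcl : closure (Set.Ioo x d) = Set.Icc x d := closure_Ioo hxd.ne
    -- Tangency is known only in the open interval; both sides are continuous, so the inequality
    -- extends to the endpoints.
    refine le_on_closure (s := Set.Ioo x d)
      (f := fun s => ‖f (derivWithin γ (Set.Icc x d) s)‖) (g := fun s => K * ‖f (γ s)‖)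
      ?_ ?_ ?_ (hcl ▸ hs)
    · intro t ht
      have ht' : t ∈ Set.Icc x d := ⟨ht.1.le, ht.2.le⟩
      have e := derivWithin_of_mem_nhds (f := γ) (Icc_mem_nhds ht.1 ht.2)
      have hm := k2 t ht
      rw [← e, hF, Submodule.mem_span_singleton] at hm
      obtain ⟨a, ha⟩ := hm
      have hb := (le_abs_self _).trans (hK t ht')
      have hpos : 0 < ‖X (γ t)‖ := norm_pos_iff.2 (hX0 t ht')
      simp only [← ha, map_smul, hfg, norm_smul, norm_mul] at hb ⊢
      have : ‖a‖ * ‖g (γ t)‖ ≤ K := by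
        rwa [mul_right_comm, mul_div_cancel_right₀ _ hpos.ne'] at hb
      rw [← mul_assoc]
      exact mul_le_mul_of_nonneg_right this (norm_nonneg _)
    · rw [hcl]
      exact (f.continuous.comp_continuousOn hdc).norm
    · rw [hcl]
      exact continuousOn_const.mul (f.continuous.comp_continuousOn hγc).norm
  refine ⟨d, ?_, hxd, hdy⟩
  refine eq_zero_of_abs_deriv_le_mul_abs_self_of_eq_zero_right
    (f := fun s => f (γ s)) (f' := fun s => f (derivWithin γ (Set.Icc x d) s)) (K := K)
    (f.continuous.comp_continuousOn hγc) (fun s hs => ?_) hx0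
    (fun s hs => hbound s ⟨hs.1, hs.2.le⟩) d ⟨hxd.le, le_rfl⟩
  have := ((k1.differentiableOn one_ne_zero) s ⟨hs.1, hs.2.le⟩).hasDerivWithinAt
  exact ((f.restrictScalars ℝ).hasFDerivAt.comp_hasDerivWithinAt s this).mono_of_mem_nhdsWithin
    (Icc_mem_nhdsGE_of_mem hs)

end HolFoliation

/-! ### The polynomial vector fields generating the two foliations -/

section Model

variable {n P : ℕ}

/-- The logarithmic weights of the coordinates `x_i = t_1 t_i` (and `x_1 = t_1`). -/
def wt (ν : Fin (n + 1) → Fin P → ℂ) (i : Fin (n + 1)) (j : Fin P) : ℂ :=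
  if i = 0 then ν 0 j else ν 0 j + ν i j

@[simp]
theorem wt_zero (ν : Fin (n + 1) → Fin P → ℂ) (j : Fin P) : wt ν 0 j = ν 0 j := if_pos rfl

theorem wt_of_ne (ν : Fin (n + 1) → Fin P → ℂ) {i : Fin (n + 1)} (hi : i ≠ 0) (j : Fin P) :
    wt ν i j = ν 0 j + ν i j := if_neg hi

/-- The product `∏_{j' ≠ j} (x_M - b_j' x_1)`. -/
def coProd (b : Fin P → ℂ) (j : Fin P) (x : CSpace n) : ℂ :=
  ∏ j' ∈ Finset.univ.erase j, (x (Fin.last (n + 1)) - b j' * x 0)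

/-- The product `∏_j (x_M - b_j x_1)`. -/
def fullProd (b : Fin P → ℂ) (x : CSpace n) : ℂ := ∏ j, (x (Fin.last (n + 1)) - b j * x 0)

theorem mul_coProd (b : Fin P → ℂ) (j : Fin P) (x : CSpace n) :
    (x (Fin.last (n + 1)) - b j * x 0) * coProd b j x = fullProd b x :=
  Finset.mul_prod_erase _ (fun j => x (Fin.last (n + 1)) - b j * x 0) (Finset.mem_univ j)

/-- The components of the polynomial field generating the pushed-forward foliation. -/
def pushPoly (ν : Fin (n + 1) → Fin P → ℂ) (b : Fin P → ℂ) :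
    Fin (n + 2) → MvPolynomial (Fin (n + 2)) ℂ :=
  Fin.snoc (α := fun _ => MvPolynomial (Fin (n + 2)) ℂ)
    (fun i => MvPolynomial.X i.castSucc * ∑ j, MvPolynomial.C (wt ν i j) *
      ∏ j' ∈ Finset.univ.erase j,
        (MvPolynomial.X (Fin.last (n + 1)) - MvPolynomial.C (b j') * MvPolynomial.X 0))
    (MvPolynomial.X (Fin.last (n + 1)) * ∑ j, MvPolynomial.C (wt ν 0 j) *
      ∏ j' ∈ Finset.univ.erase j,
        (MvPolynomial.X (Fin.last (n + 1)) - MvPolynomial.C (b j') * MvPolynomial.X 0) +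
      ∏ j, (MvPolynomial.X (Fin.last (n + 1)) - MvPolynomial.C (b j) * MvPolynomial.X 0))

theorem polyField_pushPoly_castSucc (ν : Fin (n + 1) → Fin P → ℂ) (b : Fin P → ℂ) (x : CSpace n)
    (i : Fin (n + 1)) :
    polyField (pushPoly ν b) x i.castSucc = x i.castSucc * ∑ j, wt ν i j * coProd b j x := by
  simp [polyField, pushPoly, coProd, map_sum, map_prod]

theorem polyField_pushPoly_last (ν : Fin (n + 1) → Fin P → ℂ) (b : Fin P → ℂ) (x : CSpace n) :
    polyField (pushPoly ν b) x (Fin.last (n + 1)) =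
      x (Fin.last (n + 1)) * ∑ j, wt ν 0 j * coProd b j x + fullProd b x := by
  simp [polyField, pushPoly, coProd, fullProd, map_sum, map_prod]

/-- The logarithmic derivative `∑_j ρ_ij / (z - b_j)` of the `i`-th coordinate. -/
def logField (ν : Fin (n + 1) → Fin P → ℂ) (b : Fin P → ℂ) (i : Fin (n + 1)) (z : ℂ) : ℂ :=
  ∑ j, wt ν i j / (z - b j)

theorem fullProd_eq (b : Fin P → ℂ) {x : CSpace n} {z : ℂ} (hx : x (Fin.last (n + 1)) = z * x 0) :
    fullProd b x = x 0 ^ P * ∏ j, (z - b j) := by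
  simp only [fullProd, hx, ← sub_mul, Finset.prod_mul_distrib, Finset.prod_const, Finset.card_univ,
    Fintype.card_fin]
  ring

/-- Dividing the polynomial field by the common factor `fullProd / x_1` gives back the rational
system in the parameter z = x_M/x_1, with x_i' = `logField i z` · x_i. -/
theorem sum_wt_mul_coProd (ν : Fin (n + 1) → Fin P → ℂ) (b : Fin P → ℂ) {x : CSpace n} {z : ℂ}
    (hx : x (Fin.last (n + 1)) = z * x 0) (h0 : x 0 ≠ 0) (hz : ∀ j, z ≠ b j) (i : Fin (n + 1)) :
    ∑ j, wt ν i j * coProd b j x = fullProd b x / x 0 * logField ν b i z := by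
  rw [logField, Finset.mul_sum]
  refine Finset.sum_congr rfl fun j _ => ?_
  have := sub_ne_zero.2 (hz j)
  rw [← mul_coProd b j, hx]
  field_simp

theorem continuous_polyField (X : Fin (n + 2) → MvPolynomial (Fin (n + 2)) ℂ) :
    Continuous (polyField X) := by
  refine (PiLp.continuous_toLp 2 _).comp (continuous_pi fun i => ?_)
  exact (MvPolynomial.continuous_eval (X i)).comp (continuous_pi fun j => by fun_prop)

theorem analyticAt_polyField (X : Fin (n + 2) → MvPolynomial (Fin (n + 2)) ℂ) (p : CSpace n) :
    AnalyticAt ℂ (polyField X) p := by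
  have : ContDiff ℂ ⊤ (polyField X) := by
    rw [contDiff_euclidean]
    intro i
    rw [contDiff_omega_iff_analyticOnNhd]
    intro x _
    have := AnalyticAt.aeval_mvPolynomial (𝕜 := ℂ) (f := fun (y : CSpace n) j => y j) (z := x)
      (fun j => (EuclideanSpace.proj (𝕜 := ℂ) j).analyticAt x) (X i)
    simpa [polyField, MvPolynomial.aeval_eq_eval] using this
  exact (contDiff_omega_iff_analyticOnNhd.1 this) p trivial

/-- The components of the polynomial field generating the rational system. -/
def rationalPoly (ν : Fin (n + 1) → Fin P → ℂ) (b : Fin P → ℂ) :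
    Fin (n + 2) → MvPolynomial (Fin (n + 2)) ℂ :=
  Fin.snoc (α := fun _ => MvPolynomial (Fin (n + 2)) ℂ)
    (fun i => MvPolynomial.X i.castSucc * ∑ j, MvPolynomial.C (ν i j) *
      ∏ j' ∈ Finset.univ.erase j, (MvPolynomial.X (Fin.last (n + 1)) - MvPolynomial.C (b j')))
    (∏ j, (MvPolynomial.X (Fin.last (n + 1)) - MvPolynomial.C (b j)))

theorem polyField_rationalPoly_castSucc (ν : Fin (n + 1) → Fin P → ℂ) (b : Fin P → ℂ)
    (t : CSpace n) (i : Fin (n + 1)) :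
    polyField (rationalPoly ν b) t i.castSucc = t i.castSucc *
      ∑ j, ν i j * ∏ j' ∈ Finset.univ.erase j, (t (Fin.last (n + 1)) - b j') := by
  simp [polyField, rationalPoly, map_sum, map_prod]

theorem polyField_rationalPoly_last (ν : Fin (n + 1) → Fin P → ℂ) (b : Fin P → ℂ)
    (t : CSpace n) :
    polyField (rationalPoly ν b) t (Fin.last (n + 1)) = ∏ j, (t (Fin.last (n + 1)) - b j) := by
  simp [polyField, rationalPoly, map_prod]

theorem polyField_rationalPoly_eq_smul (ν : Fin (n + 1) → Fin P → ℂ) (b : Fin P → ℂ)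
    {t : CSpace n} (ht : ∀ j, t (Fin.last (n + 1)) ≠ b j) :
    polyField (rationalPoly ν b) t = (∏ j, (t (Fin.last (n + 1)) - b j)) • rationalField ν b t := by
  ext i
  refine Fin.lastCases ?_ (fun i => ?_) i
  · rw [polyField_rationalPoly_last]
    simp [rationalField]
  · rw [polyField_rationalPoly_castSucc]
    simp only [rationalField, PiLp.smul_apply, Fin.snoc_castSucc, smul_eq_mul]
    rw [mul_comm, ← mul_assoc, Finset.mul_sum]
    congr 1
    refine Finset.sum_congr rfl fun j _ => ?_
    rw [← Finset.mul_prod_erase _ _ (Finset.mem_univ j)]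
    have := sub_ne_zero.2 (ht j)
    field_simp

theorem axisPoint_castSucc (τ : ℂ) (i : Fin (n + 1)) : axisPoint n τ i.castSucc = 0 := by
  simp [axisPoint, (Fin.castSucc_lt_last i).ne]

@[simp]
theorem axisPoint_last (τ : ℂ) : axisPoint n τ (Fin.last (n + 1)) = τ := by simp [axisPoint]

/-- On t_M = b_j only the j-th summand survives, and it is nonzero since ν_ij ≠ 0; this forces t_i =
0. -/
theorem polyField_rationalPoly_eq_zero_iff {ν : Fin (n + 1) → Fin P → ℂ} {b : Fin P → ℂ}
    (hν : ∀ i j, ν i j ≠ 0) (hb : Function.Injective b) (t : CSpace n) :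
    polyField (rationalPoly ν b) t = 0 ↔ ∃ j, axisPoint n (b j) = t := by
  constructor
  · intro h
    have hl := congrArg (fun v : CSpace n => v (Fin.last (n + 1))) h
    simp only [polyField_rationalPoly_last, PiLp.zero_apply, Finset.prod_eq_zero_iff,
      Finset.mem_univ, true_and] at hl
    obtain ⟨j, hj⟩ := hl
    refine ⟨j, ?_⟩
    ext i
    refine Fin.lastCases ?_ (fun i => ?_) i
    · rw [axisPoint_last, sub_eq_zero.1 hj]
    · rw [axisPoint_castSucc]
      have hi := congrArg (fun v : CSpace n => v i.castSucc) h
      simp only [polyField_rationalPoly_castSucc, PiLp.zero_apply, mul_eq_zero] at hi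
      refine (hi.resolve_right ?_).symm
      rw [Finset.sum_eq_single j]
      · refine mul_ne_zero (hν i j) (Finset.prod_ne_zero_iff.2 fun j' hj' => ?_)
        rw [sub_eq_zero.1 hj, sub_ne_zero]
        exact fun e => Finset.ne_of_mem_erase hj' (hb e).symm
      · intro j' _ hj'
        rw [Finset.prod_eq_zero (Finset.mem_erase.2 ⟨hj'.symm, Finset.mem_univ j⟩) hj, mul_zero]
      · simp
  · rintro ⟨j, rfl⟩
    ext i
    refine Fin.lastCases ?_ (fun i => ?_) i
    · rw [polyField_rationalPoly_last]
      exact Finset.prod_eq_zero (Finset.mem_univ j) (by simp)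
    · rw [polyField_rationalPoly_castSucc, axisPoint_castSucc]
      simp

/-- Off x_1 = 0 the first component kills the weighted sum, the last one then forces x_M = b_j x_1
for some j, and the surviving j-th summand is nonzero: a contradiction. On x_1 = 0 the last
component is (1 + ∑_j ν_1j) x_M^P, whence the condition on the sum. For P ≥ 2 every component
vanishes on x_1 = x_M = 0. -/
theorem polyField_pushPoly_eq_zero_iff {ν : Fin (n + 1) → Fin P → ℂ} {b : Fin P → ℂ}
    (hν : ∀ i j, ν i j ≠ 0) (hb : Function.Injective b) (hP : 2 ≤ P) (hN : ∑ j, ν 0 j ≠ -1)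
    (x : CSpace n) :
    polyField (pushPoly ν b) x = 0 ↔ x 0 = 0 ∧ x (Fin.last (n + 1)) = 0 := by
  have hcard : ∀ j : Fin P, (Finset.univ.erase j).card = P - 1 := fun j => by
    rw [Finset.card_erase_of_mem (Finset.mem_univ j), Finset.card_univ, Fintype.card_fin]
  constructor
  · intro h
    have hl := congrArg (fun v : CSpace n => v (Fin.last (n + 1))) h
    have h0 : x 0 * ∑ j, ν 0 j * coProd b j x = 0 :=
      (polyField_pushPoly_castSucc ν b x 0).symm.trans
        (congrArg (fun v : CSpace n => v (0 : Fin (n + 1)).castSucc) h)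
    simp only [polyField_pushPoly_last, PiLp.zero_apply, wt_zero] at hl
    have hx0 : x 0 = 0 := by
      by_contra hx0
      have hs := (mul_eq_zero.1 h0).resolve_left hx0
      rw [hs, mul_zero, zero_add] at hl
      obtain ⟨j, -, hj⟩ := Finset.prod_eq_zero_iff.1 hl
      rw [Finset.sum_eq_single j] at hs
      · refine (mul_ne_zero (hν 0 j) (Finset.prod_ne_zero_iff.2 fun j' hj' => ?_)) hs
        rw [sub_eq_zero.1 hj, ← sub_mul]
        exact mul_ne_zero (sub_ne_zero.2 fun e => Finset.ne_of_mem_erase hj' (hb e).symm) hx0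
      · intro j' _ hj'
        rw [coProd, Finset.prod_eq_zero (Finset.mem_erase.2 ⟨hj'.symm, Finset.mem_univ j⟩) hj,
          mul_zero]
      · simp
    refine ⟨hx0, ?_⟩
    simp only [coProd, fullProd, hx0, mul_zero, sub_zero, Finset.prod_const, hcard,
      Finset.card_univ, Fintype.card_fin, ← Finset.sum_mul] at hl
    by_contra hx
    obtain ⟨Q, rfl⟩ : ∃ Q, P = Q + 1 := ⟨P - 1, by omega⟩
    have : x (Fin.last (n + 1)) ^ (Q + 1) * (∑ j, ν 0 j + 1) = 0 := by
      rw [← hl, Nat.add_sub_cancel]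
      ring
    rcases mul_eq_zero.1 this with h | h
    · exact hx (pow_eq_zero_iff (Nat.succ_ne_zero Q) |>.1 h)
    · exact hN (eq_neg_of_add_eq_zero_left h)
  · rintro ⟨h0, hl⟩
    have hco : ∀ j, coProd b j x = 0 := fun j => by
      simp only [coProd, h0, hl, mul_zero, sub_zero, Finset.prod_const, hcard]
      exact zero_pow (by omega)
    have hfu : fullProd b x = 0 := by
      simp only [fullProd, h0, hl, mul_zero, sub_zero, Finset.prod_const, Finset.card_univ,
        Fintype.card_fin]
      exact zero_pow (by omega)
    ext i
    refine Fin.lastCases ?_ (fun i => ?_) i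
    · rw [polyField_pushPoly_last]
      simp [hl, hfu]
    · rw [polyField_pushPoly_castSucc]
      simp [hco]

/-- The coordinate plane spanned by the first and the last axis. -/
def endPlane (n : ℕ) : Submodule ℂ (CSpace n) :=
  Submodule.span ℂ {EuclideanSpace.single 0 1, EuclideanSpace.single (Fin.last (n + 1)) 1}

theorem finrank_endPlane : Module.finrank ℂ (endPlane n) = 2 := by
  have hli : LinearIndependent ℂ ((EuclideanSpace.basisFun (Fin (n + 2)) ℂ).toBasis ∘
      ![0, Fin.last (n + 1)]) :=
    (EuclideanSpace.basisFun (Fin (n + 2)) ℂ).toBasis.linearIndependent.comp _ (by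
      intro i j
      fin_cases i <;> fin_cases j <;> simp [Fin.ext_iff])
  have hr : Set.range ((EuclideanSpace.basisFun (Fin (n + 2)) ℂ).toBasis ∘ ![0, Fin.last (n + 1)]) =
      {EuclideanSpace.single 0 1, EuclideanSpace.single (Fin.last (n + 1)) 1} := by
    rw [Set.range_comp, Matrix.range_cons_cons_empty, Set.image_pair]
    simp
  have := finrank_span_eq_card hli
  rwa [hr, Fintype.card_fin] at this

theorem eq_zero_of_mem_endPlane {v : CSpace n} (hv : v ∈ endPlane n) (h0 : v 0 = 0)
    (hl : v (Fin.last (n + 1)) = 0) : v = 0 := by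
  obtain ⟨a, c, rfl⟩ := Submodule.mem_span_pair.1 hv
  simp at h0 hl
  simp [h0, hl]

/-- The foliation of `ℂ^M` defined by the rational system. -/
def rationalFoliation (ν : Fin (n + 1) → Fin P → ℂ) (b : Fin P → ℂ) (hν : ∀ i j, ν i j ≠ 0)
    (hb : Function.Injective b) : HolFoliation n where
  dir t := Submodule.span ℂ {polyField (rationalPoly ν b) t}
  locally_generated p := ⟨_, analyticAt_polyField _ p, Filter.Eventually.of_forall fun _ => rfl⟩
  codim_sing p _ := by
    refine ⟨endPlane n, finrank_endPlane, ?_⟩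
    have hfin : (Set.range fun j => axisPoint n (b j)).Finite := Set.finite_range _
    have hcl := (hfin.sdiff (t := {p})).isClosed.isOpen_compl.mem_nhds
      (show p ∈ ((Set.range fun j => axisPoint n (b j)) \ {p})ᶜ by simp)
    have hc : Filter.Tendsto (fun v : CSpace n => p + v) (𝓝 0) (𝓝 p) := by
      have : Continuous fun v : CSpace n => p + v := by fun_prop
      simpa using this.tendsto 0
    filter_upwards [(hc.eventually hcl).filter_mono nhdsWithin_le_nhds, self_mem_nhdsWithin]
      with v hv hv0 _ hbot
    rw [Submodule.span_singleton_eq_bot, polyField_rationalPoly_eq_zero_iff hν hb] at hbot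
    exact hv ⟨hbot, by simpa using hv0⟩

/-- The push-forward of the rational foliation by the blow-up map. -/
def pushFoliation (ν : Fin (n + 1) → Fin P → ℂ) (b : Fin P → ℂ) (hν : ∀ i j, ν i j ≠ 0)
    (hb : Function.Injective b) (hP : 2 ≤ P) (hN : ∑ j, ν 0 j ≠ -1) : HolFoliation n where
  dir x := Submodule.span ℂ {polyField (pushPoly ν b) x}
  locally_generated p := ⟨_, analyticAt_polyField _ p, Filter.Eventually.of_forall fun _ => rfl⟩
  codim_sing p hp := by
    refine ⟨endPlane n, finrank_endPlane, ?_⟩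
    rw [Submodule.span_singleton_eq_bot, polyField_pushPoly_eq_zero_iff hν hb hP hN] at hp
    filter_upwards [self_mem_nhdsWithin] with v hv0 hv hbot
    rw [Submodule.span_singleton_eq_bot, polyField_pushPoly_eq_zero_iff hν hb hP hN] at hbot
    simp only [PiLp.add_apply, hp.1, hp.2, zero_add] at hbot
    exact hv0 (eq_zero_of_mem_endPlane hv hbot.1 hbot.2)

theorem rationalFoliation_sing (ν : Fin (n + 1) → Fin P → ℂ) (b : Fin P → ℂ)
    (hν : ∀ i j, ν i j ≠ 0) (hb : Function.Injective b) :
    (rationalFoliation ν b hν hb).sing = Set.range fun j => axisPoint n (b j) := by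
  ext t
  change Submodule.span ℂ {_} = ⊥ ↔ _
  rw [Submodule.span_singleton_eq_bot, polyField_rationalPoly_eq_zero_iff hν hb]
  rfl

theorem mem_pushFoliation_sing {ν : Fin (n + 1) → Fin P → ℂ} {b : Fin P → ℂ}
    {hν : ∀ i j, ν i j ≠ 0} {hb : Function.Injective b} {hP : 2 ≤ P} {hN : ∑ j, ν 0 j ≠ -1}
    {x : CSpace n} :
    x ∈ (pushFoliation ν b hν hb hP hN).sing ↔ x 0 = 0 ∧ x (Fin.last (n + 1)) = 0 := by
  change Submodule.span ℂ {_} = ⊥ ↔ _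
  rw [Submodule.span_singleton_eq_bot, polyField_pushPoly_eq_zero_iff hν hb hP hN]

theorem rationalFoliation_dir {ν : Fin (n + 1) → Fin P → ℂ} {b : Fin P → ℂ}
    {hν : ∀ i j, ν i j ≠ 0} {hb : Function.Injective b} {t : CSpace n}
    (ht : ∀ j, t (Fin.last (n + 1)) ≠ b j) :
    (rationalFoliation ν b hν hb).dir t = Submodule.span ℂ {rationalField ν b t} := by
  change Submodule.span ℂ {_} = _
  rw [polyField_rationalPoly_eq_smul ν b ht]
  exact Submodule.span_singleton_smul_eq
    (Finset.prod_ne_zero_iff.2 fun j _ => sub_ne_zero.2 (ht j)).isUnit _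

theorem blowMap_zero (t : CSpace n) : blowMap t 0 = t 0 := by simp [blowMap]

theorem blowMap_of_ne (t : CSpace n) {i : Fin (n + 2)} (hi : i ≠ 0) : blowMap t i = t 0 * t i := by
  simp [blowMap, hi]

theorem blowMap_last (t : CSpace n) :
    blowMap t (Fin.last (n + 1)) = t 0 * t (Fin.last (n + 1)) :=
  blowMap_of_ne t (Fin.last_pos.ne')

theorem fderiv_blowMap (t v : CSpace n) (i : Fin (n + 2)) :
    fderiv ℂ blowMap t v i = if i = 0 then v 0 else v 0 * t i + t 0 * v i := by
  have hd : ∀ j : Fin (n + 2), HasFDerivAt (fun t : CSpace n => t j)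
      (EuclideanSpace.proj (𝕜 := ℂ) j : CSpace n →L[ℂ] ℂ) t :=
    fun j => (EuclideanSpace.proj (𝕜 := ℂ) j : CSpace n →L[ℂ] ℂ).hasFDerivAt
  have hdiff : DifferentiableAt ℂ (blowMap (n := n)) t := by
    rw [differentiableAt_euclidean]
    intro j
    by_cases hj : j = 0
    · simpa only [hj, blowMap_zero] using (hd 0).differentiableAt
    · simp only [blowMap_of_ne _ hj]
      exact (hd 0).differentiableAt.mul (hd j).differentiableAt
  have h1 := ((EuclideanSpace.proj (𝕜 := ℂ) i : CSpace n →L[ℂ] ℂ).hasFDerivAt.comp t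
    hdiff.hasFDerivAt)
  by_cases hi : i = 0
  · have h2 : HasFDerivAt (fun t : CSpace n => blowMap t i)
        (EuclideanSpace.proj (𝕜 := ℂ) 0 : CSpace n →L[ℂ] ℂ) t := by
      simpa only [hi, blowMap_zero] using hd 0
    have := DFunLike.congr_fun (h1.unique h2) v
    simpa [hi] using this
  · have h2 := (hd 0).mul (hd i)
    have h3 : HasFDerivAt (fun t : CSpace n => blowMap t i) _ t :=
      h2.congr_of_eventuallyEq (Filter.Eventually.of_forall fun s => blowMap_of_ne s hi)
    have : fderiv ℂ blowMap t v i = t 0 * v i + t i * v 0 := DFunLike.congr_fun (h1.unique h3) v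
    rw [this, if_neg hi]
    ring

/-- The two polynomial fields correspond up to the factor t_1^(P-1), invertible off the exceptional
divisor. The weights ν_1 + ν_i come from differentiating the product x_i = t_1 t_i. -/
theorem pushFoliation_dir_blowMap {ν : Fin (n + 1) → Fin P → ℂ} {b : Fin P → ℂ}
    {hν : ∀ i j, ν i j ≠ 0} {hb : Function.Injective b} {hP : 2 ≤ P} {hN : ∑ j, ν 0 j ≠ -1}
    {t : CSpace n} (ht : t 0 ≠ 0) :
    (pushFoliation ν b hν hb hP hN).dir (blowMap t) =
      ((rationalFoliation ν b hν hb).dir t).map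
        ((fderiv ℂ blowMap t : CSpace n →L[ℂ] CSpace n) : CSpace n →ₗ[ℂ] CSpace n) := by
  change Submodule.span ℂ {_} = (Submodule.span ℂ {_}).map _
  rw [Submodule.map_span, Set.image_singleton]
  obtain ⟨Q, rfl⟩ : ∃ Q, P = Q + 1 := ⟨P - 1, by omega⟩
  have hco : ∀ j, coProd b j (blowMap t) = t 0 ^ Q *
      ∏ j' ∈ Finset.univ.erase j, (t (Fin.last (n + 1)) - b j') := fun j => by
    simp only [coProd, blowMap_last, blowMap_zero]
    rw [Finset.prod_congr rfl fun j' _ =>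
      show t 0 * t (Fin.last (n + 1)) - b j' * t 0 = t 0 * (t (Fin.last (n + 1)) - b j') by ring,
      Finset.prod_mul_distrib, Finset.prod_const, Finset.card_erase_of_mem (Finset.mem_univ j)]
    simp
  have hfu : fullProd b (blowMap t) = t 0 ^ (Q + 1) * ∏ j, (t (Fin.last (n + 1)) - b j) :=
    (fullProd_eq b (z := t (Fin.last (n + 1))) (by rw [blowMap_last, blowMap_zero, mul_comm])).trans
      (by rw [blowMap_zero])
  have hsum : ∀ i, ∑ j, wt ν i j * coProd b j (blowMap t) = t 0 ^ Q * ∑ j, wt ν i j *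
      ∏ j' ∈ Finset.univ.erase j, (t (Fin.last (n + 1)) - b j') := fun i => by
    rw [Finset.mul_sum]
    refine Finset.sum_congr rfl fun j _ => ?_
    rw [hco]
    ring
  have key : polyField (pushPoly ν b) (blowMap t) =
      t 0 ^ Q • fderiv ℂ blowMap t (polyField (rationalPoly ν b) t) := by
    have h0 : polyField (rationalPoly ν b) t 0 = t 0 *
      ∑ j, ν 0 j * ∏ j' ∈ Finset.univ.erase j, (t (Fin.last (n + 1)) - b j') :=
      polyField_rationalPoly_castSucc ν b t 0
    ext i
    rw [PiLp.smul_apply, fderiv_blowMap, h0, smul_eq_mul]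
    refine Fin.lastCases ?_ (fun i => ?_) i
    · rw [polyField_pushPoly_last, hsum, hfu, polyField_rationalPoly_last, blowMap_last,
        if_neg Fin.last_pos.ne']
      simp only [wt_zero]
      ring
    · rw [polyField_pushPoly_castSucc, hsum, polyField_rationalPoly_castSucc]
      by_cases hi : i = 0
      · subst hi
        simp only [wt_zero, Fin.castSucc_zero, blowMap_zero, if_true]
        ring
      · have hi' : i.castSucc ≠ 0 := by simpa using hi
        rw [blowMap_of_ne _ hi', if_neg hi']
        simp only [wt_of_ne ν hi, add_mul, Finset.sum_add_distrib]
        ring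
  rw [key]
  exact Submodule.span_singleton_smul_eq (pow_ne_zero _ ht).isUnit _

end Model

/-! ### Choice of the nodes and of the weights -/

section Nodes

variable {n : ℕ}

open Polynomial

/-- Constant-weight logarithmic blocks: the fibres of a polynomial all of whose critical points of
order `k` lie over `0`. -/
theorem exists_flat_fibres (T : Finset ℂ) (k : ℕ) :
    ∃ R : ℕ → Finset ℂ, (∀ m m', m ≠ m' → Disjoint (R m) (R m')) ∧ (∀ m, Disjoint T (R m)) ∧
      (∀ m, k * T.card ≤ (R m).card) ∧ (∀ m, (R m).Nonempty) ∧
      ∀ m, ∀ τ ∈ T, (fun z => ∑ b ∈ R m, 1 / (z - b)) =O[𝓝[≠] τ] fun z => (z - τ) ^ k := by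
  classical
  -- The extra factor X makes Q nonconstant even when T is empty. The exponent k + 1 makes the
  -- derivative of q divisible by (X - τ)^k for each τ ∈ T.
  set Q : ℂ[X] := X * ∏ τ ∈ T, (X - C τ) with hQ
  set q : ℂ[X] := Q ^ (k + 1) with hq
  have hQm : Q.Monic := monic_X.mul (monic_prod_of_monic _ _ fun τ _ => monic_X_sub_C τ)
  have hqm : q.Monic := hQm.pow _
  have hdeg : q.natDegree = (k + 1) * (1 + T.card) := by
    rw [hq, natDegree_pow, hQ, monic_X.natDegree_mul (monic_prod_of_monic _ _ fun τ _ =>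
      monic_X_sub_C τ), natDegree_X, natDegree_prod_of_monic _ _ fun τ _ => monic_X_sub_C τ]
    simp
  have hder : derivative q ≠ 0 := by
    intro h
    have := derivative_eq_zero.1 h
    rw [hdeg] at this
    exact (Nat.mul_pos k.succ_pos (by omega)).ne' this
  -- Away from the critical values the fibres of q are simple; away from 0 they avoid T.
  set bad : Set ℂ := insert 0 ((fun z => q.eval z) '' {z | z ∈ (derivative q).roots}) with hbad
  have hfin : bad.Finite := by
    refine (Set.Finite.image _ ?_).insert 0
    exact (derivative q).roots.toFinset.finite_toSet.subset fun z hz => by simpa using hz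
  have hinf : badᶜ.Infinite := hfin.infinite_compl
  let c : ℕ → ℂ := fun m => hinf.natEmbedding _ m
  have hcinj : Function.Injective c := fun m m' h => (hinf.natEmbedding _).injective (Subtype.ext h)
  have hcbad : ∀ m, c m ∉ bad := fun m => (hinf.natEmbedding _ m).2
  have hc0 : ∀ m, c m ≠ 0 := fun m h => hcbad m (by rw [h]; exact Set.mem_insert _ _)
  have hdegc : ∀ m, (q - C (c m)).natDegree = (k + 1) * (1 + T.card) := fun m => by
    rw [natDegree_sub_C, hdeg]
  have hne : ∀ m, q - C (c m) ≠ 0 := fun m h => by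
    have := hdegc m
    rw [h, natDegree_zero] at this
    exact (Nat.mul_pos k.succ_pos (by omega)).ne this
  have hmem : ∀ m z, z ∈ (q - C (c m)).roots.toFinset ↔ q.eval z = c m := fun m z => by
    rw [Multiset.mem_toFinset, mem_roots (hne m)]
    simp [sub_eq_zero]
  have hnodup : ∀ m, (q - C (c m)).roots.Nodup := fun m => by
    rw [Multiset.nodup_iff_count_le_one]
    intro z
    rw [count_roots]
    by_contra hcon
    rw [not_le, one_lt_rootMultiplicity_iff_isRoot (hne m)] at hcon
    refine hcbad m (Set.mem_insert_of_mem _ ⟨z, ?_, ?_⟩)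
    · have h2 := hcon.2
      rw [derivative_sub, derivative_C, sub_zero] at h2
      exact (mem_roots hder).2 h2
    · have h1 := hcon.1
      rw [IsRoot.def, eval_sub, eval_C, sub_eq_zero] at h1
      exact h1
  have hcard : ∀ m, (q - C (c m)).roots.toFinset.card = (k + 1) * (1 + T.card) := fun m => by
    rw [Multiset.toFinset_card_of_nodup (hnodup m), ← hdegc m]
    exact (splits_iff_card_roots.1 (IsAlgClosed.splits (q - C (c m))))
  have hqT : ∀ τ ∈ T, q.eval τ = 0 := fun τ hτ => by
    rw [hq, hQ, eval_pow, eval_mul, eval_prod,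
      Finset.prod_eq_zero hτ (by simp : eval τ (X - C τ) = 0)]
    simp
  refine ⟨fun m => (q - C (c m)).roots.toFinset, fun m m' hmm => ?_, fun m => ?_, fun m => ?_,
    fun m => ?_, fun m τ hτ => ?_⟩
  · refine Finset.disjoint_left.2 fun z hz hz' => hmm (hcinj ?_)
    rw [← (hmem m z).1 hz, ← (hmem m' z).1 hz']
  · refine Finset.disjoint_left.2 fun z hz hz' => hc0 m ?_
    rw [← (hmem m z).1 hz', hqT z hz]
  · rw [hcard]
    nlinarith
  · rw [← Finset.card_pos, hcard]
    exact Nat.mul_pos k.succ_pos (by omega)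
  · have hev : ∀ᶠ z in 𝓝[≠] τ, eval z (q - C (c m)) ≠ 0 := by
      have h1 : ContinuousAt (fun z => eval z (q - C (c m))) τ := (q - C (c m)).continuous.continuousAt
      refine (h1.eventually_ne ?_).filter_mono nhdsWithin_le_nhds
      simp [hqT τ hτ, hc0 m]
    set W : ℂ[X] := X * ∏ τ' ∈ T.erase τ, (X - C τ') with hW
    have hfac : Q = (X - C τ) * W := by
      rw [hQ, hW, ← Finset.mul_prod_erase T _ hτ]
      ring
    -- The sum over a simple fibre is the logarithmic derivative q'/(q - c) = (k + 1) Q^k Q'/(q -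
    -- c), and Q^k contains (z - τ)^k.
    have heq : (fun z => ∑ b ∈ (q - C (c m)).roots.toFinset, 1 / (z - b)) =ᶠ[𝓝[≠] τ]
        fun z => (z - τ) ^ k *
          (((k : ℂ) + 1) * W.eval z ^ k * (derivative Q).eval z / eval z (q - C (c m))) := by
      filter_upwards [hev] with z hz
      have h1 := (IsAlgClosed.splits (q - C (c m))).eval_derivative_div_eval_of_ne_zero hz
      rw [Finset.sum, Multiset.toFinset_val, (hnodup m).dedup, ← h1, derivative_sub, derivative_C,
        sub_zero, hq, derivative_pow, ← hq]
      have h2 : Q.eval z = (z - τ) * W.eval z := by rw [hfac]; simp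
      simp only [eval_mul, eval_C, eval_pow, h2, Nat.add_sub_cancel, mul_pow]
      push_cast
      ring
    refine heq.trans_isBigO ?_
    have hcts : ContinuousAt (fun z => ((k : ℂ) + 1) * W.eval z ^ k * (derivative Q).eval z /
        eval z (q - C (c m))) τ := by
      refine ContinuousAt.div ?_ (q - C (c m)).continuous.continuousAt ?_
      · exact ((continuous_const.mul (W.continuous.pow k)).mul
          (derivative Q).continuous).continuousAt
      · simp [hqT τ hτ, hc0 m]
    have := (Asymptotics.isBigO_refl (fun z : ℂ => (z - τ) ^ k) (𝓝[≠] τ)).mul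
      ((hcts.mono_left nhdsWithin_le_nhds).isBigO_one ℂ)
    simpa using this

/-- Weights with prescribed values on `T` and a regular part vanishing to order `k` on `T`. -/
theorem exists_flat_weights (T R : Finset ℂ) (k : ℕ) (hd : Disjoint T R)
    (hcard : k * T.card ≤ R.card) (g : ℂ → ℂ) :
    ∃ w : ℂ → ℂ, (∀ τ ∈ T, w τ = g τ) ∧ ∀ τ ∈ T,
      (fun z => ∑ b ∈ (T ∪ R).erase τ, w b / (z - b)) =O[𝓝[≠] τ] fun z => (z - τ) ^ k := by
  classical
  set s := T ∪ R with hs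
  -- The fraction H / `nodal s` has residue `nodalWeight` · H(b) at b. Subtracting g(τ)/(z - τ)
  -- leaves a function vanishing to order k at τ as soon as H ≡ g(τ) · `nodal (s.erase τ)` modulo (X
  -- - τ)^(k+1). The Chinese remainder theorem solves these congruences simultaneously.
  let I : {τ // τ ∈ T} → Ideal ℂ[X] := fun τ => Ideal.span {(X - C (τ : ℂ)) ^ (k + 1)}
  have hI : Pairwise (Function.onFun IsCoprime I) := by
    intro τ τ' hne
    change IsCoprime (Ideal.span {_}) (Ideal.span {_})
    rw [Ideal.isCoprime_span_singleton_iff]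
    refine IsCoprime.pow (isCoprime_X_sub_C_of_isUnit_sub ?_)
    exact (sub_ne_zero.2 fun h => hne (Subtype.ext h)).isUnit
  obtain ⟨H₀, hH₀⟩ := Ideal.exists_forall_sub_mem_ideal hI
    (fun τ => C (g τ) * Lagrange.nodal (s.erase (τ : ℂ)) id)
  set M : ℂ[X] := ∏ τ ∈ T, (X - C τ) ^ (k + 1) with hM
  have hMm : M.Monic := monic_prod_of_monic _ _ fun τ _ => (monic_X_sub_C τ).pow _
  have hMd : M.natDegree = T.card * (k + 1) := by
    rw [hM, natDegree_prod_of_monic _ _ fun τ _ => (monic_X_sub_C τ).pow _]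
    simp
  -- Reduction modulo M keeps the congruences and brings the degree below (k + 1)|T| ≤ |T| + |R| =
  -- |s|, so that H is recovered from its values on s.
  set H := H₀ %ₘ M with hH
  have hscard : s.card = T.card + R.card := Finset.card_union_of_disjoint hd
  have hdegH : H.degree < s.card := by
    refine (degree_modByMonic_lt _ hMm).trans_le ?_
    rw [degree_eq_natDegree hMm.ne_zero, hMd, hscard]
    norm_cast
    nlinarith
  have hdvd : ∀ τ ∈ T, (X - C τ) ^ (k + 1) ∣ H - C (g τ) * Lagrange.nodal (s.erase τ) id := by
    intro τ hτ
    have h1 : (X - C τ) ^ (k + 1) ∣ H₀ - C (g τ) * Lagrange.nodal (s.erase τ) id :=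
      Ideal.mem_span_singleton.1 (hH₀ ⟨τ, hτ⟩)
    have h2 : (X - C τ) ^ (k + 1) ∣ H₀ - H := by
      have e : H₀ - H = M * (H₀ /ₘ M) := by
        rw [sub_eq_iff_eq_add', hH, modByMonic_add_div]
      rw [e]
      exact (Finset.dvd_prod_of_mem (fun τ => (X - C τ) ^ (k + 1)) hτ).mul_right _
    have := h1.sub h2
    simpa using this
  have hint : H = Lagrange.interpolate s id fun i => H.eval (id i) :=
    Lagrange.eq_interpolate (Function.injective_id.injOn) hdegH
  have hnod : ∀ τ, eval τ (Lagrange.nodal (s.erase τ) id) ≠ 0 := fun τ =>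
    Lagrange.eval_nodal_not_at_node fun b hb => (Finset.ne_of_mem_erase hb).symm
  have hwT : ∀ τ ∈ T, Lagrange.nodalWeight s id τ * H.eval τ = g τ := by
    intro τ hτ
    obtain ⟨W, hW⟩ := hdvd τ hτ
    have hev : H.eval τ = g τ * eval τ (Lagrange.nodal (s.erase τ) id) := by
      rw [sub_eq_iff_eq_add] at hW
      rw [hW]
      simp
    rw [Lagrange.nodalWeight_eq_eval_nodal_erase_inv, hev]
    simp only [id]
    have := hnod τ
    field_simp
  refine ⟨fun b => Lagrange.nodalWeight s id b * H.eval b, hwT, fun τ hτ => ?_⟩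
  obtain ⟨W, hW⟩ := hdvd τ hτ
  have hτs : τ ∈ s := Finset.mem_union_left _ hτ
  have hev : ∀ᶠ z in 𝓝[≠] τ, ∀ i ∈ s, z ≠ id i := by
    have h1 : ((s.erase τ : Finset ℂ) : Set ℂ)ᶜ ∈ 𝓝 τ :=
      (s.erase τ).finite_toSet.isClosed.isOpen_compl.mem_nhds (by simp)
    filter_upwards [nhdsWithin_le_nhds h1, self_mem_nhdsWithin] with z hz hz' i hi e
    subst e
    exact hz (Finset.mem_coe.2 (Finset.mem_erase.2 ⟨hz', hi⟩))
  have heq : (fun z => ∑ b ∈ s.erase τ, Lagrange.nodalWeight s id b * H.eval b / (z - b))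
      =ᶠ[𝓝[≠] τ] fun z => (z - τ) ^ k * (W.eval z / eval z (Lagrange.nodal (s.erase τ) id)) := by
    filter_upwards [hev] with z hz
    have h1 := Lagrange.eval_interpolate_not_at_node (fun i => H.eval (id i)) hz
    rw [← hint, Lagrange.nodal_eq_mul_nodal_erase hτs, ← Finset.add_sum_erase _ _ hτs] at h1
    have h2 : eval z H = g τ * eval z (Lagrange.nodal (s.erase τ) id) +
        (z - τ) ^ (k + 1) * W.eval z := by
      rw [sub_eq_iff_eq_add] at hW
      rw [hW]
      simp [add_comm]
    have h3 : eval z (Lagrange.nodal (s.erase τ) id) ≠ 0 :=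
      Lagrange.eval_nodal_not_at_node fun b hb => hz b (Finset.mem_of_mem_erase hb)
    have h4 : z - τ ≠ 0 := sub_ne_zero.2 (hz τ hτs)
    have h5 : ∑ b ∈ s.erase τ, Lagrange.nodalWeight s id b * H.eval b / (z - b) =
        ∑ b ∈ s.erase τ, Lagrange.nodalWeight s id b * (z - id b)⁻¹ * H.eval (id b) := by
      refine Finset.sum_congr rfl fun b _ => ?_
      simp only [id]
      ring
    rw [h5]
    have h6 : Lagrange.nodalWeight s id τ * (z - id τ)⁻¹ * H.eval (id τ) = g τ * (z - τ)⁻¹ := by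
      rw [← hwT τ hτ]
      simp only [id]
      ring
    rw [h6, h2, eval_mul] at h1
    simp only [id, eval_sub, eval_X, eval_C] at h1
    simp only [id]
    have h7 : (z - τ) * (eval z (Lagrange.nodal (s.erase τ) id) *
        ∑ b ∈ s.erase τ, Lagrange.nodalWeight s id b * (z - b)⁻¹ * H.eval b) =
        (z - τ) * ((z - τ) ^ k * W.eval z) := by
      have h8 : (z - τ) * (z - τ)⁻¹ = 1 := mul_inv_cancel₀ h4
      linear_combination -h1 - g τ * eval z (Lagrange.nodal (s.erase τ) id) * h8
    have h9 := mul_left_cancel₀ h4 h7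
    field_simp
    rw [← h9]
    simp only [mul_comm]
    field_simp
  refine heq.trans_isBigO ?_
  have hcts : ContinuousAt (fun z => W.eval z / eval z (Lagrange.nodal (s.erase τ) id)) τ :=
    W.continuous.continuousAt.div (Lagrange.nodal (s.erase τ) id).continuous.continuousAt (hnod τ)
  have := (Asymptotics.isBigO_refl (fun z : ℂ => (z - τ) ^ k) (𝓝[≠] τ)).mul
    ((hcts.mono_left nhdsWithin_le_nhds).isBigO_one ℂ)
  simpa using this

/-- The real numbers used to generate a dense group of monodromies. -/
def denseGen : Fin 3 → ℂ := ![(Real.sqrt 2 : ℂ), Complex.I, Real.sqrt 2 * Complex.I]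

/-- The open cone `|Re z| < Im z`. -/
def InCone (z : ℂ) : Prop := |z.re| < z.im

theorem InCone.add {z w : ℂ} (hz : InCone z) (hw : InCone w) : InCone (z + w) := by
  have := abs_add_le z.re w.re
  simp only [InCone, Complex.add_re, Complex.add_im] at *
  linarith

theorem InCone.ne_zero {z : ℂ} (hz : InCone z) : z ≠ 0 := by
  rintro rfl
  simp [InCone] at hz

/-- The direction i is interior to the cone, so a large multiple of it absorbs any constant. -/
theorem eventually_inCone (c : ℂ) {m : ℝ} (hm : 0 < m) :
    ∀ᶠ s : ℝ in Filter.atTop, InCone (c + m * (s * Complex.I)) := by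
  filter_upwards [Filter.eventually_gt_atTop ((|c.re| - c.im) / m)] with s hs
  rw [div_lt_iff₀ hm] at hs
  simp [InCone]
  linarith

/-- The perturbations of the weights that move a single coordinate weight `ρ_i`. -/
def blockPert (i₀ : Fin (n + 1)) (a : ℂ) (i : Fin (n + 1)) : ℂ :=
  -- When i₀ = 0, changing ν_1 alone would shift every ρ_i = ν_1 + ν_i; the value -a on the other
  -- indices compensates for this.
  if i₀ = 0 then (if i = 0 then a else -a) else if i = i₀ then a else 0

/-- The point 3i is farther than √2 from the boundary of the cone, and the perturbations have
modulus at most √2. -/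
theorem inCone_blockPert (i₀ : Fin (n + 1)) (a : Fin 3) (i : Fin (n + 1)) :
    InCone (3 * Complex.I + blockPert i₀ (denseGen a) i) := by
  have h2 : Real.sqrt 2 < 3 := by
    rw [Real.sqrt_lt' (by norm_num)]
    norm_num
  have h0 := Real.sqrt_nonneg 2
  have key : InCone (3 * Complex.I + denseGen a) ∧ InCone (3 * Complex.I + -denseGen a) ∧
      InCone (3 * Complex.I + 0) := by
    fin_cases a <;> simp [InCone, denseGen, abs_of_nonneg h0] <;> (try constructor) <;> linarith
  unfold blockPert
  split_ifs
  exacts [key.1, key.2.1, key.1, key.2.2]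

/-- The nodes are T with the prescribed residues; a block `R none`, whose weights correct the
regular parts at T and carry a free constant s i; a reference block with constant weight 3i; and,
for each pair (i₀, a), a block whose weights differ from the reference only by `denseGen a` in
ρ_{i₀}. Constant weights on the fibres of `exists_flat_fibres` never spoil the flatness at T, which
leaves s and the perturbations free. -/
theorem exists_nodes (T : Finset ℂ) (lam : {τ : ℂ // τ ∈ T} → Fin (n + 2) → ℂ)
    (hlam : ∀ τ i, lam τ i ≠ 0) (k : ℕ) :
    ∃ (P : ℕ) (ν : Fin (n + 1) → Fin P → ℂ) (b : Fin P → ℂ),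
      (∀ i j, ν i j ≠ 0) ∧ Function.Injective b ∧ 2 ≤ P ∧
      (∀ τ : {τ : ℂ // τ ∈ T}, ∃ j, b j = τ ∧
        (∀ i, ν i j = lam τ i.castSucc / lam τ (Fin.last (n + 1))) ∧
        ∀ i, (fun z => ∑ j' ∈ Finset.univ.erase j, ν i j' / (z - b j')) =O[𝓝[≠] (τ : ℂ)]
          fun z => (z - τ) ^ k) ∧
      (∀ j, b j ∉ T → ∀ i, InCone (ν i j)) ∧ (∀ i, InCone (∑ j, ν i j)) ∧
      ∀ i₀ a, ∃ j j', ∀ i, wt ν i j - wt ν i j' = if i = i₀ then denseGen a else 0 := by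
  classical
  obtain ⟨R₀, hRd₀, hRT₀, hRc₀, hRn₀, hRf₀⟩ := exists_flat_fibres T k
  set R : Option (Option (Fin (n + 1) × Fin 3)) → Finset ℂ := fun x => R₀ (Encodable.encode x) with hR
  have hRd : ∀ x y, x ≠ y → Disjoint (R x) (R y) := fun x y h =>
    hRd₀ _ _ fun e => h (Encodable.encode_injective e)
  set g : Fin (n + 1) → ℂ → ℂ := fun i z => if h : z ∈ T then
    lam ⟨z, h⟩ i.castSucc / lam ⟨z, h⟩ (Fin.last (n + 1)) else 0 with hg
  choose w hwT hwf using fun i => exists_flat_weights T (R none) k (hRT₀ _) (hRc₀ _) (g i)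
  -- the nodes
  let J := {τ : ℂ // τ ∈ T} ⊕ Σ x, {z : ℂ // z ∈ R x}
  let B : J → ℂ := Sum.elim (fun τ => τ) fun p => p.2
  let N : ℝ → Fin (n + 1) → J → ℂ := fun s i => Sum.elim (fun τ => g i τ) fun p =>
    match p with
    | ⟨none, z⟩ => w i z + s * Complex.I
    | ⟨some none, _⟩ => 3 * Complex.I
    | ⟨some (some y), _⟩ => 3 * Complex.I + blockPert y.1 (denseGen y.2) i
  have hB : Function.Injective B := by
    rintro (τ | ⟨x, z⟩) (τ' | ⟨x', z'⟩) h
    · exact congrArg Sum.inl (Subtype.ext h)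
    · exact absurd z'.2 (Finset.disjoint_left.1 (hRT₀ _) 
        (show (z' : ℂ) ∈ T by rw [← show (τ : ℂ) = z' from h]; exact τ.2))
    · exact absurd z.2 (Finset.disjoint_left.1 (hRT₀ _)
        (show (z : ℂ) ∈ T by rw [show (z : ℂ) = τ' from h]; exact τ'.2))
    · have hzz : (z : ℂ) = z' := h
      have hx : x = x' := by
        by_contra hne
        exact Finset.disjoint_left.1 (hRd x x' hne) z.2 (hzz ▸ z'.2)
      subst hx
      rw [Subtype.ext hzz]
  -- choice of the size of the special block
  have hcardpos : (0 : ℝ) < (R none).card := Nat.cast_pos.2 (Finset.card_pos.2 (hRn₀ _))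
  have hNsum : ∀ s i, ∑ j, N s i j = ∑ j, N 0 i j + ((R none).card : ℝ) * (s * Complex.I) := by
    intro s i
    simp only [J, Fintype.sum_sum_type, Fintype.sum_sigma, Fintype.sum_option, N, Sum.elim_inl,
      Sum.elim_inr, Finset.sum_add_distrib, Finset.sum_const, Finset.card_univ, Fintype.card_coe]
    simp
    ring
  -- The residues at T are imposed and may lie outside the cone. A large s brings the total sums
  -- into the cone, as well as every weight of the block `R none`.
  obtain ⟨s, hs1, hs2⟩ : ∃ s : ℝ, (∀ i, InCone (∑ j, N s i j)) ∧
      ∀ i (z : {z : ℂ // z ∈ R none}), InCone (w i z + s * Complex.I) := by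
    refine Filter.Eventually.exists (f := Filter.atTop) ?_
    refine Filter.Eventually.and ?_ ?_
    · refine Filter.eventually_all.2 fun i => ?_
      filter_upwards [eventually_inCone (∑ j, N 0 i j) hcardpos] with s hs
      rw [hNsum]
      exact hs
    · refine Filter.eventually_all.2 fun i => Filter.eventually_all.2 fun z => ?_
      simpa using eventually_inCone (w i z) one_pos
  have hcone3 : InCone (3 * Complex.I) := by simp [InCone]
  have hcone : ∀ i p, InCone (N s i (Sum.inr p)) := by
    rintro i ⟨_ | _ | y, z⟩
    · exact hs2 i z
    · exact hcone3
    · exact inCone_blockPert _ _ _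
  have hNT : ∀ i τ, N s i (Sum.inl τ) = lam τ i.castSucc / lam τ (Fin.last (n + 1)) := fun i τ => by
    simp [N, hg]
  have hN0 : ∀ i j, N s i j ≠ 0 := by
    rintro i (τ | p)
    · rw [hNT]
      exact div_ne_zero (hlam _ _) (hlam _ _)
    · exact (hcone i p).ne_zero
  have hflat : ∀ (τ : {τ : ℂ // τ ∈ T}) i,
      (fun z => ∑ j ∈ Finset.univ.erase (Sum.inl τ : J), N s i j / (z - B j)) =O[𝓝[≠] (τ : ℂ)]
          fun z => (z - τ) ^ k := by
    intro τ i
    -- Regrouping into the interpolated part and the constant-weight blocks, each of which is flat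
    -- at τ.
    have hsplit : ∀ z : ℂ, ∑ j ∈ Finset.univ.erase (Sum.inl τ : J), N s i j / (z - B j) =
        ∑ b ∈ (T ∪ R none).erase τ, w i b / (z - b) +
        (s * Complex.I) * ∑ b ∈ R none, 1 / (z - b) +
        (3 * Complex.I * ∑ b ∈ R (some none), 1 / (z - b) +
        ∑ y, (3 * Complex.I + blockPert y.1 (denseGen y.2) i) *
          ∑ b ∈ R (some (some y)), 1 / (z - b)) := by
      intro z
      have hτ : (τ : ℂ) ∈ T ∪ R none := Finset.mem_union_left _ τ.2
      have hT : ∑ b ∈ T, w i b / (z - b) = ∑ t : {τ : ℂ // τ ∈ T}, g i t / (z - t) := by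
        rw [← Finset.sum_coe_sort T]
        exact Finset.sum_congr rfl fun t _ => by rw [hwT i t t.2]
      rw [Finset.sum_erase_eq_sub (Finset.mem_univ _), Finset.sum_erase_eq_sub hτ,
        Finset.sum_union (hRT₀ _), hT, hwT i τ τ.2,
        ← Finset.sum_coe_sort (R none) fun b => w i b / (z - b)]
      simp only [J, Fintype.sum_sum_type, Fintype.sum_sigma, Fintype.sum_option, N, B,
        Sum.elim_inl, Sum.elim_inr, add_div, Finset.sum_add_distrib, Finset.mul_sum, add_mul]
      simp only [← Finset.sum_coe_sort (R _), mul_one_div]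
      ring
    simp only [hsplit]
    have hc : ∀ (c : ℂ) x, (fun z => c * ∑ b ∈ R x, 1 / (z - b)) =O[𝓝[≠] (τ : ℂ)]
        fun z => (z - τ) ^ k := fun c x => (hRf₀ _ τ τ.2).const_mul_left c
    exact ((hwf i τ τ.2).add (hc _ _)).add ((hc _ _).add
      (Asymptotics.IsBigO.fun_sum fun y _ => hc _ _))
  let e : J ≃ Fin (Fintype.card J) := Fintype.equivFin J
  have hgen : ∀ i₀ a, ∃ j j' : J, ∀ i, wt (fun i j => N s i (e.symm j)) i (e j) -
      wt (fun i j => N s i (e.symm j)) i (e j') = if i = i₀ then denseGen a else 0 := by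
    intro i₀ a
    obtain ⟨z, hz⟩ := hRn₀ (Encodable.encode (some (some (i₀, a)) :
      Option (Option (Fin (n + 1) × Fin 3))))
    obtain ⟨z', hz'⟩ := hRn₀ (Encodable.encode (some none : Option (Option (Fin (n + 1) × Fin 3))))
    refine ⟨Sum.inr ⟨some (some (i₀, a)), ⟨z, hz⟩⟩, Sum.inr ⟨some none, ⟨z', hz'⟩⟩, fun i => ?_⟩
    by_cases hi : i = 0 <;> by_cases h0 : i₀ = 0
    · subst hi h0
      simp [wt, N, blockPert]
    · subst hi
      simp [wt, N, blockPert, h0, Ne.symm h0]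
    · subst h0
      simp only [wt, N, blockPert, hi]
      simp
      ring
    · simp only [wt, N, blockPert, hi]
      simp [h0, Ne.symm h0]
  refine ⟨Fintype.card J, fun i j => N s i (e.symm j), fun j => B (e.symm j), fun i j => hN0 _ _,
    hB.comp e.symm.injective, ?_, fun τ => ⟨e (Sum.inl τ), ?_, fun i => ?_, fun i => ?_⟩,
    fun j hj i => ?_, fun i => ?_, fun i₀ a => ?_⟩
  · obtain ⟨j, j', h⟩ := hgen 0 1
    have hne : j ≠ j' := by
      rintro rfl
      exact absurd (h 0).symm (by simp [denseGen])
    exact Fintype.one_lt_card_iff.2 ⟨j, j', hne⟩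
  · simp [B]
  · simp only [Equiv.symm_apply_apply]
    exact hNT i τ
  · refine Asymptotics.IsBigO.congr_left (hflat τ i) fun z => ?_
    refine Finset.sum_equiv e (fun j => ?_) fun j _ => by simp only [Equiv.symm_apply_apply]
    simp only [Finset.mem_erase, e.injective.ne_iff, Finset.mem_univ]
  · have : ∀ x : J, B x ∉ T → InCone (N s i x) := by
      rintro (τ | p) hx
      · exact absurd τ.2 hx
      · exact hcone i p
    exact this _ hj
  · have h := hs1 i
    rwa [← Equiv.sum_comp e.symm] at h
  · obtain ⟨j, j', h⟩ := hgen i₀ a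
    exact ⟨e j, e j', h⟩

end Nodes

/-! ### Linearization at the nodes of T -/

section Linearization

variable {n P : ℕ}

/-- The part of `∑_j ν_ij / (z - b_j)` that is regular at `b_j`. -/
def regPart (ν : Fin (n + 1) → Fin P → ℂ) (b : Fin P → ℂ) (j : Fin P) (i : Fin (n + 1)) (z : ℂ) : ℂ :=
  ∑ j' ∈ Finset.univ.erase j, ν i j' / (z - b j')

/-- The primitive of the regular part that vanishes at the node. -/
def regPrim (ν : Fin (n + 1) → Fin P → ℂ) (b : Fin P → ℂ) (j : Fin P) (i : Fin (n + 1)) (u : ℂ) : ℂ :=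
  ∑ j' ∈ Finset.univ.erase j, ν i j' * Complex.log (1 + u / (b j - b j'))

/-- The linearizing map at a node. -/
def linMap (ν : Fin (n + 1) → Fin P → ℂ) (b : Fin P → ℂ) (j : Fin P) (s : CSpace n) : CSpace n :=
  WithLp.toLp 2 (Fin.snoc (α := fun _ => ℂ)
    (fun i => s i.castSucc * Complex.exp (regPrim ν b j i (s (Fin.last (n + 1)))))
    (s (Fin.last (n + 1))))

/-- The domain of the primitives. -/
def SlitAt (b : Fin P → ℂ) (j : Fin P) (u : ℂ) : Prop :=
  ∀ j' ∈ Finset.univ.erase j, 1 + u / (b j - b j') ∈ Complex.slitPlane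

variable {ν : Fin (n + 1) → Fin P → ℂ} {b : Fin P → ℂ} {j : Fin P}

theorem linMap_castSucc (s : CSpace n) (i : Fin (n + 1)) : linMap ν b j s i.castSucc =
    s i.castSucc * Complex.exp (regPrim ν b j i (s (Fin.last (n + 1)))) := by
  simp [linMap]

theorem linMap_last (s : CSpace n) :
    linMap ν b j s (Fin.last (n + 1)) = s (Fin.last (n + 1)) := by
  simp [linMap]

theorem eventually_slitAt : ∀ᶠ u in 𝓝 (0 : ℂ), SlitAt b j u := by
  refine (Filter.eventually_all_finset _).2 fun j' _ => ?_
  have hc : ContinuousAt (fun u : ℂ => 1 + u / (b j - b j')) 0 := by fun_prop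
  refine hc.eventually_mem (Complex.isOpen_slitPlane.mem_nhds ?_)
  simp

theorem sub_ne_zero_of_slitAt (hb : Function.Injective b) {u : ℂ} (hu : SlitAt b j u) {j' : Fin P}
    (hj : j' ∈ Finset.univ.erase j) : b j + u - b j' ≠ 0 := by
  have h1 : b j - b j' ≠ 0 := sub_ne_zero.2 fun e => Finset.ne_of_mem_erase hj (hb e).symm
  have h2 := Complex.slitPlane_ne_zero (hu j' hj)
  intro h
  refine h2 ?_
  field_simp
  linear_combination h

theorem hasDerivAt_regPrim (hb : Function.Injective b) (i : Fin (n + 1)) {u : ℂ}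
    (hu : SlitAt b j u) : HasDerivAt (regPrim ν b j i) (regPart ν b j i (b j + u)) u := by
  refine HasDerivAt.fun_sum fun j' hj => ?_
  have h1 : b j - b j' ≠ 0 := sub_ne_zero.2 fun e => Finset.ne_of_mem_erase hj (hb e).symm
  have h2 := Complex.slitPlane_ne_zero (hu j' hj)
  have h3 := sub_ne_zero_of_slitAt hb hu hj
  have h4 : HasDerivAt (fun u : ℂ => 1 + u / (b j - b j')) (1 / (b j - b j')) u :=
    ((hasDerivAt_id u).div_const _).const_add 1
  have e : 1 + u / (b j - b j') = (b j + u - b j') / (b j - b j') := by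
    field_simp
    ring
  refine ((h4.clog (hu j' hj)).const_mul (ν i j')).congr_deriv ?_
  rw [e, div_div_div_cancel_right₀ h1, mul_one_div]

theorem regPrim_zero (i : Fin (n + 1)) : regPrim ν b j i 0 = 0 := by simp [regPrim]

/-- Integration raises the order of vanishing by one, through the mean value inequality on the
closed disc of radius |u|. -/
theorem isBigO_regPrim (hb : Function.Injective b) {k : ℕ} (i : Fin (n + 1))
    (h : regPart ν b j i =O[𝓝[≠] (b j)] fun z => (z - b j) ^ k) :
    regPrim ν b j i =O[𝓝 0] fun u => u ^ (k + 1) := by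
  obtain ⟨C, hC⟩ := h.bound
  have hC' : ∀ᶠ u in 𝓝[≠] (0 : ℂ), ‖regPart ν b j i (b j + u)‖ ≤ C * ‖u ^ k‖ := by
    have ht : Filter.Tendsto (fun u : ℂ => b j + u) (𝓝[≠] 0) (𝓝[≠] (b j)) := by
      refine tendsto_nhdsWithin_iff.2 ⟨?_, ?_⟩
      · have : Continuous fun u : ℂ => b j + u := by fun_prop
        simpa using (this.tendsto 0).mono_left (nhdsWithin_le_nhds (s := {0}ᶜ))
      · filter_upwards [self_mem_nhdsWithin] with u hu
        simpa using hu
    simpa using ht.eventually hC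
  have hcont : ContinuousAt (fun u => regPart ν b j i (b j + u)) 0 := by
    refine tendsto_finsetSum _ fun j' hj => ?_
    refine ContinuousAt.div (by fun_prop) (by fun_prop) ?_
    exact sub_ne_zero_of_slitAt hb eventually_slitAt.self_of_nhds hj
  -- The hypothesis says nothing at the node itself; continuity of the regular part extends the
  -- bound there.
  have h0 : ‖regPart ν b j i (b j + 0)‖ ≤ C * ‖(0 : ℂ) ^ k‖ := by
    have hr : ContinuousAt (fun u : ℂ => C * ‖u ^ k‖) 0 := by fun_prop
    exact le_of_tendsto_of_tendsto (hcont.norm.mono_left (nhdsWithin_le_nhds (s := {0}ᶜ)))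
      (hr.mono_left nhdsWithin_le_nhds) hC'
  have hC0 : ∀ᶠ u in 𝓝 (0 : ℂ), ‖regPart ν b j i (b j + u)‖ ≤ C * ‖u ^ k‖ := by
    rw [eventually_nhdsWithin_iff] at hC'
    filter_upwards [hC'] with u hu
    by_cases hu0 : u = 0
    · rw [hu0]
      exact h0
    · exact hu hu0
  obtain ⟨δ, hδ, hball⟩ := Metric.eventually_nhds_iff.1 (hC0.and (eventually_slitAt (b := b) (j := j)))
  refine Asymptotics.IsBigO.of_bound |C| ?_
  filter_upwards [Metric.ball_mem_nhds (0 : ℂ) hδ] with u hu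
  have hmem : ∀ x ∈ Metric.closedBall (0 : ℂ) ‖u‖, dist x 0 < δ := fun x hx =>
    lt_of_le_of_lt (Metric.mem_closedBall.1 hx) (by simpa using hu)
  have := (convex_closedBall (0 : ℂ) ‖u‖).norm_image_sub_le_of_norm_hasDerivWithin_le
    (f := regPrim ν b j i) (C := |C| * ‖u‖ ^ k) (x := 0) (y := u)
    (fun x hx => (hasDerivAt_regPrim hb i (hball (hmem x hx)).2).hasDerivWithinAt)
    (fun x hx => by
      refine ((hball (hmem x hx)).1).trans ?_
      rw [norm_pow]
      have hx' : ‖x‖ ≤ ‖u‖ := by simpa using hx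
      exact mul_le_mul (le_abs_self C) (pow_le_pow_left₀ (norm_nonneg _) hx' k)
        (by positivity) (abs_nonneg C))
    (by simp) (by simp)
  rw [regPrim_zero, sub_zero, sub_zero] at this
  rw [norm_pow, pow_succ, ← mul_assoc]
  exact this

/-- Each coordinate of the difference but the last, which is 0, is s_i (exp(`regPrim`) - 1): one
order from s_i and k + 1 orders from the primitive. The order k + 2, one more than tangency
requires, makes the derivative at 0 the identity even when k = 0. -/
theorem isBigO_linMap_sub (hb : Function.Injective b) {k : ℕ}
    (h : ∀ i, regPart ν b j i =O[𝓝[≠] (b j)] fun z => (z - b j) ^ k) :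
    (fun s => linMap ν b j s - s) =O[𝓝 0] fun s : CSpace n => ‖s‖ ^ (k + 2) := by
  have hpi : (fun s : CSpace n => fun i => (linMap ν b j s - s) i) =O[𝓝 0]
      fun s : CSpace n => ‖s‖ ^ (k + 2) := by
    rw [Asymptotics.isBigO_pi]
    intro i
    have hcoord : ∀ i, (fun s : CSpace n => s i) =O[𝓝 0] fun s : CSpace n => ‖s‖ := fun i =>
      Asymptotics.IsBigO.of_bound 1 (Filter.Eventually.of_forall fun s => by
        simpa using PiLp.norm_apply_le s i)
    refine Fin.lastCases ?_ (fun i => ?_) i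
    · simp only [PiLp.sub_apply, linMap_last, sub_self]
      exact Asymptotics.isBigO_zero _ _
    · have hlast : Filter.Tendsto (fun s : CSpace n => s (Fin.last (n + 1))) (𝓝 0) (𝓝 0) := by
        have : Continuous fun s : CSpace n => s (Fin.last (n + 1)) := by fun_prop
        simpa using this.tendsto 0
      have h1 := isBigO_regPrim hb i (h i)
      have h2 : Filter.Tendsto (regPrim ν b j i) (𝓝 0) (𝓝 0) := by
        have := (hasDerivAt_regPrim (ν := ν) hb i
          (eventually_slitAt (b := b) (j := j)).self_of_nhds).continuousAt.tendsto
        rwa [regPrim_zero] at this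
      have h3 : (fun u => Complex.exp (regPrim ν b j i u) - 1) =O[𝓝 0] fun u => u ^ (k + 1) := by
        have := (Complex.hasDerivAt_exp 0).isBigO_sub
        simp only [Complex.exp_zero, sub_zero] at this
        exact (this.comp_tendsto h2).trans h1
      have h4 := (hcoord i.castSucc).mul ((h3.comp_tendsto hlast).trans
        ((hcoord (Fin.last (n + 1))).pow (k + 1)))
      refine (h4.congr_left fun s => ?_).trans_eventuallyEq ?_
      · simp only [PiLp.sub_apply, linMap_castSucc, Function.comp]
        ring
      · exact Filter.Eventually.of_forall fun s => (pow_succ' ‖s‖ (k + 1)).symm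
  exact ((PiLp.continuousLinearEquiv 2 ℂ (fun _ : Fin (n + 2) => ℂ)).symm :
    (Fin (n + 2) → ℂ) →L[ℂ] CSpace n).isBigO_comp
      (fun s : CSpace n => fun i => (linMap ν b j s - s) i) (𝓝 0) |>.trans hpi

theorem isTangentToId_linMap (hb : Function.Injective b) {k : ℕ}
    (h : ∀ i, regPart ν b j i =O[𝓝[≠] (b j)] fun z => (z - b j) ^ k) :
    IsTangentToId k (linMap ν b j) := by
  refine (isBigO_linMap_sub hb h).trans (Asymptotics.IsBigO.of_bound 1 ?_)
  filter_upwards [Metric.ball_mem_nhds (0 : CSpace n) one_pos] with s hs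
  rw [norm_pow, norm_norm, one_mul, norm_pow, norm_norm]
  exact pow_le_pow_of_le_one (norm_nonneg _) (by simpa using (mem_ball_zero_iff.1 hs).le) (by omega)

theorem isBiholGerm_linMap (hb : Function.Injective b) {k : ℕ}
    (h : ∀ i, regPart ν b j i =O[𝓝[≠] (b j)] fun z => (z - b j) ^ k) :
    IsBiholGerm (linMap ν b j) := by
  refine ⟨?_, ?_, ?_⟩
  · ext i
    refine Fin.lastCases ?_ (fun i => ?_) i
    · simp [linMap_last]
    · simp [linMap_castSucc]
  · refine ContDiffAt.analyticAt ?_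
    rw [contDiffAt_euclidean]
    intro i
    have hp : ∀ i, AnalyticAt ℂ (fun s : CSpace n => s i) 0 := fun i =>
      (EuclideanSpace.proj (𝕜 := ℂ) i : CSpace n →L[ℂ] ℂ).analyticAt 0
    refine AnalyticAt.contDiffAt ?_
    refine Fin.lastCases ?_ (fun i => ?_) i
    · simpa only [linMap_last] using hp _
    · simp only [linMap_castSucc]
      refine (hp _).mul (AnalyticAt.cexp ?_)
      refine Finset.analyticAt_fun_sum _ fun j' hj => ?_
      refine analyticAt_const.mul (AnalyticAt.clog ?_ ?_)
      · exact analyticAt_const.add ((hp _).div_const)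
      · simp
  · have h1 : HasFDerivAt (fun s => linMap ν b j s - s) (0 : CSpace n →L[ℂ] CSpace n) 0 := by
      refine Asymptotics.IsBigO.hasFDerivAt (n := k + 2) ?_ (by omega)
      simpa using isBigO_linMap_sub hb h
    have h2 := h1.add (hasFDerivAt_id (𝕜 := ℂ) (0 : CSpace n))
    have h3 : HasFDerivAt (linMap ν b j) (0 + ContinuousLinearMap.id ℂ (CSpace n)) 0 :=
      h2.congr_of_eventuallyEq (Filter.Eventually.of_forall fun s => by simp)
    rw [h3.fderiv, zero_add]
    exact Function.bijective_id

theorem fderiv_linMap (hb : Function.Injective b) {s : CSpace n}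
    (hs : SlitAt b j (s (Fin.last (n + 1)))) (p v : CSpace n) :
    fderiv ℂ (fun s => p + linMap ν b j s) s v = WithLp.toLp 2 (Fin.snoc (α := fun _ => ℂ)
      (fun i => Complex.exp (regPrim ν b j i (s (Fin.last (n + 1)))) * (v i.castSucc +
        s i.castSucc * regPart ν b j i (b j + s (Fin.last (n + 1))) * v (Fin.last (n + 1))))
      (v (Fin.last (n + 1)))) := by
  have hd : ∀ i : Fin (n + 2), HasFDerivAt (fun t : CSpace n => t i)
      (EuclideanSpace.proj (𝕜 := ℂ) i : CSpace n →L[ℂ] ℂ) s :=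
    fun i => (EuclideanSpace.proj (𝕜 := ℂ) i : CSpace n →L[ℂ] ℂ).hasFDerivAt
  have hc : ∀ i : Fin (n + 1), HasFDerivAt (fun t : CSpace n => linMap ν b j t i.castSucc) _ s :=
    fun i => ((hd i.castSucc).mul ((hasDerivAt_regPrim (ν := ν) hb i hs).comp_hasFDerivAt s
      (hd (Fin.last (n + 1)))).cexp).congr_of_eventuallyEq
        (Filter.Eventually.of_forall fun t => linMap_castSucc t i)
  have hl : HasFDerivAt (fun t : CSpace n => linMap ν b j t (Fin.last (n + 1))) _ s :=
    (hd (Fin.last (n + 1))).congr_of_eventuallyEq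
        (Filter.Eventually.of_forall fun t => linMap_last t)
  have hdiff : DifferentiableAt ℂ (linMap ν b j) s := by
    rw [differentiableAt_euclidean]
    exact Fin.lastCases hl.differentiableAt fun i => (hc i).differentiableAt
  rw [fderiv_const_add]
  have h1 : ∀ i, HasFDerivAt (fun t : CSpace n => linMap ν b j t i) _ s := fun i =>
    (EuclideanSpace.proj (𝕜 := ℂ) i : CSpace n →L[ℂ] ℂ).hasFDerivAt.comp s hdiff.hasFDerivAt
  ext i
  refine Fin.lastCases ?_ (fun i => ?_) i
  · have := DFunLike.congr_fun ((h1 _).unique hl) v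
    refine Eq.trans this ?_
    simp
  · have := DFunLike.congr_fun ((h1 _).unique (hc i)) v
    refine Eq.trans this ?_
    simp
    ring

/-- With u = t_M - b_j, the system reads d log t_i/du = ν_ij/u + `regPart`. The factor
exp(`regPrim`) absorbs the regular part, and what remains is the linear system, since ν_ij =
λ_i/λ_M. The two fields differ by the nonzero factor q/λ_M. -/
theorem rationalFoliation_dir_linMap {hν : ∀ i j, ν i j ≠ 0} (hb : Function.Injective b)
    {l : Fin (n + 2) → ℂ} (hl : l (Fin.last (n + 1)) ≠ 0)
    (hνl : ∀ i, ν i j = l i.castSucc / l (Fin.last (n + 1))) {s : CSpace n}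
    (hs : SlitAt b j (s (Fin.last (n + 1)))) :
    (rationalFoliation ν b hν hb).dir (axisPoint n (b j) + linMap ν b j s) = Submodule.span ℂ
      {fderiv ℂ (fun s => axisPoint n (b j) + linMap ν b j s) s (diagField l s)} := by
  change Submodule.span ℂ {_} = _
  set u := s (Fin.last (n + 1)) with hu
  set q := ∏ j' ∈ Finset.univ.erase j, (b j + u - b j') with hq
  have hq0 : q ≠ 0 := Finset.prod_ne_zero_iff.2 fun j' hj => sub_ne_zero_of_slitAt hb hs hj
  have hlast : (axisPoint n (b j) + linMap ν b j s) (Fin.last (n + 1)) = b j + u := by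
    rw [PiLp.add_apply, axisPoint_last, linMap_last]
  have hcs : ∀ i : Fin (n + 1), (axisPoint n (b j) + linMap ν b j s) i.castSucc =
      s i.castSucc * Complex.exp (regPrim ν b j i u) := fun i => by
    rw [PiLp.add_apply, axisPoint_castSucc, linMap_castSucc, zero_add]
  have hfull : ∏ j', (b j + u - b j') = u * q := by
    rw [← Finset.mul_prod_erase _ _ (Finset.mem_univ j)]
    ring
  have hsum : ∀ i, ∑ j₁, ν i j₁ * ∏ j' ∈ Finset.univ.erase j₁, (b j + u - b j') =
      q * (ν i j + u * regPart ν b j i (b j + u)) := by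
    intro i
    rw [← Finset.add_sum_erase _ _ (Finset.mem_univ j), regPart, mul_add, ← hq, mul_comm,
      Finset.mul_sum, Finset.mul_sum]
    congr 1
    refine Finset.sum_congr rfl fun j₁ hj₁ => ?_
    have h1 := sub_ne_zero_of_slitAt hb hs hj₁
    have h2 : (b j + u - b j₁) * ∏ j' ∈ Finset.univ.erase j₁, (b j + u - b j') = u * q := by
      rw [Finset.mul_prod_erase _ (fun j' => b j + u - b j') (Finset.mem_univ j₁), hfull]
    field_simp
    linear_combination ν i j₁ * h2
  have key : polyField (rationalPoly ν b) (axisPoint n (b j) + linMap ν b j s) =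
      (q / l (Fin.last (n + 1))) •
        fderiv ℂ (fun s => axisPoint n (b j) + linMap ν b j s) s (diagField l s) := by
    rw [fderiv_linMap hb hs]
    ext i
    refine Fin.lastCases ?_ (fun i => ?_) i
    · rw [polyField_rationalPoly_last, hlast, hfull]
      simp only [PiLp.smul_apply, Fin.snoc_last, diagField, smul_eq_mul, ← hu]
      field_simp
    · rw [polyField_rationalPoly_castSucc, hlast, hcs, hsum, hνl]
      simp only [PiLp.smul_apply, Fin.snoc_castSucc, diagField, smul_eq_mul, ← hu]
      field_simp
  rw [key]
  exact Submodule.span_singleton_smul_eq (div_ne_zero hq0 hl).isUnit _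

theorem blowMap_mem_hypersurfaceS_iff (t : CSpace n) : blowMap t ∈ hypersurfaceS b ↔
    (∏ i : Fin (n + 1), t i.castSucc) * ∏ j, (t (Fin.last (n + 1)) - b j) = 0 := by
  have hfac : ∀ j, blowMap t (Fin.last (n + 1)) - b j * blowMap t 0 =
      t 0 * (t (Fin.last (n + 1)) - b j) := fun j => by
    rw [blowMap_last, blowMap_zero]
    ring
  simp only [hypersurfaceS, Set.mem_ofPred_eq, hfac, mul_eq_zero, Finset.prod_eq_zero_iff,
    Finset.mem_univ, true_and]
  have h0 : ∀ i : Fin (n + 1), blowMap t i.castSucc = 0 → t 0 = 0 ∨ t i.castSucc = 0 := by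
    intro i hi
    by_cases h : i = 0
    · subst h
      exact Or.inl (by simpa [blowMap_zero] using hi)
    · rw [blowMap_of_ne _ (by simpa using h)] at hi
      exact mul_eq_zero.1 hi
  constructor
  · rintro (⟨i, hi⟩ | ⟨j, hj | hj⟩)
    · exact (h0 i hi).elim (fun h => Or.inl ⟨0, h⟩) fun h => Or.inl ⟨i, h⟩
    · exact Or.inl ⟨0, hj⟩
    · exact Or.inr ⟨j, hj⟩
  · rintro (⟨i, hi⟩ | ⟨j, hj⟩)
    · refine Or.inl ⟨i, ?_⟩
      by_cases h : i = 0
      · subst h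
        simpa [blowMap_zero] using hi
      · rw [blowMap_of_ne _ (by simpa using h), hi, mul_zero]
    · exact Or.inr ⟨j, Or.inr hj⟩

theorem blowMap_linMap_mem_iff (hb : Function.Injective b) {s : CSpace n}
    (hs : SlitAt b j (s (Fin.last (n + 1)))) :
    blowMap (axisPoint n (b j) + linMap ν b j s) ∈ hypersurfaceS b ↔ ∏ i, s i = 0 := by
  rw [blowMap_mem_hypersurfaceS_iff, Fin.prod_univ_castSucc fun i => s i, mul_eq_zero, mul_eq_zero]
  refine or_congr ?_ ?_
  · simp [Finset.prod_eq_zero_iff, axisPoint_castSucc, linMap_castSucc]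
  · simp only [PiLp.add_apply, axisPoint_last, linMap_last]
    rw [← Finset.mul_prod_erase _ _ (Finset.mem_univ j), add_sub_cancel_left, mul_eq_zero]
    exact or_iff_left (Finset.prod_ne_zero_iff.2 fun j' hj => sub_ne_zero_of_slitAt hb hs hj)

end Linearization

/-! ### Lifting paths of the z-plane to the leaves -/

section Lifting

open MeasureTheory

variable {n P : ℕ}

/-- The foliation is generated by the pushed-forward field and singular exactly on
`x_1 = x_M = 0`. -/
structure IsPush (F : HolFoliation n) (ν : Fin (n + 1) → Fin P → ℂ) (b : Fin P → ℂ) : Prop where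
  dir_eq : ∀ x, F.dir x = Submodule.span ℂ {polyField (pushPoly ν b) x}
  mem_sing : ∀ x, x ∈ F.sing ↔ x 0 = 0 ∧ x (Fin.last (n + 1)) = 0

theorem isPush_pushFoliation {ν : Fin (n + 1) → Fin P → ℂ} {b : Fin P → ℂ}
    {hν : ∀ i j, ν i j ≠ 0} {hb : Function.Injective b} {hP : 2 ≤ P} {hN : ∑ j, ν 0 j ≠ -1} :
    IsPush (pushFoliation ν b hν hb hP hN) ν b :=
  ⟨fun _ => rfl, fun _ => mem_pushFoliation_sing⟩

/-- The point with coordinates `x_i = m_i` for `i < M` and `x_M = z x_1`. -/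
def pt (m : Fin (n + 1) → ℂ) (z : ℂ) : CSpace n :=
  WithLp.toLp 2 (Fin.snoc (α := fun _ => ℂ) m (z * m 0))

@[simp]
theorem pt_castSucc (m : Fin (n + 1) → ℂ) (z : ℂ) (i : Fin (n + 1)) : pt m z i.castSucc = m i := by
  simp [pt]

@[simp]
theorem pt_zero (m : Fin (n + 1) → ℂ) (z : ℂ) : pt m z 0 = m 0 := pt_castSucc m z 0

@[simp]
theorem pt_last (m : Fin (n + 1) → ℂ) (z : ℂ) : pt m z (Fin.last (n + 1)) = z * m 0 := by
  simp [pt]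

theorem norm_le_norm_pt (m : Fin (n + 1) → ℂ) (z : ℂ) (i : Fin (n + 1)) : ‖m i‖ ≤ ‖pt m z‖ := by
  simpa using PiLp.norm_apply_le (pt m z) i.castSucc

theorem norm_mul_le_norm_pt (m : Fin (n + 1) → ℂ) (z : ℂ) : ‖z * m 0‖ ≤ ‖pt m z‖ := by
  simpa using PiLp.norm_apply_le (pt m z) (Fin.last (n + 1))

theorem norm_le_of_forall_coord {v : CSpace n} {C : ℝ} (h : ∀ i, ‖v i‖ ≤ C) : ‖v‖ ≤ (n + 2) * C := by
  have hC : 0 ≤ C := (norm_nonneg _).trans (h 0)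
  rw [EuclideanSpace.norm_eq]
  refine Real.sqrt_le_iff.2 ⟨by positivity, ?_⟩
  calc ∑ i, ‖v i‖ ^ 2 ≤ ∑ _i : Fin (n + 2), C ^ 2 :=
        Finset.sum_le_sum fun i _ => pow_le_pow_left₀ (norm_nonneg _) (h i) 2
    _ = (n + 2) * C ^ 2 := by simp
    _ ≤ ((n + 2) * C) ^ 2 := by
        rw [mul_pow]
        refine mul_le_mul_of_nonneg_right ?_ (by positivity)
        nlinarith [(Nat.cast_nonneg n : (0 : ℝ) ≤ n)]

theorem exists_eq_pt {b : Fin P → ℂ} {x : CSpace n} (hx : x ∉ hypersurfaceS b) :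
    ∃ (m : Fin (n + 1) → ℂ) (z : ℂ), (∀ i, m i ≠ 0) ∧ (∀ j, z ≠ b j) ∧ x = pt m z := by
  simp only [hypersurfaceS, Set.mem_ofPred_eq, mul_eq_zero, not_or, Finset.prod_eq_zero_iff,
    Finset.mem_univ, true_and, not_exists] at hx
  have h0 : x 0 ≠ 0 := hx.1 0
  refine ⟨fun i => x i.castSucc, x (Fin.last (n + 1)) / x 0, hx.1, fun j hj => hx.2 j ?_, ?_⟩
  · rw [← hj, div_mul_cancel₀ _ h0, sub_self]
  · ext i
    refine Fin.lastCases ?_ (fun i => ?_) i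
    · rw [pt_last]
      exact (div_mul_cancel₀ _ h0).symm
    · rw [pt_castSucc]

/-- The direction of the lift of the vector `1` of the `z`-plane. -/
theorem mem_dir_pt {F : HolFoliation n} {ν : Fin (n + 1) → Fin P → ℂ} {b : Fin P → ℂ}
    (hF : IsPush F ν b) {m : Fin (n + 1) → ℂ} {z : ℂ} (hm : m 0 ≠ 0) (hz : ∀ j, z ≠ b j) (c : ℂ)
    {v : CSpace n} (hv : ∀ i : Fin (n + 1), v i.castSucc = logField ν b i z * c * m i)
    (hl : v (Fin.last (n + 1)) = (c + z * (logField ν b 0 z * c)) * m 0) : v ∈ F.dir (pt m z) := by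
  have hx : pt m z (Fin.last (n + 1)) = z * pt m z 0 := by simp
  have h0 : pt m z 0 ≠ 0 := by simpa using hm
  have hs := sum_wt_mul_coProd ν b hx h0 hz
  have hq : fullProd b (pt m z) ≠ 0 := by
    rw [fullProd_eq b hx]
    exact mul_ne_zero (pow_ne_zero _ h0)
      (Finset.prod_ne_zero_iff.2 fun j _ => sub_ne_zero.2 (hz j))
  rw [hF.dir_eq, Submodule.mem_span_singleton]
  -- The polynomial field is `fullProd / x_1` times the lift of the vector 1; the coefficient
  -- removes this factor and multiplies by c.
  refine ⟨c * m 0 / fullProd b (pt m z), ?_⟩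
  ext i
  refine Fin.lastCases ?_ (fun i => ?_) i
  · rw [PiLp.smul_apply, polyField_pushPoly_last, hs, hl]
    simp only [pt_zero, pt_last, smul_eq_mul]
    field_simp
    ring
  · rw [PiLp.smul_apply, polyField_pushPoly_castSucc, hs, hv]
    simp only [pt_zero, pt_castSucc, smul_eq_mul]
    field_simp

theorem continuousAt_logField {ν : Fin (n + 1) → Fin P → ℂ} {b : Fin P → ℂ} (i : Fin (n + 1)) {z : ℂ}
    (hz : ∀ j, z ≠ b j) : ContinuousAt (logField ν b i) z := by
  refine tendsto_finsetSum _ fun j _ => ?_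
  exact ContinuousAt.div (by fun_prop) (by fun_prop) (sub_ne_zero.2 (hz j))

theorem hasDerivAt_of_coord {γ : ℝ → CSpace n} {v : CSpace n} {s : ℝ}
    (h : ∀ i, HasDerivAt (fun s => γ s i) (v i) s) : HasDerivAt γ v s :=
  ((PiLp.continuousLinearEquiv 2 ℝ (fun _ : Fin (n + 2) => ℂ)).symm :
    (Fin (n + 2) → ℂ) →L[ℝ] CSpace n).hasFDerivAt.comp_hasDerivAt s (hasDerivAt_pi.2 h)

/-- The logarithm of the `i`-th coordinate along the lift of the path `ζ`. -/
def liftExp (ν : Fin (n + 1) → Fin P → ℂ) (b : Fin P → ℂ) (ζ ζ' : ℝ → ℂ) (i : Fin (n + 1)) (s : ℝ) : ℂ :=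
  ∫ t in (0 : ℝ)..s, logField ν b i (ζ t) * ζ' t

section

variable {F : HolFoliation n} {ν : Fin (n + 1) → Fin P → ℂ} {b : Fin P → ℂ} {ζ ζ' : ℝ → ℂ} {S : ℝ}

@[simp]
theorem liftExp_zero (i : Fin (n + 1)) : liftExp ν b ζ ζ' i 0 = 0 := by simp [liftExp]

theorem hasDerivAt_liftExp (hζ : ∀ s, HasDerivAt ζ (ζ' s) s) (hζ' : Continuous ζ')
    (hb : ∀ s ∈ Set.Icc 0 S, ∀ j, ζ s ≠ b j) (i : Fin (n + 1)) {s : ℝ} (hs : s ∈ Set.Icc 0 S) :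
    HasDerivAt (liftExp ν b ζ ζ' i) (logField ν b i (ζ s) * ζ' s) s := by
  have hζc : Continuous ζ := continuous_iff_continuousAt.2 fun s => (hζ s).continuousAt
  have hca : ∀ t, (∀ j, ζ t ≠ b j) → ContinuousAt (fun t => logField ν b i (ζ t) * ζ' t) t :=
    fun t ht => (ContinuousAt.comp (f := ζ) (continuousAt_logField i ht) hζc.continuousAt).mul
      hζ'.continuousAt
  have hopen : IsOpen {t | ∀ j, ζ t ≠ b j} := by
    simp only [Set.ofPred_forall]
    exact isOpen_iInter_of_finite fun j => isOpen_ne_fun hζc continuous_const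
  refine intervalIntegral.integral_hasDerivAt_right ?_ ?_ (hca s (hb s hs))
  · refine ContinuousOn.intervalIntegrable fun t ht => (hca t (hb t ?_)).continuousWithinAt
    rw [Set.uIcc_of_le hs.1] at ht
    exact ⟨ht.1, ht.2.trans hs.2⟩
  · exact ContinuousOn.stronglyMeasurableAtFilter hopen
      (fun t ht => (hca t ht).continuousWithinAt) s (hb s hs)

/-- The lift to the leaf of a path in the `z`-plane. -/
theorem reach_lift (hF : IsPush F ν b) (hS : 0 ≤ S) (hζ : ∀ s, HasDerivAt ζ (ζ' s) s)
    (hζ' : Continuous ζ') (hb : ∀ s ∈ Set.Icc 0 S, ∀ j, ζ s ≠ b j) {m : Fin (n + 1) → ℂ}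
    (hm : ∀ i, m i ≠ 0) {g g' : ℝ → ℝ} (hg : ∀ s ∈ Set.Icc 0 S, HasDerivAt g (g' s) s)
    (hbd : ∀ s ∈ Set.Icc 0 S, ∀ i : Fin (n + 1),
      ‖logField ν b i (ζ s) * ζ' s‖ * ‖m i * Complex.exp (liftExp ν b ζ ζ' i s)‖ ≤ g' s)
    (hbl : ∀ s ∈ Set.Icc 0 S, ‖ζ' s + ζ s * (logField ν b 0 (ζ s) * ζ' s)‖ *
      ‖m 0 * Complex.exp (liftExp ν b ζ ζ' 0 s)‖ ≤ g' s) :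
    F.Reach (pt m (ζ 0)) (pt (fun i => m i * Complex.exp (liftExp ν b ζ ζ' i S)) (ζ S))
      ((n + 2) * (g S - g 0)) := by
  have hζc : Continuous ζ := continuous_iff_continuousAt.2 fun s => (hζ s).continuousAt
  set E : ℝ → Fin (n + 1) → ℂ := fun s i => m i * Complex.exp (liftExp ν b ζ ζ' i s) with hE
  have hE0 : ∀ s i, E s i ≠ 0 := fun s i => mul_ne_zero (hm i) (Complex.exp_ne_zero _)
  have hEd : ∀ s ∈ Set.Icc 0 S, ∀ i,
      HasDerivAt (fun s => E s i) (logField ν b i (ζ s) * ζ' s * E s i) s := fun s hs i => by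
    refine ((hasDerivAt_liftExp hζ hζ' hb i hs).cexp.const_mul (m i)).congr_deriv ?_
    simp only [hE]
    ring
  set v : ℝ → CSpace n := fun s => WithLp.toLp 2 (Fin.snoc (α := fun _ => ℂ)
    (fun i => logField ν b i (ζ s) * ζ' s * E s i)
    ((ζ' s + ζ s * (logField ν b 0 (ζ s) * ζ' s)) * E s 0)) with hv
  -- The factor n + 2 passes from bounds on the n + 2 coordinates to a bound on the Euclidean norm.
  have key := HolFoliation.reach_of_hasDerivAt (F := F) (γ := fun s => pt (E s) (ζ s)) (γ' := v)
    (g := fun s => (n + 2) * g s) (g' := fun s => (n + 2) * g' s) (ℓ := (n + 2) * (g S - g 0)) hS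
    ?_ ?_ ?_ ?_ (fun s hs => (hg s hs).const_mul _) ?_ (by rw [mul_sub])
  · have e0 : E 0 = m := by
      funext i
      simp [hE]
    simpa only [e0] using key
  · intro s hs
    refine hasDerivAt_of_coord fun i => ?_
    refine Fin.lastCases ?_ (fun i => ?_) i
    · simp only [pt_last]
      refine ((hζ s).mul (hEd s hs 0)).congr_deriv ?_
      simp only [hv, Fin.snoc_last]
      ring
    · simp only [pt_castSucc]
      refine (hEd s hs i).congr_deriv ?_
      simp only [hv, Fin.snoc_castSucc]
  · have hA : ∀ i, ContinuousOn (fun s => logField ν b i (ζ s) * ζ' s) (Set.Icc 0 S) :=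
      fun i s hs => ((ContinuousAt.comp (f := ζ) (continuousAt_logField i (hb s hs))
        hζc.continuousAt).mul hζ'.continuousAt).continuousWithinAt
    have hEc : ∀ i, ContinuousOn (fun s => E s i) (Set.Icc 0 S) := fun i s hs =>
      (hEd s hs i).continuousAt.continuousWithinAt
    refine (PiLp.continuous_toLp 2 _).comp_continuousOn (continuousOn_pi.2 fun i => ?_)
    refine Fin.lastCases ?_ (fun i => ?_) i
    · simp only [Fin.snoc_last]
      exact (hζ'.continuousOn.add (hζc.continuousOn.mul (hA 0))).mul (hEc 0)
    · simp only [Fin.snoc_castSucc]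
      exact (hA i).mul (hEc i)
  · intro s hs h
    rw [hF.mem_sing] at h
    exact hE0 s 0 (by simpa using h.1)
  · intro s hs
    refine mem_dir_pt hF (hE0 s 0) (hb s hs) (ζ' s) (fun i => ?_) ?_
    · simp only [hv, Fin.snoc_castSucc]
    · simp only [hv, Fin.snoc_last]
  · intro s hs
    refine norm_le_of_forall_coord fun i => ?_
    refine Fin.lastCases ?_ (fun i => ?_) i
    · simp only [hv, Fin.snoc_last]
      rw [norm_mul]
      exact hbl s hs
    · simp only [hv, Fin.snoc_castSucc]
      rw [norm_mul]
      exact hbd s hs i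

/-- Exponential bound for the coordinates of a lift. -/
theorem norm_exp_liftExp_le (hζ : ∀ s, HasDerivAt ζ (ζ' s) s) (hζ' : Continuous ζ')
    (hb : ∀ s ∈ Set.Icc 0 S, ∀ j, ζ s ≠ b j) (i : Fin (n + 1)) {c : ℝ}
    (hc : ∀ s ∈ Set.Icc 0 S, (logField ν b i (ζ s) * ζ' s).re ≤ -c) {s : ℝ}
    (hs : s ∈ Set.Icc 0 S) : ‖Complex.exp (liftExp ν b ζ ζ' i s)‖ ≤ Real.exp (-c * s) := by
  rw [Complex.norm_exp]
  refine Real.exp_le_exp.2 ?_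
  have hd : ∀ t ∈ Set.Icc 0 S, HasDerivAt (fun t => (liftExp ν b ζ ζ' i t).re)
      (logField ν b i (ζ t) * ζ' t).re t := fun t ht =>
    (Complex.reCLM.hasFDerivAt (x := liftExp ν b ζ ζ' i t)).comp_hasDerivAt t
      (hasDerivAt_liftExp hζ hζ' hb i ht)
  have hsub : ∀ t ∈ Set.Icc 0 s, t ∈ Set.Icc 0 S := fun t ht => ⟨ht.1, ht.2.trans hs.2⟩
  refine image_le_of_deriv_right_le_deriv_boundary (a := 0) (b := s)
    (f := fun t => (liftExp ν b ζ ζ' i t).re) (f' := fun t => (logField ν b i (ζ t) * ζ' t).re)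
    (B := fun t => -c * t) (B' := fun _ => -c)
    (fun t ht => (hd t (hsub t ht)).continuousAt.continuousWithinAt)
    (fun t ht => (hd t (hsub t ⟨ht.1, ht.2.le⟩)).hasDerivWithinAt) (by simp)
    (by fun_prop)
    (fun t _ => by simpa using ((hasDerivAt_id t).const_mul (-c)).hasDerivWithinAt)
    (fun t ht => hc t (hsub t ⟨ht.1, ht.2.le⟩)) ⟨hs.1, le_rfl⟩

end

end Lifting

/-! ### Moving to the base point at a cost proportional to the norm -/

section Moves

variable {n P : ℕ}

/-- Every point over `z` (off the invariant hypersurface) can be moved along its leaf to a point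
over `w` by a path whose length is at most `C` times the norm of the starting point. -/
def Mv (F : HolFoliation n) (C : ℝ) (z w : ℂ) : Prop :=
  ∀ m : Fin (n + 1) → ℂ, (∀ i, m i ≠ 0) →
    ∃ m' : Fin (n + 1) → ℂ, (∀ i, m' i ≠ 0) ∧ F.Reach (pt m z) (pt m' w) (C * ‖pt m z‖)

variable {F : HolFoliation n} {ν : Fin (n + 1) → Fin P → ℂ} {b : Fin P → ℂ}

theorem Mv.mono {C C' : ℝ} {z w : ℂ} (h : Mv F C z w) (hC : C ≤ C') : Mv F C' z w := fun m hm => by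
  obtain ⟨m', hm', hr⟩ := h m hm
  exact ⟨m', hm', hr.mono (mul_le_mul_of_nonneg_right hC (norm_nonneg _))⟩

/-- The second move starts at a point whose norm is at most 1 + C times the initial one; this
accounts for the constant. -/
theorem Mv.trans {C C' : ℝ} {z w v : ℂ} (h : Mv F C z w) (h' : Mv F C' w v) (hC' : 0 ≤ C') :
    Mv F (C + C' * (1 + C)) z v := fun m hm => by
  obtain ⟨m', hm', hr⟩ := h m hm
  obtain ⟨m'', hm'', hr'⟩ := h' m' hm'
  refine ⟨m'', hm'', (hr.trans hr').mono ?_⟩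
  nlinarith [mul_le_mul_of_nonneg_left hr.norm_le hC']

/-- Short moves between nearby points of the `z`-plane. -/
theorem exists_mv_ball (hF : IsPush F ν b) {z₀ : ℂ} (hz : ∀ j, z₀ ≠ b j) :
    ∃ r > 0, ∃ C, 0 ≤ C ∧ ∀ z ∈ Metric.ball z₀ r, ∀ w ∈ Metric.ball z₀ r, Mv F C z w := by
  set K : ℝ := ∑ i, ‖logField ν b i z₀‖ + 1 with hK
  have hev : ∀ᶠ x in 𝓝 z₀, (∀ j, x ≠ b j) ∧ ∀ i, ‖logField ν b i x‖ < K := by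
    refine Filter.Eventually.and (Filter.eventually_all.2 fun j => isOpen_ne.mem_nhds (hz j))
      (Filter.eventually_all.2 fun i => ?_)
    refine (continuousAt_logField i hz).norm.eventually_lt_const ?_
    have := Finset.single_le_sum (f := fun i => ‖logField ν b i z₀‖) (fun i _ => norm_nonneg _)
      (Finset.mem_univ i)
    linarith
  have hK0 : 0 ≤ K := by positivity
  obtain ⟨r₀, hr₀, hr⟩ := Metric.eventually_nhds_iff_ball.1 hev
  set r := min r₀ 1 with hrdef
  -- Bounds for the logarithmic speed 2K of the first coordinates and for that of x_M = ζ x_1, times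
  -- the growth exp(2K) of the coordinates in unit time. The 2 bounds |w - z|.
  set D : ℝ := (2 * K + (2 + (‖z₀‖ + 1) * (2 * K))) * Real.exp (2 * K) with hD
  have hD0 : 0 ≤ D := by positivity
  refine ⟨r, lt_min hr₀ one_pos, (n + 2) * D, by positivity, fun z hzr w hwr m hm => ?_⟩
  set ζ : ℝ → ℂ := fun s => z + s * (w - z) with hζ
  have hζd : ∀ s, HasDerivAt ζ (w - z) s := fun s => by
    refine (((Complex.ofRealCLM.hasDerivAt (x := s)).mul_const (w - z)).const_add z).congr_deriv ?_
    simp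
  have hmem : ∀ s ∈ Set.Icc (0 : ℝ) 1, ζ s ∈ Metric.ball z₀ r := fun s hs => by
    have := (convex_ball z₀ r).add_smul_sub_mem hzr hwr hs
    simpa [hζ] using this
  have hmem' : ∀ s ∈ Set.Icc (0 : ℝ) 1, ζ s ∈ Metric.ball z₀ r₀ := fun s hs =>
    Metric.ball_subset_ball (min_le_left _ _) (hmem s hs)
  have hwz : ‖w - z‖ ≤ 2 := by
    have h1 := mem_ball_iff_norm.1 hzr
    have h2 := mem_ball_iff_norm.1 hwr
    have h3 : r ≤ 1 := min_le_right _ _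
    have h4 := norm_sub_le (w - z₀) (z - z₀)
    rw [sub_sub_sub_cancel_right] at h4
    linarith
  have ha : ∀ s ∈ Set.Icc (0 : ℝ) 1, ∀ i, ‖logField ν b i (ζ s) * (w - z)‖ ≤ 2 * K := fun s hs i => by
    rw [norm_mul, mul_comm]
    exact mul_le_mul hwz ((hr _ (hmem' s hs)).2 i).le (norm_nonneg _) (by norm_num)
  have hζn : ∀ s ∈ Set.Icc (0 : ℝ) 1, ‖ζ s‖ ≤ ‖z₀‖ + 1 := fun s hs => by
    have h1 := mem_ball_iff_norm.1 (hmem s hs)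
    have h3 : r ≤ 1 := min_le_right _ _
    have h4 := norm_add_le (ζ s - z₀) z₀
    rw [sub_add_cancel] at h4
    linarith
  have hbs : ∀ s ∈ Set.Icc (0 : ℝ) 1, ∀ j, ζ s ≠ b j := fun s hs => (hr _ (hmem' s hs)).1
  have hE : ∀ s ∈ Set.Icc (0 : ℝ) 1, ∀ i,
      ‖m i * Complex.exp (liftExp ν b ζ (fun _ => w - z) i s)‖ ≤ Real.exp (2 * K) * ‖pt m z‖ := by
    intro s hs i
    have h1 := norm_exp_liftExp_le (ν := ν) (c := -(2 * K)) hζd continuous_const hbs i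
      (fun t ht => by
        rw [neg_neg]
        exact (Complex.re_le_norm _).trans (ha t ht i)) hs
    rw [norm_mul, mul_comm]
    refine mul_le_mul (h1.trans (Real.exp_le_exp.2 ?_)) (norm_le_norm_pt m z i) (norm_nonneg _)
      (Real.exp_nonneg _)
    rw [neg_neg]
    exact mul_le_of_le_one_right (by positivity) hs.2
  have key := reach_lift hF zero_le_one hζd continuous_const hbs hm
    (g := fun s => D * ‖pt m z‖ * s) (g' := fun _ => D * ‖pt m z‖)
    (fun s _ => by simpa using (hasDerivAt_id s).const_mul (D * ‖pt m z‖))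
    (fun s hs i => by
      refine (mul_le_mul (ha s hs i) (hE s hs i) (norm_nonneg _) (by positivity)).trans ?_
      rw [hD, ← mul_assoc]
      refine mul_le_mul_of_nonneg_right (mul_le_mul_of_nonneg_right ?_ (Real.exp_nonneg _))
        (norm_nonneg _)
      have : 0 ≤ 2 + (‖z₀‖ + 1) * (2 * K) := by positivity
      linarith)
    (fun s hs => by
      have h1 : ‖w - z + ζ s * (logField ν b 0 (ζ s) * (w - z))‖ ≤ 2 + (‖z₀‖ + 1) * (2 * K) := by
        refine (norm_add_le _ _).trans (add_le_add hwz ?_)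
        rw [norm_mul]
        exact mul_le_mul (hζn s hs) (ha s hs 0) (norm_nonneg _) (by positivity)
      refine (mul_le_mul h1 (hE s hs 0) (norm_nonneg _) (by positivity)).trans ?_
      rw [hD, ← mul_assoc]
      refine mul_le_mul_of_nonneg_right (mul_le_mul_of_nonneg_right ?_ (Real.exp_nonneg _))
        (norm_nonneg _)
      linarith)
  refine ⟨_, fun i => mul_ne_zero (hm i) (Complex.exp_ne_zero (liftExp ν b ζ (fun _ => w - z) i 1)),
    ?_⟩
  have e0 : ζ 0 = z := by simp [hζ]
  have e1 : ζ 1 = w := by simp [hζ]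
  rw [e0, e1] at key
  refine key.mono (le_of_eq ?_)
  ring

/-- A contracting lift has length controlled by the norm of its starting point. -/
theorem reach_of_decay (hF : IsPush F ν b) {ζ ζ' : ℝ → ℂ} {S : ℝ} (hS : 0 ≤ S)
    (hζ : ∀ s, HasDerivAt ζ (ζ' s) s) (hζ' : Continuous ζ')
    (hb : ∀ s ∈ Set.Icc 0 S, ∀ j, ζ s ≠ b j) {m : Fin (n + 1) → ℂ} (hm : ∀ i, m i ≠ 0)
    {c K K' : ℝ} (hc : 0 < c) (hK : 0 ≤ K) (hK' : 0 ≤ K')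
    (hre : ∀ s ∈ Set.Icc 0 S, ∀ i, (logField ν b i (ζ s) * ζ' s).re ≤ -c)
    (hno : ∀ s ∈ Set.Icc 0 S, ∀ i, ‖logField ν b i (ζ s) * ζ' s‖ ≤ K)
    (hla : ∀ s ∈ Set.Icc 0 S, ‖ζ' s + ζ s * (logField ν b 0 (ζ s) * ζ' s)‖ *
      ‖m 0 * Complex.exp (liftExp ν b ζ ζ' 0 s)‖ ≤ K' * ‖pt m (ζ 0)‖ * Real.exp (-c * s)) :
    ∃ m' : Fin (n + 1) → ℂ, (∀ i, m' i ≠ 0) ∧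
      F.Reach (pt m (ζ 0)) (pt m' (ζ S)) ((n + 2) * ((K + K') / c) * ‖pt m (ζ 0)‖) := by
  set N := ‖pt m (ζ 0)‖ with hN
  have hN0 : 0 ≤ N := norm_nonneg _
  -- Here `g` is a primitive of the speed bound (K + K') N exp(-cs); its increase is at most (K +
  -- K') N / c, whatever the duration S.
  have key := reach_lift hF hS hζ hζ' hb hm
    (g := fun s => -((K + K') / c * N * Real.exp (-c * s)))
    (g' := fun s => (K + K') * N * Real.exp (-c * s))
    (fun s _ => by
      have h1 : HasDerivAt (fun s : ℝ => -c * s) (-c) s := by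
        simpa using (hasDerivAt_id s).const_mul (-c)
      refine ((h1.exp.const_mul ((K + K') / c * N)).neg).congr_deriv ?_
      field_simp)
    (fun s hs i => by
      have h1 := norm_exp_liftExp_le hζ hζ' hb i (fun t ht => hre t ht i) hs
      have h2 : ‖m i * Complex.exp (liftExp ν b ζ ζ' i s)‖ ≤ N * Real.exp (-c * s) := by
        rw [norm_mul]
        exact mul_le_mul (norm_le_norm_pt m _ i) h1 (norm_nonneg _) hN0
      refine (mul_le_mul (hno s hs i) h2 (norm_nonneg _) hK).trans ?_
      rw [← mul_assoc]
      refine mul_le_mul_of_nonneg_right (mul_le_mul_of_nonneg_right ?_ hN0) (Real.exp_nonneg _)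
      linarith)
    (fun s hs => by
      refine (hla s hs).trans ?_
      refine mul_le_mul_of_nonneg_right (mul_le_mul_of_nonneg_right ?_ hN0) (Real.exp_nonneg _)
      linarith)
  refine ⟨_, fun i => mul_ne_zero (hm i) (Complex.exp_ne_zero (liftExp ν b ζ ζ' i S)),
    key.mono ?_⟩
  refine (mul_le_mul_of_nonneg_left (c := (K + K') / c * N) ?_
    (by positivity : (0 : ℝ) ≤ n + 2)).trans (le_of_eq (by ring))
  have : 0 ≤ (K + K') / c * N * Real.exp (-c * S) := by positivity
  simp only [mul_zero, Real.exp_zero, mul_one]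
  linarith

theorem exists_uniform_neg {ι : Type*} [Finite ι] {x : ι → ℝ} (hx : ∀ i, x i < 0) :
    ∃ c > 0, ∀ i, x i < -c := by
  have h : ∀ᶠ c in 𝓝[>] (0 : ℝ), ∀ i, x i < -c := by
    refine Filter.eventually_all.2 fun i => ?_
    have : Filter.Tendsto (fun c : ℝ => -c) (𝓝[>] 0) (𝓝 0) := by
      simpa using (continuous_neg.tendsto (0 : ℝ)).mono_left nhdsWithin_le_nhds
    exact this.eventually_const_lt (hx i)
  obtain ⟨c, hc, hc0⟩ := (h.and self_mem_nhdsWithin).exists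
  exact ⟨c, hc0, hc⟩

/-- Near a node with the separation property the leaves can be followed away from the node along a
contracting spiral. -/
theorem exists_mv_node (hF : IsPush F ν b) (hb : Function.Injective b) (j : Fin P) {ω : ℂ}
    (hω : 0 < ω.re) (hsep : ∀ i, (ω * wt ν i j).re < 0) :
    ∃ ρ > 0, ∃ C, 0 ≤ C ∧ (∀ w, ‖w - b j‖ = ρ → ∀ j', w ≠ b j') ∧
      ∀ z, 0 < ‖z - b j‖ → ‖z - b j‖ ≤ ρ → ∃ w, ‖w - b j‖ = ρ ∧ Mv F C z w := by
  obtain ⟨c, hc, hcw⟩ := exists_uniform_neg hsep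
  -- This is v · `logField` at b_j + v, continued to v = 0, where its value is the weight ρ_ij. The
  -- strict inequality on Re(ω ρ_ij) therefore persists near the node.
  set ψ : Fin (n + 1) → ℂ → ℂ := fun i v => wt ν i j +
    v * ∑ j' ∈ Finset.univ.erase j, wt ν i j' / (b j + v - b j') with hψ
  have hne : ∀ j' ∈ Finset.univ.erase j, b j - b j' ≠ 0 := fun j' hj =>
    sub_ne_zero.2 fun e => Finset.ne_of_mem_erase hj (hb e).symm
  have hψc : ∀ i, ContinuousAt (ψ i) 0 := fun i => by
    refine continuousAt_const.add (continuousAt_id.mul (tendsto_finsetSum _ fun j' hj => ?_))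
    exact ContinuousAt.div (by fun_prop) (by fun_prop) (by simpa using hne j' hj)
  have hψ0 : ∀ i, ψ i 0 = wt ν i j := fun i => by simp [hψ]
  have hlog : ∀ i v, v ≠ 0 → logField ν b i (b j + v) * v = ψ i v := fun i v hv => by
    rw [logField, ← Finset.add_sum_erase _ _ (Finset.mem_univ j), add_mul, add_sub_cancel_left,
      div_mul_cancel₀ _ hv, mul_comm (Finset.sum _ _)]
  set K : ℝ := ∑ i, ‖ω * wt ν i j‖ + 1 with hK
  have hK0 : 0 ≤ K := by positivity
  have hev : ∀ᶠ v in 𝓝 (0 : ℂ), (∀ i, (ω * ψ i v).re < -c) ∧ (∀ i, ‖ω * ψ i v‖ < K) ∧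
      ∀ j' ∈ Finset.univ.erase j, b j + v ≠ b j' := by
    refine Filter.Eventually.and (Filter.eventually_all.2 fun i => ?_)
      (Filter.Eventually.and (Filter.eventually_all.2 fun i => ?_)
        ((Filter.eventually_all_finset _).2 fun j' hj => ?_))
    · refine (Complex.continuous_re.continuousAt.comp
        (continuousAt_const.mul (hψc i))).eventually_lt_const ?_
      simpa [hψ0] using hcw i
    · have hcont : ContinuousAt (fun v => ‖ω * ψ i v‖) 0 :=
        (continuousAt_const.mul (hψc i)).norm
      refine hcont.eventually_lt_const ?_
      have := Finset.single_le_sum (f := fun i => ‖ω * wt ν i j‖) (fun i _ => norm_nonneg _)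
        (Finset.mem_univ i)
      change ‖ω * ψ i 0‖ < K
      rw [hψ0]
      linarith
    · have : ContinuousAt (fun v : ℂ => b j + v) 0 := by fun_prop
      exact this.eventually_ne (by simpa using fun e => hne j' hj (sub_eq_zero.2 e))
  obtain ⟨r, hr, hball⟩ := Metric.eventually_nhds_iff_ball.1 hev
  set ρ := r / 2 with hρ
  have hρ0 : 0 < ρ := by positivity
  have hin : ∀ v : ℂ, ‖v‖ ≤ ρ → v ∈ Metric.ball (0 : ℂ) r := fun v hv => by
    rw [mem_ball_zero_iff]
    linarith
  have hnode : ∀ v : ℂ, v ≠ 0 → ‖v‖ ≤ ρ → ∀ j', b j + v ≠ b j' := fun v hv0 hv j' => by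
    by_cases h : j' = j
    · subst h
      simpa using hv0
    · exact (hball v (hin v hv)).2.2 j' (Finset.mem_erase.2 ⟨h, Finset.mem_univ _⟩)
  set K' : ℝ := ‖ω‖ * ρ + (‖b j‖ + ρ) * K with hK'
  refine ⟨ρ, hρ0, (n + 2) * ((K + K') / c), by positivity, fun w hw j' => ?_, fun z hz0 hzρ => ?_⟩
  · have := hnode (w - b j) (norm_ne_zero_iff.1 (by rw [hw]; exact hρ0.ne')) hw.le j'
    simpa using this
  set u := z - b j with hu
  set S := Real.log (ρ / ‖u‖) / ω.re with hS
  have hS0 : 0 ≤ S := div_nonneg (Real.log_nonneg (by rwa [one_le_div hz0])) hω.le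
  set ζ : ℝ → ℂ := fun s => b j + u * Complex.exp (ω * s) with hζ
  set ζ' : ℝ → ℂ := fun s => ω * (u * Complex.exp (ω * s)) with hζ'
  have hvn : ∀ s : ℝ, ‖u * Complex.exp (ω * s)‖ = ‖u‖ * Real.exp (ω.re * s) := fun s => by
    rw [norm_mul, Complex.norm_exp]
    simp
  have hv0 : ∀ s : ℝ, u * Complex.exp (ω * s) ≠ 0 := fun s =>
    mul_ne_zero (norm_pos_iff.1 hz0) (Complex.exp_ne_zero _)
  have hvρ : ∀ s ∈ Set.Icc 0 S, ‖u * Complex.exp (ω * s)‖ ≤ ρ := fun s hs => by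
    rw [hvn, mul_comm, ← le_div_iff₀ hz0, ← Real.le_log_iff_exp_le (by positivity), mul_comm,
      ← le_div_iff₀ hω]
    exact hs.2
  have hend : ‖u * Complex.exp (ω * S)‖ = ρ := by
    rw [hvn, hS, mul_div_cancel₀ _ hω.ne', Real.exp_log (by positivity),
      mul_div_cancel₀ _ hz0.ne']
  have ha : ∀ s : ℝ, ∀ i, logField ν b i (ζ s) * ζ' s = ω * ψ i (u * Complex.exp (ω * s)) :=
    fun s i => by
      rw [← hlog i _ (hv0 s)]
      ring
  have hζd : ∀ s, HasDerivAt ζ (ζ' s) s := fun s => by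
    have h1 : HasDerivAt (fun s : ℝ => ω * (s : ℂ)) ω s := by
      simpa using (Complex.ofRealCLM.hasDerivAt (x := s)).const_mul ω
    refine ((h1.cexp.const_mul u).const_add (b j)).congr_deriv ?_
    simp only [hζ']
    ring
  have hζ'c : Continuous ζ' := by fun_prop
  have hζ0 : ζ 0 = z := by simp [hζ, hu]
  refine ⟨ζ S, by simpa [hζ] using hend, fun m hm => ?_⟩
  rw [← hζ0]
  refine reach_of_decay hF hS0 hζd hζ'c (fun s hs => hnode _ (hv0 s) (hvρ s hs)) hm hc hK0
    (by positivity) (fun s hs i => ?_) (fun s hs i => ?_) (fun s hs => ?_)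
  · rw [ha]
    exact ((hball _ (hin _ (hvρ s hs))).1 i).le
  · rw [ha]
    exact ((hball _ (hin _ (hvρ s hs))).2.1 i).le
  · have h1 : ‖ζ' s + ζ s * (logField ν b 0 (ζ s) * ζ' s)‖ ≤ K' := by
      refine (norm_add_le _ _).trans (add_le_add ?_ ?_)
      · rw [hζ', norm_mul]
        exact mul_le_mul_of_nonneg_left (hvρ s hs) (norm_nonneg _)
      · rw [norm_mul, ha]
        refine mul_le_mul ?_ ((hball _ (hin _ (hvρ s hs))).2.1 0).le (norm_nonneg _) (by positivity)
        exact (norm_add_le _ _).trans (add_le_add le_rfl (hvρ s hs))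
    have h2 := norm_exp_liftExp_le (ν := ν) (c := c) hζd hζ'c
      (fun s hs => hnode _ (hv0 s) (hvρ s hs)) 0
      (fun t ht => by rw [ha]; exact ((hball _ (hin _ (hvρ t ht))).1 0).le) hs
    rw [mul_assoc, norm_mul]
    exact mul_le_mul h1 (mul_le_mul (norm_le_norm_pt m _ 0) h2 (norm_nonneg _) (norm_nonneg _))
      (by positivity) (by positivity)

theorem tendsto_mul_logField (i : Fin (n + 1)) :
    Filter.Tendsto (fun z => z * logField ν b i z) (Bornology.cobounded ℂ) (𝓝 (∑ j, wt ν i j)) := by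
  have h : ∀ j, Filter.Tendsto (fun z : ℂ => z * (wt ν i j / (z - b j))) (Bornology.cobounded ℂ)
      (𝓝 (wt ν i j)) := fun j => by
    have h1 : Filter.Tendsto (fun z : ℂ => (z - b j)⁻¹) (Bornology.cobounded ℂ) (𝓝 0) :=
      Filter.tendsto_inv₀_cobounded.comp (tendsto_sub_const_cobounded (b j))
    have h2 : Filter.Tendsto (fun z : ℂ => wt ν i j * (1 + b j * (z - b j)⁻¹))
        (Bornology.cobounded ℂ) (𝓝 (wt ν i j * (1 + b j * 0))) :=
      ((h1.const_mul (b j)).const_add 1).const_mul _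
    rw [mul_zero, add_zero, mul_one] at h2
    refine h2.congr' ?_
    filter_upwards [Bornology.isBounded_singleton (x := b j)] with z hz
    have : z - b j ≠ 0 := sub_ne_zero.2 (by simpa using hz)
    field_simp
    ring
  simp only [logField, Finset.mul_sum]
  exact tendsto_finsetSum _ fun j _ => h j

/-- Near infinity the leaves can be followed along a contracting spiral. -/
theorem exists_mv_infty (hF : IsPush F ν b) (hN : ∀ i, InCone (∑ j, wt ν i j)) :
    ∃ R > 0, ∃ C, 0 ≤ C ∧ (∀ w, ‖w‖ = R → ∀ j, w ≠ b j) ∧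
      ∀ z, R ≤ ‖z‖ → ∃ w, ‖w‖ = R ∧ Mv F C z w := by
  -- On the cone Re(ωρ) = Re ρ + Im ρ > 0, and Re ω = 1. Hence z exp(-ωs) comes in from infinity
  -- while the coordinates x_i with i < M contract.
  set ω : ℂ := 1 - Complex.I with hω
  have hre : ω.re = 1 := by simp [hω]
  have hneg : ∀ i, (-(ω * ∑ j, wt ν i j)).re < 0 := fun i => by
    have h1 := hN i
    have h2 := neg_abs_le (∑ j, wt ν i j).re
    simp only [InCone] at h1
    rw [Complex.neg_re, Complex.mul_re, hω]
    simp only [Complex.sub_re, Complex.sub_im, Complex.one_re, Complex.one_im, Complex.I_re,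
      Complex.I_im]
    linarith
  obtain ⟨c, hc, hcw⟩ := exists_uniform_neg hneg
  have ht : ∀ i, Filter.Tendsto (fun z => -(ω * (z * logField ν b i z))) (Bornology.cobounded ℂ)
      (𝓝 (-(ω * ∑ j, wt ν i j))) := fun i => ((tendsto_mul_logField i).const_mul ω).neg
  set K : ℝ := ∑ i, ‖-(ω * ∑ j, wt ν i j)‖ + 1 with hK
  have hK0 : 0 ≤ K := by positivity
  have hev : ∀ᶠ z in Bornology.cobounded ℂ, (∀ i, (-(ω * (z * logField ν b i z))).re < -c) ∧
      (∀ i, ‖-(ω * (z * logField ν b i z))‖ < K) ∧ ∀ j, z ≠ b j := by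
    refine Filter.Eventually.and (Filter.eventually_all.2 fun i => ?_)
      (Filter.Eventually.and (Filter.eventually_all.2 fun i => ?_)
        (Filter.eventually_all.2 fun j => ?_))
    · exact ((Complex.continuous_re.tendsto _).comp (ht i)).eventually_lt_const (hcw i)
    · refine (ht i).norm.eventually_lt_const ?_
      have := Finset.single_le_sum (f := fun i => ‖-(ω * ∑ j, wt ν i j)‖)
        (fun i _ => norm_nonneg _) (Finset.mem_univ i)
      linarith
    · filter_upwards [Bornology.isBounded_singleton (x := b j)] with z hz
      simpa using hz
  obtain ⟨R₀, -, hR₀⟩ := Filter.hasBasis_cobounded_norm.eventually_iff.1 hev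
  set R := max R₀ 1 with hR
  have hR1 : 1 ≤ R := le_max_right _ _
  have hR0 : 0 < R := by linarith
  have hfar : ∀ z : ℂ, R ≤ ‖z‖ → _ := fun z hz => hR₀ (show R₀ ≤ ‖z‖ from (le_max_left _ _).trans hz)
  set K' : ℝ := ‖ω‖ + K with hK'
  refine ⟨R, hR0, (n + 2) * ((K + K') / c), by positivity, fun w hw => (hfar w hw.ge).2.2,
    fun z hz => ?_⟩
  have hz0 : 0 < ‖z‖ := by linarith
  set S := Real.log (‖z‖ / R) with hS
  have hS0 : 0 ≤ S := Real.log_nonneg (by rwa [one_le_div hR0])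
  set ζ : ℝ → ℂ := fun s => z * Complex.exp (-ω * s) with hζ
  set ζ' : ℝ → ℂ := fun s => -ω * ζ s with hζ'
  have hζn : ∀ s : ℝ, ‖ζ s‖ = ‖z‖ * Real.exp (-s) := fun s => by
    rw [hζ, norm_mul, Complex.norm_exp]
    simp [hre]
  have hζR : ∀ s ∈ Set.Icc 0 S, R ≤ ‖ζ s‖ := fun s hs => by
    rw [hζn, Real.exp_neg, ← div_eq_mul_inv, le_div_comm₀ hR0 (Real.exp_pos _),
      ← Real.le_log_iff_exp_le (by positivity)]
    exact hs.2
  have hend : ‖ζ S‖ = R := by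
    rw [hζn, Real.exp_neg, hS, Real.exp_log (by positivity)]
    field_simp
  have ha : ∀ s : ℝ, ∀ i, logField ν b i (ζ s) * ζ' s = -(ω * (ζ s * logField ν b i (ζ s))) :=
    fun s i => by
      simp only [hζ']
      ring
  have hζd : ∀ s, HasDerivAt ζ (ζ' s) s := fun s => by
    have h1 : HasDerivAt (fun s : ℝ => -ω * (s : ℂ)) (-ω) s := by
      simpa using (Complex.ofRealCLM.hasDerivAt (x := s)).const_mul (-ω)
    refine (h1.cexp.const_mul z).congr_deriv ?_
    simp only [hζ', hζ]
    ring
  have hζ'c : Continuous ζ' := by fun_prop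
  have hζ0 : ζ 0 = z := by simp [hζ]
  refine ⟨ζ S, hend, fun m hm => ?_⟩
  rw [← hζ0]
  refine reach_of_decay hF hS0 hζd hζ'c (fun s hs => (hfar _ (hζR s hs)).2.2) hm hc hK0
    (by positivity) (fun s hs i => ?_) (fun s hs i => ?_) (fun s hs => ?_)
  · rw [ha]
    exact ((hfar _ (hζR s hs)).1 i).le
  · rw [ha]
    exact ((hfar _ (hζR s hs)).2.1 i).le
  · have h2 := norm_exp_liftExp_le (ν := ν) (c := c) hζd hζ'c
      (fun s hs => (hfar _ (hζR s hs)).2.2) 0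
      (fun t ht => by rw [ha]; exact ((hfar _ (hζR t ht)).1 0).le) hs
    have h3 : ‖-ω + -(ω * (ζ s * logField ν b 0 (ζ s)))‖ ≤ K' := by
      refine (norm_add_le _ _).trans (add_le_add (norm_neg _).le ?_)
      exact ((hfar _ (hζR s hs)).2.1 0).le
    have h4 : ζ' s + ζ s * (logField ν b 0 (ζ s) * ζ' s) =
        (-ω + -(ω * (ζ s * logField ν b 0 (ζ s)))) * ζ s := by
      simp only [hζ']
      ring
    -- The factor ζ in x_M = ζ x_1 is not bounded uniformly in z, but |ζ| decreases along the
    -- spiral, so it can be charged to the initial value of |x_M|.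
    have h5 : ‖ζ s‖ * ‖m 0‖ ≤ ‖pt m (ζ 0)‖ := by
      have h6 : Real.exp (-s) ≤ 1 := Real.exp_le_one_iff.2 (neg_nonpos.2 hs.1)
      rw [hζ0]
      refine le_trans ?_ (norm_mul_le_norm_pt m z)
      rw [hζn s, norm_mul z (m 0)]
      exact mul_le_mul_of_nonneg_right (mul_le_of_le_one_right (norm_nonneg _) h6) (norm_nonneg _)
    have h6 := mul_le_mul h3 (mul_le_mul h5 h2 (norm_nonneg _) (norm_nonneg _)) (by positivity)
      (by positivity)
    rw [h4, norm_mul _ (ζ s), norm_mul (m 0)]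
    refine le_trans (le_of_eq ?_) (h6.trans (le_of_eq ?_)) <;> ring

theorem isPreconnected_compl_range (b : Fin P → ℂ) : IsPreconnected (Set.range b)ᶜ :=
  ((Set.countable_range b).isConnected_compl_of_one_lt_rank (by simp)).isPreconnected

/-- Moves exist in both directions between nearby points and can be composed, so the connectedness
of the complement of the nodes is enough. -/
theorem exists_mv (hF : IsPush F ν b) {z w : ℂ} (hz : ∀ j, z ≠ b j) (hw : ∀ j, w ≠ b j) :
    ∃ C, 0 ≤ C ∧ Mv F C z w := by
  have hmem : ∀ {x : ℂ}, x ∈ (Set.range b)ᶜ ↔ ∀ j, x ≠ b j := by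
    intro x
    simp [eq_comm]
  refine (isPreconnected_compl_range b).induction₂' (fun z w => ∃ C, 0 ≤ C ∧ Mv F C z w)
    (fun x hx => ?_) (fun x y z _ _ _ h h' => ?_) (hmem.2 hz) (hmem.2 hw)
  · obtain ⟨r, hr, C, hC, h⟩ := exists_mv_ball hF (hmem.1 hx)
    filter_upwards [nhdsWithin_le_nhds (Metric.ball_mem_nhds x hr)] with y hy
    exact ⟨⟨C, hC, h x (Metric.mem_ball_self hr) y hy⟩, ⟨C, hC, h y hy x (Metric.mem_ball_self hr)⟩⟩
  · obtain ⟨C, hC, h⟩ := h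
    obtain ⟨C', hC', h'⟩ := h'
    exact ⟨_, by positivity, h.trans h' hC'⟩

theorem exists_mv_nhds (hF : IsPush F ν b) {z₀ w : ℂ} (hz : ∀ j, z₀ ≠ b j) (hw : ∀ j, w ≠ b j) :
    ∃ C, 0 ≤ C ∧ ∀ᶠ z in 𝓝 z₀, Mv F C z w := by
  obtain ⟨r, hr, C, hC, h⟩ := exists_mv_ball hF hz
  obtain ⟨C', hC', h'⟩ := exists_mv hF hz hw
  refine ⟨C + C' * (1 + C), by positivity, ?_⟩
  filter_upwards [Metric.ball_mem_nhds z₀ hr] with z hzr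
  exact (h z hzr z₀ (Metric.mem_ball_self hr)).trans h' hC'

theorem exists_mv_of_isCompact {w : ℂ} {K : Set ℂ} (hK : IsCompact K)
    (h : ∀ z₀ ∈ K, ∃ C, 0 ≤ C ∧ ∀ᶠ z in 𝓝 z₀, (∀ j, z ≠ b j) → Mv F C z w) :
    ∃ C, 0 ≤ C ∧ ∀ z ∈ K, (∀ j, z ≠ b j) → Mv F C z w := by
  refine hK.induction_on (p := fun K => ∃ C, 0 ≤ C ∧ ∀ z ∈ K, (∀ j, z ≠ b j) → Mv F C z w)
    ⟨0, le_rfl, by simp⟩ ?_ ?_ ?_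
  · rintro s t hst ⟨C, hC, h⟩
    exact ⟨C, hC, fun z hz => h z (hst hz)⟩
  · rintro s t ⟨C, hC, h⟩ ⟨C', hC', h'⟩
    refine ⟨max C C', le_max_of_le_left hC, ?_⟩
    rintro z (hz | hz) hzb
    · exact (h z hz hzb).mono (le_max_left _ _)
    · exact (h' z hz hzb).mono (le_max_right _ _)
  · intro z hz
    obtain ⟨C, hC, h⟩ := h z hz
    exact ⟨_, nhdsWithin_le_nhds h, C, hC, fun z hz => hz⟩

/-- Uniform moves to a base point from the part of the `z`-plane that keeps away from the nodes
without separation property. -/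
theorem exists_mv_uniform (hF : IsPush F ν b) (hb : Function.Injective b)
    (hN : ∀ i, InCone (∑ j, wt ν i j)) {w : ℂ} (hw : ∀ j, w ≠ b j) {J : Set (Fin P)}
    (hJ : ∀ j ∉ J, ∃ ω : ℂ, 0 < ω.re ∧ ∀ i, (ω * wt ν i j).re < 0) {r : ℝ} (hr : 0 < r) :
    ∃ C, 0 ≤ C ∧ ∀ z, (∀ j ∈ J, r ≤ ‖z - b j‖) → (∀ j, z ≠ b j) → Mv F C z w := by
  have hcpt : ∀ K : Set ℂ, IsCompact K → (∀ z ∈ K, ∀ j, z ≠ b j) →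
      ∃ C, 0 ≤ C ∧ ∀ z ∈ K, Mv F C z w := fun K hK hKb => by
    obtain ⟨C, hC, h⟩ := exists_mv_of_isCompact (b := b) (F := F) (w := w) hK fun z hz => by
      obtain ⟨C, hC, h⟩ := exists_mv_nhds hF (hKb z hz) hw
      exact ⟨C, hC, h.mono fun z hz _ => hz⟩
    exact ⟨C, hC, fun z hz => h z hz (hKb z hz)⟩
  have hnode : ∀ j ∉ J, ∃ C, 0 ≤ C ∧ ∀ᶠ z in 𝓝 (b j), (∀ j, z ≠ b j) → Mv F C z w := by
    intro j hj
    obtain ⟨ω, hω, hsep⟩ := hJ j hj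
    obtain ⟨ρ, hρ, C, hC, hcirc, h⟩ := exists_mv_node hF hb j hω hsep
    obtain ⟨C', hC', h'⟩ := hcpt (Metric.sphere (b j) ρ) (isCompact_sphere _ _)
      fun z hz => hcirc z (mem_sphere_iff_norm.1 hz)
    refine ⟨C + C' * (1 + C), by positivity, ?_⟩
    filter_upwards [Metric.ball_mem_nhds (b j) hρ] with z hz hzb
    obtain ⟨v, hv, hmv⟩ := h z (norm_pos_iff.2 (sub_ne_zero.2 (hzb j))) (mem_ball_iff_norm.1 hz).le
    exact hmv.trans (h' v (mem_sphere_iff_norm.2 hv)) hC'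
  obtain ⟨R, hR, C₁, hC₁, hcirc, h₁⟩ := exists_mv_infty hF hN
  obtain ⟨C₂, hC₂, h₂⟩ := hcpt (Metric.sphere 0 R) (isCompact_sphere _ _)
    fun z hz => hcirc z (mem_sphere_zero_iff_norm.1 hz)
  have hKc : IsCompact (Metric.closedBall (0 : ℂ) R ∩ {z | ∀ j ∈ J, r ≤ ‖z - b j‖}) := by
    refine (isCompact_closedBall _ _).inter_right ?_
    simp only [Set.ofPred_forall]
    exact isClosed_iInter fun j => isClosed_iInter fun _ =>
      isClosed_le continuous_const (by fun_prop)
  -- The compact set may contain nodes, but only nodes outside J, and near those the outgoing spiral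
  -- gives a uniform constant.
  obtain ⟨C₃, hC₃, h₃⟩ := exists_mv_of_isCompact (b := b) (F := F) (w := w) hKc fun z hz => by
    by_cases hzb : ∀ j, z ≠ b j
    · obtain ⟨C, hC, h⟩ := exists_mv_nhds hF hzb hw
      exact ⟨C, hC, h.mono fun z hz _ => hz⟩
    · push Not at hzb
      obtain ⟨j, rfl⟩ := hzb
      refine hnode j fun hj => ?_
      have := hz.2 j hj
      rw [sub_self, norm_zero] at this
      linarith
  refine ⟨max (C₁ + C₂ * (1 + C₁)) C₃, le_max_of_le_right hC₃, fun z hz hzb => ?_⟩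
  rcases le_total ‖z‖ R with h | h
  · exact (h₃ z ⟨mem_closedBall_zero_iff.2 h, hz⟩ hzb).mono (le_max_right _ _)
  · obtain ⟨v, hv, hmv⟩ := h₁ z h
    exact (hmv.trans (h₂ v (mem_sphere_zero_iff_norm.2 hv)) hC₂).mono (le_max_left _ _)

end Moves

/-! ### The torus symmetry and the density of the monodromy -/

section Monodromy

variable {n P : ℕ}

/-- The torus action `x_i ↦ κ_i x_i` for `i < M` and `x_M ↦ κ_1 x_M`. -/
def scale (κ : Fin (n + 1) → ℂ) : CSpace n →L[ℂ] CSpace n :=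
  LinearMap.toContinuousLinearMap
    { toFun := fun x => WithLp.toLp 2 (Fin.snoc (α := fun _ => ℂ)
        (fun i : Fin (n + 1) => κ i * x i.castSucc) (κ 0 * x (Fin.last (n + 1))))
      map_add' := fun x y => by
        ext i
        refine Fin.lastCases ?_ (fun i => ?_) i <;> simp [mul_add]
      map_smul' := fun c x => by
        ext i
        refine Fin.lastCases ?_ (fun i => ?_) i <;> simp [mul_left_comm] }

@[simp]
theorem scale_castSucc (κ : Fin (n + 1) → ℂ) (x : CSpace n) (i : Fin (n + 1)) :
    scale κ x i.castSucc = κ i * x i.castSucc := by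
  simp [scale]

@[simp]
theorem scale_zero (κ : Fin (n + 1) → ℂ) (x : CSpace n) : scale κ x 0 = κ 0 * x 0 :=
  scale_castSucc κ x 0

@[simp]
theorem scale_last (κ : Fin (n + 1) → ℂ) (x : CSpace n) :
    scale κ x (Fin.last (n + 1)) = κ 0 * x (Fin.last (n + 1)) := by
  simp [scale]

@[simp]
theorem scale_pt (κ m : Fin (n + 1) → ℂ) (z : ℂ) : scale κ (pt m z) = pt (κ * m) z := by
  ext i
  refine Fin.lastCases ?_ (fun i => ?_) i
  · simp only [scale_last, pt_last, Pi.mul_apply]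
    ring
  · simp

theorem norm_scale_le {κ : Fin (n + 1) → ℂ} {K : ℝ} (hκ : ∀ i, ‖κ i‖ ≤ K) (x : CSpace n) :
    ‖scale κ x‖ ≤ K * ‖x‖ := by
  have hK : 0 ≤ K := (norm_nonneg _).trans (hκ 0)
  rw [EuclideanSpace.norm_eq, EuclideanSpace.norm_eq]
  refine Real.sqrt_le_iff.2 ⟨by positivity, ?_⟩
  rw [mul_pow, Real.sq_sqrt (by positivity), Finset.mul_sum]
  refine Finset.sum_le_sum fun i _ => ?_
  rw [← mul_pow]
  refine pow_le_pow_left₀ (norm_nonneg _) ?_ 2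
  refine Fin.lastCases ?_ (fun i => ?_) i
  · rw [scale_last, norm_mul]
    exact mul_le_mul_of_nonneg_right (hκ 0) (norm_nonneg _)
  · rw [scale_castSucc, norm_mul]
    exact mul_le_mul_of_nonneg_right (hκ i) (norm_nonneg _)

theorem fullProd_scale (b : Fin P → ℂ) (κ : Fin (n + 1) → ℂ) (x : CSpace n) :
    fullProd b (scale κ x) = κ 0 ^ P * fullProd b x := by
  have : ∀ j, κ 0 * x (Fin.last (n + 1)) - b j * (κ 0 * x 0) =
      κ 0 * (x (Fin.last (n + 1)) - b j * x 0) := fun j => by ring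
  simp [fullProd, this, Finset.prod_mul_distrib]

theorem mul_coProd_scale (b : Fin P → ℂ) (j : Fin P) (κ : Fin (n + 1) → ℂ) (x : CSpace n) :
    κ 0 * coProd b j (scale κ x) = κ 0 ^ P * coProd b j x := by
  have h : ∀ j, κ 0 * x (Fin.last (n + 1)) - b j * (κ 0 * x 0) =
      κ 0 * (x (Fin.last (n + 1)) - b j * x 0) := fun j => by ring
  have hP : P = P - 1 + 1 := (Nat.sub_add_cancel (Fin.pos j)).symm
  simp only [coProd, scale_last, scale_zero, h, Finset.prod_mul_distrib, Finset.prod_const,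
    Finset.card_erase_of_mem (Finset.mem_univ j), Finset.card_univ, Fintype.card_fin]
  rw [← mul_assoc, ← pow_succ', ← hP]

/-- The generating field is equivariant up to the factor κ_1^(P-1); the extra κ_1 on both sides
avoids the exponent P - 1. -/
theorem smul_polyField_scale (ν : Fin (n + 1) → Fin P → ℂ) (b : Fin P → ℂ) (κ : Fin (n + 1) → ℂ)
    (x : CSpace n) : κ 0 • polyField (pushPoly ν b) (scale κ x) =
      κ 0 ^ P • scale κ (polyField (pushPoly ν b) x) := by
  have h : ∀ i, κ 0 * ∑ j, wt ν i j * coProd b j (scale κ x) =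
      κ 0 ^ P * ∑ j, wt ν i j * coProd b j x := fun i => by
    rw [Finset.mul_sum, Finset.mul_sum]
    refine Finset.sum_congr rfl fun j _ => ?_
    rw [mul_left_comm, mul_coProd_scale, mul_left_comm]
  ext i
  refine Fin.lastCases ?_ (fun i => ?_) i
  · simp only [PiLp.smul_apply, scale_last, polyField_pushPoly_last, smul_eq_mul, fullProd_scale]
    linear_combination (κ 0 * x (Fin.last (n + 1))) * h 0
  · simp only [PiLp.smul_apply, scale_castSucc, polyField_pushPoly_castSucc, smul_eq_mul]
    linear_combination (κ i * x i.castSucc) * h i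

variable {F : HolFoliation n} {ν : Fin (n + 1) → Fin P → ℂ} {b : Fin P → ℂ}

/-- The torus action preserves the foliation. -/
theorem HolFoliation.Reach.torus (hF : IsPush F ν b) {κ : Fin (n + 1) → ℂ} (hκ : κ 0 ≠ 0) {K : ℝ}
    (hK : ∀ i, ‖κ i‖ ≤ K) {p q : CSpace n} {ℓ : ℝ} (h : F.Reach p q ℓ) :
    F.Reach (scale κ p) (scale κ q) (K * ℓ) := by
  refine h.map (scale κ) ((norm_nonneg _).trans (hK 0)) (norm_scale_le hK) fun x hx =>
    ⟨fun h => hx ?_, fun v hv => ?_⟩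
  · rw [hF.mem_sing] at h ⊢
    simpa [hκ] using h
  · rw [hF.dir_eq, Submodule.mem_span_singleton] at hv ⊢
    obtain ⟨c, rfl⟩ := hv
    refine ⟨c * (κ 0 ^ P)⁻¹ * κ 0, ?_⟩
    rw [mul_smul, smul_polyField_scale, ← mul_smul, inv_mul_cancel_right₀ (pow_ne_zero _ hκ),
      map_smul]

theorem HolFoliation.Reach.exists_torus (hF : IsPush F ν b) {κ : Fin (n + 1) → ℂ} (hκ : κ 0 ≠ 0)
    {p q : CSpace n} {ℓ : ℝ} (h : F.Reach p q ℓ) :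
    ∃ ℓ', F.Reach (scale κ p) (scale κ q) ℓ' :=
  ⟨_, h.torus hF hκ fun i => norm_le_pi_norm κ i⟩

theorem circleIntegral_logField (j : Fin P) {ρ : ℝ} (hρ : 0 < ρ)
    (h : ∀ j' ≠ j, b j' ∉ Metric.closedBall (b j) ρ) (i : Fin (n + 1)) :
    (∮ z in C(b j, ρ), logField ν b i z) = 2 * Real.pi * Complex.I * wt ν i j := by
  have hmem : ∀ j', b j' ∉ Metric.sphere (b j) |ρ| := fun j' hj' => by
    rw [abs_of_pos hρ] at hj'
    by_cases e : j' = j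
    · rw [e, mem_sphere_iff_norm, sub_self, norm_zero] at hj'
      exact hρ.ne hj'
    · exact h j' e (Metric.sphere_subset_closedBall hj')
  have hint : ∀ j', CircleIntegrable (fun z => wt ν i j' / (z - b j')) (b j) ρ := fun j' => by
    refine ContinuousOn.circleIntegrable' fun z hz => ?_
    refine (ContinuousAt.div (by fun_prop) (by fun_prop) ?_).continuousWithinAt
    exact sub_ne_zero.2 fun e => hmem j' (e ▸ hz)
  have hsum := circleIntegral.integral_fun_sum (s := Finset.univ) (c := b j) (R := ρ)
    (f := fun j' z => wt ν i j' / (z - b j')) fun j' _ => hint j'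
  simp only [logField]
  rw [hsum, Finset.sum_eq_single j]
  · simp only [div_eq_mul_inv]
    rw [circleIntegral.integral_const_mul,
      circleIntegral.integral_sub_inv_of_mem_ball (Metric.mem_ball_self hρ), mul_comm]
  · intro j' _ hj'
    have hd : ∀ z ∈ Metric.closedBall (b j) ρ,
        DifferentiableAt ℂ (fun z => wt ν i j' / (z - b j')) z := fun z hz => by
      refine DifferentiableAt.div (by fun_prop) (by fun_prop) (sub_ne_zero.2 fun e => ?_)
      exact h j' hj' (e ▸ hz)
    exact Complex.circleIntegral_eq_zero_of_differentiable_on_off_countable hρ.le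
      Set.countable_empty (fun z hz => (hd z hz).continuousAt.continuousWithinAt)
      fun z hz => hd z (Metric.ball_subset_closedBall hz.1)
  · simp

/-- The monodromy of a small loop around a node. -/
theorem exists_reach_loop (hF : IsPush F ν b) (hb : Function.Injective b) (j : Fin P) :
    ∃ z, (∀ j', z ≠ b j') ∧ ∃ ℓ, F.Reach (pt 1 z)
      (pt (fun i => Complex.exp (2 * Real.pi * Complex.I * wt ν i j)) z) ℓ := by
  have hev : ∀ᶠ v in 𝓝 (b j), ∀ j', j' ≠ j → v ≠ b j' :=
    Filter.eventually_all.2 fun j' => by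
      by_cases h : j' = j
      · exact Filter.Eventually.of_forall fun v h' => absurd h h'
      · exact (isOpen_ne.eventually_mem (hb.ne (Ne.symm h))).mono fun v hv _ => hv
  obtain ⟨r, hr, hball⟩ := Metric.eventually_nhds_iff_ball.1 hev
  set ρ := r / 2 with hρ
  have hρ0 : 0 < ρ := by positivity
  have hout : ∀ j' ≠ j, b j' ∉ Metric.closedBall (b j) ρ := fun j' hj' h =>
    hball _ (Metric.closedBall_subset_ball (by linarith) h) j' hj' rfl
  set ζ : ℝ → ℂ := circleMap (b j) ρ with hζ
  set ζ' : ℝ → ℂ := fun s => circleMap 0 ρ s * Complex.I with hζ'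
  have hζd : ∀ s, HasDerivAt ζ (ζ' s) s := hasDerivAt_circleMap _ _
  have hζc' : Continuous ζ' := (continuous_circleMap 0 ρ).mul continuous_const
  have hζc : Continuous ζ := continuous_circleMap _ _
  have hbs : ∀ s, ∀ j', ζ s ≠ b j' := fun s j' e => by
    by_cases h : j' = j
    · subst h
      exact circleMap_ne_center hρ0.ne' e
    · exact hout j' h (e ▸ circleMap_mem_closedBall _ hρ0.le s)
  have hfin : ∀ i, liftExp ν b ζ ζ' i (2 * Real.pi) = 2 * Real.pi * Complex.I * wt ν i j := by
    intro i
    rw [← circleIntegral_logField j hρ0 hout i, liftExp, circleIntegral]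
    refine intervalIntegral.integral_congr fun s _ => ?_
    simp only [deriv_circleMap, smul_eq_mul]
    exact mul_comm _ _
  have hper : ζ (2 * Real.pi) = ζ 0 := by
    simpa using periodic_circleMap (b j) ρ 0
  have hLc : ∀ i, ContinuousOn (liftExp ν b ζ ζ' i) (Set.Icc 0 (2 * Real.pi)) := fun i s hs =>
    (hasDerivAt_liftExp hζd hζc' (fun s _ => hbs s) i hs).continuousAt.continuousWithinAt
  have hA : ∀ i, Continuous fun s => logField ν b i (ζ s) * ζ' s := fun i =>
    (continuous_iff_continuousAt.2 fun s => ContinuousAt.comp (f := ζ)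
      (continuousAt_logField i (hbs s)) hζc.continuousAt).mul hζc'
  set u : Fin (n + 1) → ℝ → ℝ := fun i s =>
    ‖logField ν b i (ζ s) * ζ' s‖ * ‖(1 : ℂ) * Complex.exp (liftExp ν b ζ ζ' i s)‖ with hu
  set v : ℝ → ℝ := fun s => ‖ζ' s + ζ s * (logField ν b 0 (ζ s) * ζ' s)‖ *
    ‖(1 : ℂ) * Complex.exp (liftExp ν b ζ ζ' 0 s)‖ with hv
  have hEc : ∀ i, ContinuousOn (fun s => ‖(1 : ℂ) * Complex.exp (liftExp ν b ζ ζ' i s)‖)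
      (Set.Icc 0 (2 * Real.pi)) := fun i => (continuousOn_const.mul (hLc i).cexp).norm
  have huc : ∀ i, ContinuousOn (u i) (Set.Icc 0 (2 * Real.pi)) := fun i =>
    (hA i).norm.continuousOn.mul (hEc i)
  have hvc : ContinuousOn v (Set.Icc 0 (2 * Real.pi)) :=
    (hζc'.add (hζc.mul (hA 0))).norm.continuousOn.mul (hEc 0)
  -- No quantitative control of the length is needed for a loop: any bound of the speed over one
  -- period will do.
  obtain ⟨D, hD⟩ := isCompact_Icc.exists_bound_of_continuousOn
    ((continuousOn_finsetSum Finset.univ fun i _ => huc i).add hvc)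
  have hu0 : ∀ i s, 0 ≤ u i s := fun i s => by positivity
  have hv0 : ∀ s, 0 ≤ v s := fun s => by positivity
  have hsum0 : ∀ s, 0 ≤ ∑ i, u i s := fun s => Finset.sum_nonneg fun i _ => hu0 i s
  have hle : ∀ s ∈ Set.Icc 0 (2 * Real.pi), ∑ i, u i s + v s ≤ D := fun s hs =>
    (le_abs_self _).trans (hD s hs)
  have key := reach_lift hF (m := 1) Real.two_pi_pos.le hζd hζc' (fun s _ => hbs s)
    (fun _ => one_ne_zero) (g := fun s => D * s) (g' := fun _ => D)
    (fun s _ => by simpa using (hasDerivAt_id s).const_mul D)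
    (fun s hs i => ?_) (fun s hs => ?_)
  · refine ⟨ζ 0, hbs 0, (n + 2) * (D * (2 * Real.pi) - D * 0), ?_⟩
    simpa only [hfin, hper, Pi.one_apply, one_mul] using key
  · have := Finset.single_le_sum (f := fun i => u i s) (fun i _ => hu0 i s) (Finset.mem_univ i)
    exact (this.trans (le_add_of_nonneg_right (hv0 s))).trans (hle s hs)
  · exact (le_add_of_nonneg_left (hsum0 s)).trans (hle s hs)

/-- The multipliers of the moves over the base point `w`. -/
def monodromyGroup (hF : IsPush F ν b) (w : ℂ) :
    Subgroup (Fin (n + 1) → ℂˣ) where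
  carrier := {h | ∃ ℓ, F.Reach (pt 1 w) (pt (fun i => (h i : ℂ)) w) ℓ}
  one_mem' := ⟨0, HolFoliation.Reach.refl fun h => by simpa using ((hF.mem_sing _).1 h).1⟩
  mul_mem' := by
    rintro g h ⟨ℓ, hg⟩ ⟨ℓ', hh⟩
    obtain ⟨ℓ'', hh'⟩ := hh.exists_torus hF (κ := fun i => (g i : ℂ)) (g 0).ne_zero
    rw [scale_pt, scale_pt, mul_one] at hh'
    exact ⟨_, hg.trans hh'⟩
  inv_mem' := by
    rintro g ⟨ℓ, hg⟩
    obtain ⟨ℓ', hg'⟩ := hg.symm.exists_torus hF (κ := fun i => (((g i)⁻¹ : ℂˣ) : ℂ)) (g 0)⁻¹.ne_zero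
    rw [scale_pt, scale_pt, mul_one] at hg'
    have e : ((fun i => (((g i)⁻¹ : ℂˣ) : ℂ)) * fun i => (g i : ℂ) : Fin (n + 1) → ℂ) = 1 := by
      funext i
      simp
    rw [e] at hg'
    exact ⟨ℓ', hg'⟩

/-- The exponential as a map to the units. -/
def expUnit (z : ℂ) : ℂˣ := Units.mk0 (Complex.exp z) (Complex.exp_ne_zero z)

theorem expUnit_add (z w : ℂ) : expUnit (z + w) = expUnit z * expUnit w :=
  Units.ext (Complex.exp_add z w)

theorem expUnit_zero : expUnit 0 = 1 := Units.ext Complex.exp_zero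

theorem expUnit_neg (z : ℂ) : expUnit (-z) = (expUnit z)⁻¹ := by
  rw [eq_inv_iff_mul_eq_one, ← expUnit_add, neg_add_cancel, expUnit_zero]

theorem continuous_expUnit : Continuous expUnit := by
  refine Units.continuous_iff.2 ⟨Complex.continuous_exp, ?_⟩
  have : (fun x => ((expUnit x)⁻¹ : ℂˣ).val) = fun x => Complex.exp (-x) := by
    funext x
    rw [← expUnit_neg]
    rfl
  rw [this]
  fun_prop

/-- The loop is based at a point near the node. Conjugating it by a path from w does not change its
multiplier, because the torus preserves the foliation and is commutative. -/
theorem expUnit_wt_mem (hF : IsPush F ν b) (hb : Function.Injective b) {w : ℂ}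
    (hw : ∀ j, w ≠ b j) (j : Fin P) :
    (fun i => expUnit (2 * Real.pi * Complex.I * wt ν i j)) ∈ monodromyGroup hF w := by
  obtain ⟨z, hz, ℓ, hl⟩ := exists_reach_loop hF hb j
  obtain ⟨C, -, h⟩ := exists_mv hF hw hz
  obtain ⟨m, hm, hr⟩ := h 1 fun _ => one_ne_zero
  obtain ⟨ℓ₁, h₁⟩ := hl.exists_torus hF (hm 0)
  obtain ⟨ℓ₂, h₂⟩ := hr.symm.exists_torus hF
    (κ := fun i => Complex.exp (2 * Real.pi * Complex.I * wt ν i j)) (Complex.exp_ne_zero _)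
  rw [scale_pt, scale_pt, mul_one] at h₁ h₂
  rw [mul_comm m] at h₁
  exact ⟨_, (hr.trans h₁).trans h₂⟩

/-- The admissible r form a closed subgroup of ℝ containing 1 and √2; it is dense since √2 is
irrational, hence all of ℝ. -/
theorem mulSingle_expUnit_mem {G : Subgroup (Fin (n + 1) → ℂˣ)} (hG : IsClosed (G : Set (Fin (n + 1) → ℂˣ)))
    (i : Fin (n + 1)) {c : ℂ} (h1 : Pi.mulSingle i (expUnit c) ∈ G)
    (h2 : Pi.mulSingle i (expUnit (Real.sqrt 2 * c)) ∈ G) (r : ℝ) :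
    Pi.mulSingle i (expUnit (r * c)) ∈ G := by
  let A : AddSubgroup ℝ :=
    { carrier := {r | Pi.mulSingle i (expUnit (r * c)) ∈ G}
      zero_mem' := by simp [expUnit_zero, G.one_mem]
      add_mem' := fun {x y} hx hy => by
        have := G.mul_mem hx hy
        rw [← Pi.mulSingle_mul, ← expUnit_add, ← add_mul] at this
        simpa using this
      neg_mem' := fun {x} hx => by
        have := G.inv_mem hx
        rw [← Pi.mulSingle_inv, ← expUnit_neg, ← neg_mul] at this
        simpa using this }
  have hA : IsClosed (A : Set ℝ) := by
    refine hG.preimage ((continuous_mulSingle i).comp (continuous_expUnit.comp ?_))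
    fun_prop
  have hd : Dense (A : Set ℝ) := by
    refine (dense_addSubgroupClosure_pair_iff.2 ?_).mono
      (AddSubgroup.closure_le (K := A) |>.2 (Set.insert_subset (a := (Real.sqrt 2)) (s := {1}) ?_ (Set.singleton_subset_iff.2 ?_)))
    · simpa using irrational_sqrt_two
    · exact h2
    · simpa [A] using h1
  have : r ∈ closure (A : Set ℝ) := hd r
  rwa [hA.closure_eq] at this

/-- The quotient of two loop multipliers isolates one coordinate. There the exponents 1 and √2, of
which 1 is free because exp(2πi) = 1, generate a dense subgroup of the unit circle, while i and √2 i
do the same for the positive reals. Together they fill ℂ^* coordinate by coordinate. -/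
theorem dense_monodromyGroup (hF : IsPush F ν b) (hb : Function.Injective b)
    (hgen : ∀ i₀ a, ∃ j j', ∀ i, wt ν i j - wt ν i j' = if i = i₀ then denseGen a else 0) {w : ℂ}
    (hw : ∀ j, w ≠ b j) : Dense (monodromyGroup hF w : Set (Fin (n + 1) → ℂˣ)) := by
  set H := monodromyGroup hF w with hH
  have hG : IsClosed (H.topologicalClosure : Set (Fin (n + 1) → ℂˣ)) :=
    H.isClosed_topologicalClosure
  have h0 : ∀ i₀ a, Pi.mulSingle i₀ (expUnit (2 * Real.pi * Complex.I * denseGen a)) ∈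
      H.topologicalClosure := fun i₀ a => by
    obtain ⟨j, j', hj⟩ := hgen i₀ a
    refine H.le_topologicalClosure ?_
    have := H.mul_mem (expUnit_wt_mem hF hb hw j) (H.inv_mem (expUnit_wt_mem hF hb hw j'))
    convert this using 1
    funext i
    rw [Pi.mul_apply, Pi.inv_apply, ← expUnit_neg, ← expUnit_add, ← sub_eq_add_neg, ← mul_sub, hj i]
    by_cases hi : i = i₀
    · subst hi
      simp
    · simp [hi, expUnit_zero]
  have h1 : ∀ (i : Fin (n + 1)) (r : ℝ),
      Pi.mulSingle i (expUnit (r * (2 * Real.pi * Complex.I))) ∈ H.topologicalClosure := by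
    intro i r
    refine mulSingle_expUnit_mem hG i ?_ ?_ r
    · have : expUnit (2 * Real.pi * Complex.I) = 1 := Units.ext Complex.exp_two_pi_mul_I
      rw [this, Pi.mulSingle_one]
      exact one_mem _
    · simpa [denseGen, mul_comm] using h0 i 0
  have h2 : ∀ (i : Fin (n + 1)) (r : ℝ),
      Pi.mulSingle i (expUnit (r * (2 * Real.pi * Complex.I * Complex.I))) ∈
        H.topologicalClosure := by
    intro i r
    refine mulSingle_expUnit_mem hG i ?_ ?_ r
    · simpa [denseGen] using h0 i 1
    · simpa [denseGen, mul_comm, mul_assoc, mul_left_comm] using h0 i 2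
  have h3 : ∀ (i : Fin (n + 1)) (u : ℂˣ), Pi.mulSingle i u ∈ H.topologicalClosure := by
    intro i u
    set z := Complex.log u / (2 * Real.pi * Complex.I) with hz
    have hpi : (2 * Real.pi * Complex.I : ℂ) ≠ 0 := Complex.two_pi_I_ne_zero
    have hu : u = expUnit (z.re * (2 * Real.pi * Complex.I) +
        z.im * (2 * Real.pi * Complex.I * Complex.I)) := by
      refine Units.ext ?_
      have e : z.re * (2 * Real.pi * Complex.I) + z.im * (2 * Real.pi * Complex.I * Complex.I) =
          z * (2 * Real.pi * Complex.I) := by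
        conv_rhs => rw [← Complex.re_add_im z]
        ring
      rw [e, hz, div_mul_cancel₀ _ hpi]
      exact (Complex.exp_log u.ne_zero).symm
    rw [hu, expUnit_add, Pi.mulSingle_mul]
    exact mul_mem (h1 i _) (h2 i _)
  have h4 : ∀ g : Fin (n + 1) → ℂˣ, g ∈ H.topologicalClosure := fun g => by
    rw [← Finset.univ_prod_mulSingle g]
    exact prod_mem fun i _ => h3 i _
  exact fun g => h4 g

/-- Over the base point, the moves from a point reach a dense set. -/
theorem exists_reach_monodromy (hF : IsPush F ν b) (hb : Function.Injective b)
    (hgen : ∀ i₀ a, ∃ j j', ∀ i, wt ν i j - wt ν i j' = if i = i₀ then denseGen a else 0) {w : ℂ}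
    (hw : ∀ j, w ≠ b j) {m : Fin (n + 1) → ℂ} (hm : ∀ i, m i ≠ 0) {V : Set (Fin (n + 1) → ℂ)}
    (hV : V ∈ 𝓝 m) :
    ∃ h ∈ V, (∀ i, h i ≠ 0) ∧ ∃ ℓ, F.Reach (pt 1 w) (pt h w) ℓ := by
  have hc : Continuous fun g : Fin (n + 1) → ℂˣ => fun i => (g i : ℂ) := by fun_prop
  have hV' : (fun g : Fin (n + 1) → ℂˣ => fun i => (g i : ℂ)) ⁻¹' V ∈
      𝓝 (fun i => Units.mk0 (m i) (hm i)) := hc.continuousAt.preimage_mem_nhds (by simpa using hV)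
  obtain ⟨g, hg, hgH⟩ := (dense_monodromyGroup hF hb hgen hw).inter_nhds_nonempty hV'
  exact ⟨_, hgH, fun i => (g i).ne_zero, hg⟩

end Monodromy

/-! ### Connecting points through small scales; invariance and density -/

section Connection

variable {n P : ℕ} {F : HolFoliation n} {ν : Fin (n + 1) → Fin P → ℂ} {b : Fin P → ℂ}

/-- Iterated contraction over the base point, with a bound for the total length. -/
theorem exists_contraction (hF : IsPush F ν b) (hb : Function.Injective b)
    (hgen : ∀ i₀ a, ∃ j j', ∀ i, wt ν i j - wt ν i j' = if i = i₀ then denseGen a else 0) {w : ℂ}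
    (hw : ∀ j, w ≠ b j) :
    ∃ h : Fin (n + 1) → ℂ, (∀ i, h i ≠ 0) ∧ (∀ i, ‖h i‖ ≤ 3 / 4) ∧ ∃ C, 0 ≤ C ∧
      ∀ m : Fin (n + 1) → ℂ, (∀ i, m i ≠ 0) → ∀ N : ℕ,
        F.Reach (pt m w) (pt (h ^ N * m) w) (C * ‖pt m w‖) := by
  -- A multiplier close to 1/2 in every coordinate. The factor 4 in the constant below is the sum of
  -- the geometric series of ratio 3/4.
  obtain ⟨h, hV, h0, ℓ, hl⟩ := exists_reach_monodromy hF hb hgen hw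
    (m := fun _ => 1 / 2) (fun _ => by norm_num) (V := {h | ∀ i, ‖h i‖ < 3 / 4}) (by
      refine (isOpen_lt (f := fun h : Fin (n + 1) → ℂ => ‖h‖) (g := fun _ => 3 / 4)
        (by fun_prop) continuous_const).mem_nhds ?_ |> Filter.mem_of_superset <| ?_
      · refine (pi_norm_lt_iff (by norm_num)).2 fun i => ?_
        norm_num
      · exact fun h hh i => (norm_le_pi_norm h i).trans_lt hh)
  have hle : ∀ i, ‖h i‖ ≤ 3 / 4 := fun i => (hV i).le
  have hl0 : 0 ≤ ℓ := hl.1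
  refine ⟨h, h0, hle, ℓ * 4, by positivity, fun m hm N => ?_⟩
  suffices hs : F.Reach (pt m w) (pt (h ^ N * m) w) (ℓ * 4 * ‖pt m w‖ * (1 - (3 / 4) ^ N)) by
    refine hs.mono (mul_le_of_le_one_right (by positivity) ?_)
    linarith [pow_nonneg (by norm_num : (0 : ℝ) ≤ 3 / 4) N]
  induction N with
  | zero =>
    simp only [pow_zero, one_mul, sub_self, mul_zero]
    refine HolFoliation.Reach.refl fun hs => ?_
    exact hm 0 (by simpa using ((hF.mem_sing _).1 hs).1)
  | succ N ih =>
    -- The path realizing h from the point with coordinates 1 is transported by the torus element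
    -- h^N m, which multiplies lengths by at most (3/4)^N ‖`pt m w`‖.
    have hstep := hl.torus hF (κ := h ^ N * m) (mul_ne_zero (pow_ne_zero _ (h0 0)) (hm 0))
      (K := (3 / 4) ^ N * ‖pt m w‖) fun i => by
        rw [Pi.mul_apply, Pi.pow_apply, norm_mul, norm_pow]
        exact mul_le_mul (pow_le_pow_left₀ (norm_nonneg _) (hle i) N) (norm_le_norm_pt m w i)
          (norm_nonneg _) (by positivity)
    rw [scale_pt, scale_pt, mul_one] at hstep
    have e : (h ^ N * m * fun i => h i) = h ^ (N + 1) * m := by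
      change h ^ N * m * h = _
      ring
    rw [e] at hstep
    refine (ih.trans hstep).mono (le_of_eq ?_)
    ring

theorem continuous_scale (q : CSpace n) : Continuous fun κ : Fin (n + 1) → ℂ => scale κ q := by
  refine (PiLp.continuous_toLp 2 _).comp (continuous_pi fun i => ?_)
  refine Fin.lastCases ?_ (fun i => ?_) i
  · simp only [Fin.snoc_last]
    fun_prop
  · simp only [Fin.snoc_castSucc]
    fun_prop

theorem scale_one (q : CSpace n) : scale 1 q = q := by
  ext i
  refine Fin.lastCases ?_ (fun i => ?_) i <;> simp

/-- Two points with short moves to the base point are connected, up to a small perturbation of the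
second one, by a path with controlled length. -/
theorem exists_reach_near (hF : IsPush F ν b) (hb : Function.Injective b)
    (hgen : ∀ i₀ a, ∃ j j', ∀ i, wt ν i j - wt ν i j' = if i = i₀ then denseGen a else 0) {w : ℂ}
    (hw : ∀ j, w ≠ b j) :
    ∃ C, 0 ≤ C ∧ ∀ (p q : CSpace n) (m m' : Fin (n + 1) → ℂ) (ℓ ℓ' η : ℝ), (∀ i, m i ≠ 0) →
      (∀ i, m' i ≠ 0) → F.Reach p (pt m w) ℓ → F.Reach q (pt m' w) ℓ' → 0 < η →
        ∀ V ∈ 𝓝 q, ∃ q' ∈ V,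
          F.Reach p q' (ℓ + C * ‖pt m w‖ + η + 2 * (C * ‖pt m' w‖ + ℓ')) := by
  obtain ⟨h₀, h₀0, h₀le, C, hC, hcon⟩ := exists_contraction hF hb hgen hw
  refine ⟨C, hC, fun p q m m' ℓ ℓ' η hm hm' hp hq hη V hV => ?_⟩
  have hV' : ∀ᶠ κ in 𝓝 (1 : Fin (n + 1) → ℂ), scale κ q ∈ V ∧ ‖κ‖ < 2 := by
    refine Filter.Eventually.and ?_ ?_
    · exact (continuous_scale q).continuousAt.eventually_mem (by rwa [scale_one])
    · refine continuous_norm.continuousAt.eventually_lt_const ?_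
      rw [pi_norm_lt_iff (by norm_num)]
      intro i
      norm_num
  have hquot : Filter.Tendsto (fun h : Fin (n + 1) → ℂ => h * m / m') (𝓝 (m' / m)) (𝓝 1) := by
    have hc : Continuous fun h : Fin (n + 1) → ℂ => h * m / m' := by
      simp only [div_eq_mul_inv]
      fun_prop
    have e : (m' / m) * m / m' = 1 := by
      funext i
      simp only [Pi.mul_apply, Pi.div_apply, Pi.one_apply]
      rw [div_mul_cancel₀ _ (hm i), div_self (hm' i)]
    rw [← e]
    exact hc.tendsto _
  -- The multiplier m'/m would carry m exactly to m'. An available h near it carries m to κ m' with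
  -- κ = h m / m' close to 1, and the path then ends at κ · q instead of q. The requirement ‖κ‖ < 2
  -- gives the factor 2 in the final bound.
  obtain ⟨h, ⟨hhV, hh2⟩, hh0, ℓh, hlh⟩ := exists_reach_monodromy hF hb hgen hw
    (m := m' / m) (fun i => div_ne_zero (hm' i) (hm i)) (hquot.eventually hV')
  set κ := h * m / m' with hκ
  have hκ0 : κ 0 ≠ 0 := div_ne_zero (mul_ne_zero (hh0 0) (hm 0)) (hm' 0)
  have hκm : κ * m' = h * m := by
    funext i
    simp only [hκ, Pi.mul_apply, Pi.div_apply]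
    rw [div_mul_cancel₀ _ (hm' i)]
  have hκ2 : ∀ i, ‖κ i‖ ≤ 2 := fun i => (norm_le_pi_norm κ i).trans hh2.le
  -- The length of the path realizing h is not controlled; after N contractions it costs less than
  -- η.
  obtain ⟨N, hN⟩ : ∃ N : ℕ, (3 / 4 : ℝ) ^ N * (‖pt m w‖ * ℓh) < η := by
    have ht := (tendsto_pow_atTop_nhds_zero_of_lt_one (by norm_num : (0 : ℝ) ≤ 3 / 4)
      (by norm_num)).mul_const (‖pt m w‖ * ℓh)
    rw [zero_mul] at ht
    exact (ht.eventually_lt_const hη).exists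
  have hmid := hlh.torus hF (κ := h₀ ^ N * m) (mul_ne_zero (pow_ne_zero _ (h₀0 0)) (hm 0))
    (K := (3 / 4) ^ N * ‖pt m w‖) fun i => by
      rw [Pi.mul_apply, Pi.pow_apply, norm_mul, norm_pow]
      exact mul_le_mul (pow_le_pow_left₀ (norm_nonneg _) (h₀le i) N) (norm_le_norm_pt m w i)
        (norm_nonneg _) (by positivity)
  have hback := (hcon m' hm' N).symm.torus hF hκ0 hκ2
  have hlast := hq.symm.torus hF hκ0 hκ2
  rw [scale_pt, scale_pt] at hmid hback
  rw [scale_pt] at hlast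
  -- Applying h to the contracted m gives the contraction of κ m', from which the reversed path for
  -- m', scaled by κ, leads back to κ m'.
  have e : h₀ ^ N * m * h = κ * (h₀ ^ N * m') := by
    rw [mul_left_comm, hκm]
    ring
  rw [mul_one] at hmid
  change F.Reach _ (pt (h₀ ^ N * m * h) w) _ at hmid
  rw [e] at hmid
  refine ⟨scale κ q, hhV, ((((hp.trans (hcon m hm N)).trans hmid).trans hback).trans hlast).mono ?_⟩
  nlinarith [hN]

theorem isClosed_hypersurfaceS (b : Fin P → ℂ) : IsClosed (hypersurfaceS (n := n) b) := by
  refine isClosed_eq ?_ continuous_const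
  fun_prop

theorem dense_ne_zero_of_clm {f : CSpace n →L[ℂ] ℂ} {v : CSpace n} (hv : f v ≠ 0) :
    IsOpen {x | f x ≠ 0} ∧ Dense {x | f x ≠ 0} := by
  refine ⟨isOpen_ne_fun f.continuous continuous_const, ?_⟩
  have h : interior ((LinearMap.ker (f : CSpace n →ₗ[ℂ] ℂ) : Submodule ℂ (CSpace n)) :
      Set (CSpace n)) = ∅ := by
    by_contra hne
    have := Submodule.eq_top_of_nonempty_interior' _ (Set.nonempty_iff_ne_empty.2 hne)
    have hv' : v ∈ LinearMap.ker (f : CSpace n →ₗ[ℂ] ℂ) := this ▸ Submodule.mem_top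
    exact hv hv'
  exact interior_eq_empty_iff_dense_compl.1 h

/-- The linear form `x_M - c x_1`. -/
def slopeForm (n : ℕ) (c : ℂ) : CSpace n →L[ℂ] ℂ :=
  EuclideanSpace.proj (𝕜 := ℂ) (Fin.last (n + 1)) - c • EuclideanSpace.proj (𝕜 := ℂ) 0

theorem slopeForm_apply (c : ℂ) (x : CSpace n) :
    slopeForm n c x = x (Fin.last (n + 1)) - c * x 0 := rfl

theorem dense_compl_hypersurfaceS (b : Fin P → ℂ) : Dense (hypersurfaceS (n := n) b)ᶜ := by
  have h1 : ∀ i : Fin (n + 1), _ := fun i =>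
    dense_ne_zero_of_clm (f := EuclideanSpace.proj (𝕜 := ℂ) i.castSucc)
      (v := EuclideanSpace.single i.castSucc 1) (by simp)
  have h2 : ∀ j, _ := fun j =>
    dense_ne_zero_of_clm (f := slopeForm n (b j))
      (v := EuclideanSpace.single (Fin.last (n + 1)) 1) (by simp [slopeForm_apply])
  have h1' := dense_iInter_of_isOpen (fun i => (h1 i).1) fun i => (h1 i).2
  have h2' := dense_iInter_of_isOpen (fun j => (h2 j).1) fun j => (h2 j).2
  refine (h1'.inter_of_isOpen_left h2' (isOpen_iInter_of_finite fun i => (h1 i).1)).mono ?_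
  rintro x ⟨hx, hx'⟩ hS
  rcases mul_eq_zero.1 hS with h | h
  · obtain ⟨i, -, hi⟩ := Finset.prod_eq_zero_iff.1 h
    exact Set.mem_iInter.1 hx i hi
  · obtain ⟨j, -, hj⟩ := Finset.prod_eq_zero_iff.1 h
    exact Set.mem_iInter.1 hx' j hj

theorem continuous_sum_wt_mul_coProd (ν : Fin (n + 1) → Fin P → ℂ) (b : Fin P → ℂ)
    (i : Fin (n + 1)) : Continuous fun x : CSpace n => ∑ j, wt ν i j * coProd b j x := by
  unfold coProd
  fun_prop

/-- Each linear factor of the equation of S is multiplied by a polynomial under the generating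
field, so `IsLeafPath.eq_zero` applies to it. -/
theorem isInvariant_hypersurfaceS (hF : IsPush F ν b) : F.IsInvariant (hypersurfaceS b) := by
  rintro p hp - q ⟨γ, hγ, rfl, rfl⟩
  rcases mul_eq_zero.1 hp with h | h
  · obtain ⟨i, hi', hi⟩ := Finset.prod_eq_zero_iff.1 h
    have := hγ.eq_zero (continuous_polyField _) hF.dir_eq
      (EuclideanSpace.proj (𝕜 := ℂ) i.castSucc) (continuous_sum_wt_mul_coProd ν b i) (fun x => by
        rw [mul_comm]
        exact polyField_pushPoly_castSucc ν b x i) hi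
    exact mul_eq_zero_of_left (Finset.prod_eq_zero hi' this) _
  · obtain ⟨j, hj', hj⟩ := Finset.prod_eq_zero_iff.1 h
    have := hγ.eq_zero (continuous_polyField _) hF.dir_eq (slopeForm n (b j))
      (g := fun x => ∑ j', wt ν 0 j' * coProd b j' x + coProd b j x)
      ((continuous_sum_wt_mul_coProd ν b 0).add (by unfold coProd; fun_prop)) (fun x => by
        have h0 := polyField_pushPoly_castSucc ν b x 0
        rw [Fin.castSucc_zero] at h0
        rw [slopeForm_apply, slopeForm_apply, polyField_pushPoly_last, h0, ← mul_coProd b j x]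
        ring) hj
    exact mul_eq_zero_of_right _ (Finset.prod_eq_zero hj' this)

/-- The complement of S is dense, so it suffices to approximate points off S. Those move to the base
point, where `exists_reach_near` applies with no constraint on lengths. -/
theorem dense_leaf (hF : IsPush F ν b) (hb : Function.Injective b)
    (hgen : ∀ i₀ a, ∃ j j', ∀ i, wt ν i j - wt ν i j' = if i = i₀ then denseGen a else 0) {w : ℂ}
    (hw : ∀ j, w ≠ b j) {p : CSpace n} (hp : p ∉ hypersurfaceS b) :
    Dense (F.leaf Set.univ p) := by
  obtain ⟨C, -, hC⟩ := exists_reach_near hF hb hgen hw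
  have hbase : ∀ p ∉ hypersurfaceS b, ∃ m ℓ, (∀ i, m i ≠ 0) ∧ F.Reach p (pt m w) ℓ := by
    intro p hp
    obtain ⟨m, z, hm, hz, rfl⟩ := exists_eq_pt hp
    obtain ⟨C, -, h⟩ := exists_mv hF hz hw
    obtain ⟨m', hm', hr⟩ := h m hm
    exact ⟨m', _, hm', hr⟩
  obtain ⟨m, ℓ, hm, hr⟩ := hbase p hp
  refine dense_closure.1 ((dense_compl_hypersurfaceS b).mono fun q hq => ?_)
  obtain ⟨m', ℓ', hm', hr'⟩ := hbase q hq
  refine mem_closure_iff_nhds.2 fun V hV => ?_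
  obtain ⟨q', hq', h⟩ := hC p q m m' ℓ ℓ' 1 hm hm' hr hr' one_pos V hV
  obtain ⟨γ, h1, h2, h3, -⟩ := h.exists_isLeafPath (Set.subset_univ _)
  exact ⟨q', hq', γ, h1, h2, h3⟩

end Connection

/-! ### The open sets U and their traces on the exceptional divisor -/

section Accessible

variable {n P : ℕ} {F : HolFoliation n} {ν : Fin (n + 1) → Fin P → ℂ} {b : Fin P → ℂ}

/-- The open set of the points near the origin, off the invariant hypersurface, with short moves
to small points over `w`. -/
def shortSet (F : HolFoliation n) (b : Fin P → ℂ) (w : ℂ) (C δ : ℝ) : Set (CSpace n) :=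
  interior ({p | ‖p‖ < δ ∧ ∃ m ℓ, (∀ i, m i ≠ 0) ∧ F.Reach p (pt m w) ℓ ∧
    ℓ + C * ‖pt m w‖ < δ} \ hypersurfaceS b)

/-- The conical neighbourhood of the origin away from the directions `x_M = b_j x_1`, `j ∈ J`. -/
def wedge (n : ℕ) (b : Fin P → ℂ) (J : Set (Fin P)) (r δ : ℝ) : Set (CSpace n) :=
  {p | ‖p‖ < δ ∧ ∀ j ∈ J, r * ‖p 0‖ < ‖p (Fin.last (n + 1)) - b j * p 0‖}

theorem isOpen_wedge (b : Fin P → ℂ) (J : Set (Fin P)) (r δ : ℝ) : IsOpen (wedge n b J r δ) := by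
  have : wedge n b J r δ = {p | ‖p‖ < δ} ∩
      ⋂ j ∈ J, {p | r * ‖p 0‖ < ‖p (Fin.last (n + 1)) - b j * p 0‖} := by
    ext p
    simp [wedge]
  rw [this]
  refine (isOpen_lt continuous_norm continuous_const).inter
    (J.toFinite.isOpen_biInter fun j _ => isOpen_lt ?_ ?_) <;> fun_prop

theorem exists_wedge_subset (hF : IsPush F ν b) (hb : Function.Injective b)
    (hN : ∀ i, InCone (∑ j, wt ν i j)) {w : ℂ} (hw : ∀ j, w ≠ b j) {J : Set (Fin P)}
    (hJ : ∀ j ∉ J, ∃ ω : ℂ, 0 < ω.re ∧ ∀ i, (ω * wt ν i j).re < 0) {r : ℝ} (hr : 0 < r)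
    {C δ : ℝ} (hC : 0 ≤ C) (hδ : 0 < δ) :
    ∃ δ' > 0, wedge n b J r δ' ⊆ shortSet F b w C δ ∪ hypersurfaceS b := by
  obtain ⟨C', hC', h⟩ := exists_mv_uniform hF hb hN hw hJ hr
  -- K‖p‖ dominates ‖p‖, the length C'‖p‖ of the move to the base point, and C times the norm of its
  -- endpoint, which is at most (1 + C')‖p‖.
  set K := 1 + C' + C * (1 + C') with hK
  have hK0 : 0 < K := by positivity
  refine ⟨δ / K, by positivity, ?_⟩
  suffices hs : wedge n b J r (δ / K) \ hypersurfaceS b ⊆ shortSet F b w C δ by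
    intro p hp
    by_cases hpS : p ∈ hypersurfaceS b
    · exact Or.inr hpS
    · exact Or.inl (hs ⟨hp, hpS⟩)
  refine interior_maximal ?_ ((isOpen_wedge _ _ _ _).sdiff (isClosed_hypersurfaceS b))
  rintro p ⟨⟨hp, hpJ⟩, hpS⟩
  refine ⟨?_, hpS⟩
  rw [lt_div_iff₀ hK0] at hp
  obtain ⟨m, z, hm, hz, rfl⟩ := exists_eq_pt hpS
  obtain ⟨m', hm', hr'⟩ := h z (fun j hj => by
    have h1 := hpJ j hj
    rw [pt_last, pt_zero, ← sub_mul, norm_mul] at h1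
    exact (lt_of_mul_lt_mul_right h1 (norm_nonneg _)).le) hz m hm
  have h0 := norm_nonneg (pt m z)
  have h1 : 0 ≤ C' * ‖pt m z‖ := by positivity
  have h2 : 0 ≤ C * (1 + C') * ‖pt m z‖ := by positivity
  have h3 := mul_le_mul_of_nonneg_left hr'.norm_le hC
  refine ⟨?_, m', _, hm', hr', ?_⟩ <;> nlinarith

theorem shortSet_subset {Δ : Set (CSpace n)} {w : ℂ} {C δ : ℝ} (hΔ : Metric.ball 0 δ ⊆ Δ) :
    shortSet F b w C δ ⊆ Δ \ hypersurfaceS b := fun _ hp =>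
  ⟨hΔ (mem_ball_zero_iff.2 (interior_subset hp).1.1), (interior_subset hp).2⟩

theorem zero_mem_hypersurfaceS : (0 : CSpace n) ∈ hypersurfaceS b :=
  mul_eq_zero_of_left (Finset.prod_eq_zero (Finset.mem_univ 0) rfl) _

/-- The cone condition is open and invariant under nonzero scalars, so it defines an open set of
lines. A point of the blow-up near ξ either projects to 0, which belongs to V, or projects to a
nonzero point of such a line inside the ball, hence into the wedge. -/
theorem preimage_proj_mem_nhds {V : Set (CSpace n)} {J : Set (Fin P)} {r δ : ℝ} (hδ : 0 < δ)
    (hV : wedge n b J r δ ⊆ V) (h0 : 0 ∈ V) {ξ : BlowUp n} (hξ : ξ.proj = 0) {v : CSpace n}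
    (hv : v ∈ ξ.1.2.submodule) (hv0 : v ≠ 0)
    (hvJ : ∀ j ∈ J, r * ‖v 0‖ < ‖v (Fin.last (n + 1)) - b j * v 0‖) :
    BlowUp.proj ⁻¹' V ∈ 𝓝 ξ := by
  let O : Set (CSpace n) := {v | ∀ j ∈ J, r * ‖v 0‖ < ‖v (Fin.last (n + 1)) - b j * v 0‖}
  have hO : IsOpen O := by
    have : O = ⋂ j ∈ J, {p | r * ‖p 0‖ < ‖p (Fin.last (n + 1)) - b j * p 0‖} := by
      ext p
      simp [O]
    rw [this]
    refine J.toFinite.isOpen_biInter fun j _ => isOpen_lt ?_ ?_ <;> fun_prop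
  have hsmul : ∀ (c : ℂ) (v : CSpace n), c ≠ 0 → v ∈ O → c • v ∈ O := fun c v hc hv j hj => by
    have h1 := mul_lt_mul_of_pos_left (hv j hj) (norm_pos_iff.2 hc)
    rw [← norm_mul] at h1
    simp only [PiLp.smul_apply, smul_eq_mul]
    calc r * ‖c * v 0‖ = ‖c‖ * (r * ‖v 0‖) := by rw [norm_mul]; ring
      _ < _ := h1
      _ = _ := by congr 1; ring
  let W : Set (ℙ ℂ (CSpace n)) := {l | ∀ v ∈ l.submodule, v ≠ 0 → v ∈ O}
  have hmk : ∀ u : CSpace n, ∀ v ∈ Submodule.span ℂ {u}, v ≠ 0 → u ∈ O → v ∈ O := by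
    intro u v hv hv0 hu
    obtain ⟨c, rfl⟩ := Submodule.mem_span_singleton.1 hv
    exact hsmul c u (fun hc => hv0 (by rw [hc, zero_smul])) hu
  have hW : IsOpen W := by
    refine isOpen_coinduced.2 ?_
    have : Projectivization.mk' ℂ ⁻¹' W = (fun v : {v : CSpace n // v ≠ 0} => (v : CSpace n)) ⁻¹' O := by
      ext u
      simp only [Set.mem_preimage, W, Set.mem_ofPred_eq, Projectivization.mk'_eq_mk,
        Projectivization.submodule_mk]
      exact ⟨fun h => h u (Submodule.mem_span_singleton_self _) u.2,
        fun h v hv hv0 => hmk u v hv hv0 h⟩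
    rw [this]
    exact hO.preimage continuous_subtype_val
  have hξW : ξ.1.2 ∈ W := by
    intro u hu hu0
    rw [Projectivization.submodule_eq] at hv hu
    obtain ⟨c, rfl⟩ := Submodule.mem_span_singleton.1 hv
    have hc : c ≠ 0 := fun hc => hv0 (by rw [hc, zero_smul])
    refine hmk _ u hu hu0 ?_
    have := hsmul c⁻¹ _ (inv_ne_zero hc) hvJ
    rwa [smul_smul, inv_mul_cancel₀ hc, one_smul] at this
  have hc1 : Continuous fun ζ : BlowUp n => ζ.1.1 := continuous_fst.comp continuous_subtype_val
  have hc2 : Continuous fun ζ : BlowUp n => ζ.1.2 := continuous_snd.comp continuous_subtype_val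
  have hb : ∀ᶠ ζ : BlowUp n in 𝓝 ξ, ζ.1.1 ∈ Metric.ball (0 : CSpace n) δ :=
    hc1.continuousAt.eventually_mem (Metric.isOpen_ball.mem_nhds (by
      change ξ.proj ∈ _
      rw [hξ]
      exact Metric.mem_ball_self hδ))
  filter_upwards [hb, hc2.continuousAt.eventually_mem (hW.mem_nhds hξW)] with ζ h1 h2
  change ζ.1.1 ∈ V
  by_cases hζ : ζ.1.1 = 0
  · rwa [hζ]
  · exact hV ⟨mem_ball_zero_iff.1 h1, h2 _ ζ.2 hζ⟩

theorem exists_pos_mul_norm_lt {J : Set (Fin P)} {v : CSpace n}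
    (hv : ∀ j ∈ J, v (Fin.last (n + 1)) - b j * v 0 ≠ 0) :
    ∃ r > 0, ∀ j ∈ J, r * ‖v 0‖ < ‖v (Fin.last (n + 1)) - b j * v 0‖ := by
  have h : ∀ᶠ r : ℝ in 𝓝 0, ∀ j ∈ J, r * ‖v 0‖ < ‖v (Fin.last (n + 1)) - b j * v 0‖ := by
    refine (Filter.eventually_all_finite J.toFinite).2 fun j hj => ?_
    have hc : ContinuousAt (fun r : ℝ => r * ‖v 0‖) 0 := by fun_prop
    exact hc.eventually_lt_const (by simpa using hv j hj)
  have h' : ∀ᶠ r : ℝ in 𝓝[>] 0, ∀ j ∈ J, r * ‖v 0‖ < ‖v (Fin.last (n + 1)) - b j * v 0‖ :=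
    nhdsWithin_le_nhds h
  obtain ⟨r, hr, hr0⟩ := (h'.and self_mem_nhdsWithin).exists
  exact ⟨r, hr0, hr⟩

/-- The set `shortSet ∪ S` is a neighbourhood of the points of the exceptional divisor away from
the directions without separation property. -/
theorem preimage_shortSet_mem_nhds (hF : IsPush F ν b) (hb : Function.Injective b)
    (hN : ∀ i, InCone (∑ j, wt ν i j)) {w : ℂ} (hw : ∀ j, w ≠ b j) {J : Set (Fin P)}
    (hJ : ∀ j ∉ J, ∃ ω : ℂ, 0 < ω.re ∧ ∀ i, (ω * wt ν i j).re < 0) {C δ : ℝ} (hC : 0 ≤ C)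
    (hδ : 0 < δ) {ξ : BlowUp n} (hξ : ξ.proj = 0) {v : CSpace n} (hv : v ∈ ξ.1.2.submodule)
    (hvJ : ∀ j ∈ J, v (Fin.last (n + 1)) - b j * v 0 ≠ 0) (hv0 : v ≠ 0) :
    BlowUp.proj ⁻¹' (shortSet F b w C δ ∪ hypersurfaceS b) ∈ 𝓝 ξ := by
  obtain ⟨r, hr, hrJ⟩ := exists_pos_mul_norm_lt hvJ
  obtain ⟨δ', hδ', hsub⟩ := exists_wedge_subset hF hb hN hw hJ hr hC hδ
  exact preimage_proj_mem_nhds hδ' hsub (Or.inr zero_mem_hypersurfaceS) hξ hv hv0 hrJ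

theorem shortSet_mem_nhds (hF : IsPush F ν b) (hb : Function.Injective b)
    (hN : ∀ i, InCone (∑ j, wt ν i j)) {w : ℂ} (hw : ∀ j, w ≠ b j)
    (hJ : ∀ j, ∃ ω : ℂ, 0 < ω.re ∧ ∀ i, (ω * wt ν i j).re < 0) {C δ : ℝ} (hC : 0 ≤ C)
    (hδ : 0 < δ) : shortSet F b w C δ ∪ hypersurfaceS b ∈ 𝓝 0 := by
  obtain ⟨δ', hδ', hsub⟩ := exists_wedge_subset hF hb hN hw (J := ∅) (fun j _ => hJ j) one_pos hC hδ
  refine Filter.mem_of_superset (Metric.ball_mem_nhds 0 hδ') fun p hp => hsub ?_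
  exact ⟨mem_ball_zero_iff.1 hp, by simp⟩

/-- On the cone Re((1 + i)ρ) = Re ρ - Im ρ < 0, and the cone is stable under the sums ρ_i = ν_1 +
ν_i. -/
theorem exists_neg_of_inCone {j : Fin P} (h : ∀ i, InCone (ν i j)) :
    ∃ ω : ℂ, 0 < ω.re ∧ ∀ i, (ω * wt ν i j).re < 0 := by
  have hwt : ∀ i, InCone (wt ν i j) := fun i => by
    by_cases hi : i = 0
    · subst hi
      simpa using h 0
    · rw [wt_of_ne ν hi]
      exact (h 0).add (h i)
  refine ⟨1 + Complex.I, by simp, fun i => ?_⟩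
  have := (le_abs_self _).trans_lt (hwt i)
  simp [add_mul]
  linarith

/-- With ω = θ λ_M the products ω ρ_i become θ λ_1 and θ (λ_1 + λ_i), so the separation by the line
Re(θz) = 0 is precisely the condition for an outgoing contracting spiral. -/
theorem exists_neg_of_separation {j : Fin P} {l : Fin (n + 2) → ℂ} (hl : l (Fin.last (n + 1)) ≠ 0)
    (hνl : ∀ i, ν i j = l i.castSucc / l (Fin.last (n + 1))) (h : SeparationCondition l) :
    ∃ ω : ℂ, 0 < ω.re ∧ ∀ i, (ω * wt ν i j).re < 0 := by
  obtain ⟨θ, -, hθ, hneg⟩ := h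
  refine ⟨θ * l (Fin.last (n + 1)), hθ, fun i => ?_⟩
  by_cases hi : i = 0
  · subst hi
    rw [wt_zero, hνl, mul_assoc, mul_div_cancel₀ _ hl]
    exact hneg _ (Or.inl rfl)
  · rw [wt_of_ne ν hi, hνl, hνl, ← add_div, mul_assoc, mul_div_cancel₀ _ hl]
    refine hneg _ (Or.inr ⟨i.castSucc, ?_, (Fin.castSucc_lt_last i).ne, rfl⟩)
    exact fun h => hi (Fin.castSucc_injective _ h)

/-- After division by c one needs φ with Re φ < 0 < Re(φ a/c). If a/c is real and negative, φ = -1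
works; if it is not real, the imaginary part of φ is adjusted so that Re(φ a/c) = 1. -/
theorem separatedByRealLine_singleton_iff {a c : ℂ} (hc : c ≠ 0) :
    SeparatedByRealLine a {c} ↔ ∀ r : ℝ, 0 ≤ r → a / c ≠ r := by
  constructor
  · rintro ⟨θ, -, h1, h2⟩ r hr h
    rw [div_eq_iff hc] at h
    have h3 := h2 c rfl
    rw [h, mul_left_comm, Complex.re_ofReal_mul] at h1
    nlinarith
  · intro h
    obtain ⟨φ, h1, h2⟩ : ∃ φ : ℂ, 0 < (φ * (a / c)).re ∧ φ.re < 0 := by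
      by_cases him : (a / c).im = 0
      · refine ⟨-1, ?_, by simp⟩
        by_contra hre
        refine h (a / c).re ?_ (Complex.ext rfl (by simpa using him))
        simpa using hre
      · refine ⟨⟨-1, -((a / c).re + 1) / (a / c).im⟩, ?_, by simp⟩
        rw [Complex.mul_re, div_mul_cancel₀ _ him]
        linarith
    refine ⟨φ / c, ?_, ?_, ?_⟩
    · refine div_ne_zero (fun h0 => ?_) hc
      simp [h0] at h2
    · rwa [div_mul_eq_mul_div, ← mul_div_assoc] at *
    · rintro z rfl
      rwa [div_mul_cancel₀ _ hc]

/-- Any two points of `shortSet` are connected, up to a small perturbation of the second one, by a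
short path. -/
theorem exists_dense_short (hF : IsPush F ν b) (hb : Function.Injective b)
    (hgen : ∀ i₀ a, ∃ j j', ∀ i, wt ν i j - wt ν i j' = if i = i₀ then denseGen a else 0) {w : ℂ}
    (hw : ∀ j, w ≠ b j) : ∃ C, 0 ≤ C ∧ ∀ (ε : ℝ) (Δ : Set (CSpace n)) (δ : ℝ), 0 < δ → 4 * δ < ε →
      Metric.ball 0 (6 * δ) ⊆ Δ → ∀ p ∈ shortSet F b w C δ, ∃ D ⊆ shortSet F b w C δ,
        shortSet F b w C δ ⊆ closure D ∧ D ⊆ F.leaf Δ p ∧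
          ∀ q ∈ D, ∃ γ : ℝ → CSpace n, F.IsLeafPath Δ γ ∧ γ 0 = p ∧ γ 1 = q ∧
            eVariationOn γ (Set.Icc 0 1) < ENNReal.ofReal ε := by
  obtain ⟨C, hC0, hC⟩ := exists_reach_near hF hb hgen hw
  refine ⟨C, hC0, fun ε Δ δ hδ hε hΔ p hp => ?_⟩
  obtain ⟨⟨hpn, m, ℓ, hm, hr, hl⟩, -⟩ := interior_subset hp
  -- Since ‖p‖ < δ, paths of length at most 4δ from p stay within norm 5δ.
  have hball : Metric.closedBall p (4 * δ) ⊆ Δ := by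
    refine (Metric.closedBall_subset_ball' ?_).trans hΔ
    rw [dist_zero_right]
    linarith
  have hpath : ∀ q ∈ {q ∈ shortSet F b w C δ | F.Reach p q (4 * δ)}, ∃ γ : ℝ → CSpace n,
      F.IsLeafPath Δ γ ∧ γ 0 = p ∧ γ 1 = q ∧
        eVariationOn γ (Set.Icc 0 1) < ENNReal.ofReal ε := by
    rintro q ⟨-, hq⟩
    obtain ⟨γ, h1, h2, h3, h4⟩ := hq.exists_isLeafPath hball
    exact ⟨γ, h1, h2, h3, h4.trans_lt ((ENNReal.ofReal_lt_ofReal_iff (by linarith)).2 hε)⟩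
  refine ⟨{q ∈ shortSet F b w C δ | F.Reach p q (4 * δ)}, Set.sep_subset _ _, fun q hq => ?_,
    fun q hq => ?_, hpath⟩
  · obtain ⟨⟨-, m', ℓ', hm', hr', hl'⟩, -⟩ := interior_subset hq
    refine mem_closure_iff_nhds.2 fun V hV => ?_
    -- Taking η = δ, the bound is δ + δ + 2δ = 4δ.
    obtain ⟨q', ⟨hq', hq''⟩, h⟩ := hC p q m m' ℓ ℓ' δ hm hm' hr hr' hδ _
      (Filter.inter_mem hV (isOpen_interior.mem_nhds hq))
    exact ⟨q', hq', hq'', h.mono (by linarith)⟩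
  · obtain ⟨γ, h1, h2, h3, -⟩ := hpath q hq
    exact ⟨γ, h1, h2, h3⟩

end Accessible

end

/-! ### The theorem -/

theorem mainTheorem6 (n : ℕ) (T : Finset ℂ) (lam : {τ : ℂ // τ ∈ T} → Fin (n + 2) → ℂ)
    (hlam : ∀ τ i, lam τ i ≠ 0) (k : ℕ) :
    ∃ (G : HolFoliation n) (P : ℕ) (ν : Fin (n + 1) → Fin P → ℂ) (b : Fin P → ℂ)
      (h : {τ : ℂ // τ ∈ T} → CSpace n → CSpace n)
      (F : HolFoliation n) (X : Fin (n + 2) → MvPolynomial (Fin (n + 2)) ℂ),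
      -- (1) `G` is defined by the rational system, and its singular points are `(0,…,0,b_j)`
      ((∀ i j, ν i j ≠ 0) ∧ Function.Injective b ∧
        (∀ t : CSpace n, (∀ j, t (Fin.last (n + 1)) ≠ b j) →
          G.dir t = Submodule.span ℂ {rationalField ν b t}) ∧
        G.sing = Set.range fun j => axisPoint n (b j)) ∧
      -- (2) linearization of `G` at the points of `T`
      ((∀ τ ∈ T, ∃ j, b j = τ) ∧
        ∀ τ : {τ : ℂ // τ ∈ T}, IsBiholGerm (h τ) ∧ IsTangentToId k (h τ) ∧
          ∀ᶠ s in 𝓝 (0 : CSpace n), G.dir (axisPoint n τ + h τ s) =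
            Submodule.span ℂ {fderiv ℂ (fun s => axisPoint n τ + h τ s) s (diagField (lam τ) s)}) ∧
      -- (3) `F` is generated by a polynomial vector field and is the pushforward of `G`
      ((∀ x, F.dir x = Submodule.span ℂ {polyField X x}) ∧
        ∀ t : CSpace n, t 0 ≠ 0 → F.dir (blowMap t) =
          (G.dir t).map ((fderiv ℂ blowMap t : CSpace n →L[ℂ] CSpace n) :
            CSpace n →ₗ[ℂ] CSpace n)) ∧
      -- (4) the invariant hypersurface, density of the leaves, and the germs at the points of `T`
      (F.IsInvariant (hypersurfaceS b) ∧
        (∀ p ∉ hypersurfaceS b, Dense (F.leaf Set.univ p)) ∧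
        ∀ τ : {τ : ℂ // τ ∈ T}, ∀ᶠ s in 𝓝 (0 : CSpace n),
          (blowMap (axisPoint n τ + h τ s) ∈ hypersurfaceS b ↔ ∏ i, s i = 0)) ∧
      -- (5) the open sets `U`
      (∀ ε : ℝ, 0 < ε → ∀ Δ ∈ 𝓝 (0 : CSpace n), ∃ U : Set (CSpace n), IsOpen U ∧
        U ⊆ Δ \ hypersurfaceS b ∧
        (∀ p ∈ U, ∃ D ⊆ U, U ⊆ closure D ∧ D ⊆ F.leaf Δ p ∧
          ∀ q ∈ D, ∃ γ : ℝ → CSpace n, F.IsLeafPath Δ γ ∧ γ 0 = p ∧ γ 1 = q ∧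
            eVariationOn γ (Set.Icc 0 1) < ENNReal.ofReal ε) ∧
        (∀ ξ : BlowUp n, ξ.proj = 0 → ξ.1.2 ∉ tangentConeT T →
          BlowUp.proj ⁻¹' (U ∪ hypersurfaceS b) ∈ 𝓝 ξ) ∧
        (∀ τ : {τ : ℂ // τ ∈ T}, SeparationCondition (lam τ) →
          ∀ t : CSpace n, t 0 = 0 → t (Fin.last (n + 1)) = τ →
            BlowUp.proj ⁻¹' (U ∪ hypersurfaceS b) ∈ 𝓝 (BlowUp.chart t)) ∧
        ((∀ τ, SeparationCondition (lam τ)) → U ∪ hypersurfaceS b ∈ 𝓝 0)) ∧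
      -- the separation condition for `M = 2`
      (n = 0 → ∀ τ, (SeparationCondition (lam τ) ↔
        ∀ r : ℝ, 0 ≤ r → lam τ (Fin.last (n + 1)) / lam τ 0 ≠ r)) := by
  obtain ⟨P, ν, b, hν, hb, hP, hT, hcone, hsum, hgen⟩ := exists_nodes T lam hlam k
  choose idx hidx hνl hflat using hT
  have hN : ∑ j, ν 0 j ≠ -1 := fun h => by
    have h0 := hsum 0
    rw [h, InCone] at h0
    norm_num at h0
  have hW : ∀ i, InCone (∑ j, wt ν i j) := fun i => by
    by_cases hi : i = 0
    · subst hi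
      simpa using hsum 0
    · simp only [wt_of_ne ν hi, Finset.sum_add_distrib]
      exact (hsum 0).add (hsum i)
  have hflat' : ∀ τ i, regPart ν b (idx τ) i =O[𝓝[≠] (b (idx τ))] fun z => (z - b (idx τ)) ^ k := by
    intro τ i
    rw [hidx τ]
    exact hflat τ i
  have hF : IsPush (pushFoliation ν b hν hb hP hN) ν b := isPush_pushFoliation
  obtain ⟨w, hw⟩ := (Set.finite_range b).infinite_compl.nonempty
  have hw : ∀ j, w ≠ b j := fun j h => hw ⟨j, h.symm⟩
  obtain ⟨C, hC, hshort⟩ := exists_dense_short hF hb hgen hw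
  -- A contracting spiral exists at every node, except possibly at those of T without the separation
  -- property.
  have hsep : ∀ j, (∀ τ : {τ : ℂ // τ ∈ T}, b j = τ → SeparationCondition (lam τ)) →
      ∃ ω : ℂ, 0 < ω.re ∧ ∀ i, (ω * wt ν i j).re < 0 := by
    intro j hj
    by_cases hjT : b j ∈ T
    · have e : idx ⟨b j, hjT⟩ = j := hb (hidx ⟨b j, hjT⟩)
      refine exists_neg_of_separation (hlam ⟨b j, hjT⟩ _) (fun i => ?_) (hj ⟨b j, hjT⟩ rfl)
      rw [← hνl, e]
    · exact exists_neg_of_inCone (hcone j hjT)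
  refine ⟨rationalFoliation ν b hν hb, P, ν, b, fun τ => linMap ν b (idx τ),
    pushFoliation ν b hν hb hP hN, pushPoly ν b,
    ⟨hν, hb, fun t ht => rationalFoliation_dir ht, rationalFoliation_sing ν b hν hb⟩,
    ⟨fun τ hτ => ⟨_, hidx ⟨τ, hτ⟩⟩, fun τ => ⟨isBiholGerm_linMap hb (hflat' τ),
      isTangentToId_linMap hb (hflat' τ), ?_⟩⟩,
    ⟨hF.dir_eq, fun t ht => pushFoliation_dir_blowMap ht⟩,
    ⟨isInvariant_hypersurfaceS hF, fun p hp => dense_leaf hF hb hgen hw hp, fun τ => ?_⟩,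
    fun ε hε Δ hΔ => ?_, ?_⟩
  · have hslit := ((EuclideanSpace.proj (𝕜 := ℂ) (Fin.last (n + 1)) :
      CSpace n →L[ℂ] ℂ).continuous.tendsto' 0 0 (by simp)).eventually
        (eventually_slitAt (b := b) (j := idx τ))
    filter_upwards [hslit] with s hs
    rw [← hidx τ]
    exact rationalFoliation_dir_linMap hb (hlam τ _) (hνl τ) hs
  · have hslit := ((EuclideanSpace.proj (𝕜 := ℂ) (Fin.last (n + 1)) :
      CSpace n →L[ℂ] ℂ).continuous.tendsto' 0 0 (by simp)).eventually
        (eventually_slitAt (b := b) (j := idx τ))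
    filter_upwards [hslit] with s hs
    rw [← hidx τ]
    exact blowMap_linMap_mem_iff hb hs
  · obtain ⟨r, hr, hrΔ⟩ := Metric.mem_nhds_iff.1 hΔ
    set δ := min (r / 6) (ε / 5) with hδ
    have hδ0 : 0 < δ := lt_min (by positivity) (by positivity)
    have hδr : δ ≤ r / 6 := min_le_left _ _
    have hδε : δ ≤ ε / 5 := min_le_right _ _
    have hball : Metric.ball (0 : CSpace n) (6 * δ) ⊆ Δ :=
      (Metric.ball_subset_ball (by linarith)).trans hrΔ
    refine ⟨shortSet (pushFoliation ν b hν hb hP hN) b w C δ, isOpen_interior,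
      shortSet_subset ((Metric.ball_subset_ball (by linarith)).trans hball),
      hshort ε Δ δ hδ0 (by linarith) hball, fun ξ hξ hξT => ?_, fun τ hτ t ht0 htτ => ?_,
      fun hall => ?_⟩
    · simp only [tangentConeT, Set.mem_ofPred_eq, not_forall] at hξT
      obtain ⟨v, hv, hvT⟩ := hξT
      have hJ : ∀ j ∉ {j | b j ∈ T}, ∃ ω : ℂ, 0 < ω.re ∧ ∀ i, (ω * wt ν i j).re < 0 := fun j hj =>
        hsep j fun τ h => absurd (show b j ∈ T from h ▸ τ.2) hj
      -- A line outside the tangent cone may be witnessed by v = 0 only when T is empty; any nonzero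
      -- vector of the line then serves.
      by_cases hv0 : v = 0
      · refine preimage_shortSet_mem_nhds hF hb hW hw (J := {j | b j ∈ T}) hJ hC hδ0 hξ
          (v := ξ.1.2.rep) ?_ (fun j hj _ => ?_) ξ.1.2.rep_nonzero
        · rw [Projectivization.submodule_eq]
          exact Submodule.mem_span_singleton_self _
        · exact hvT (Finset.prod_eq_zero hj (by simp [hv0]))
      · refine preimage_shortSet_mem_nhds hF hb hW hw (J := {j | b j ∈ T}) hJ hC hδ0 hξ hv (fun j hj h => ?_) hv0
        exact hvT (Finset.prod_eq_zero hj h)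
    -- The points of t_1 = 0, t_M = τ are lines with x_M = τ x_1, so all the other nodes can be
    -- avoided, and only the spiral at τ is needed.
    · refine preimage_shortSet_mem_nhds hF hb hW hw (J := {j | b j ≠ τ})
        (fun j hj => hsep j fun τ' h => ?_) hC hδ0 (v := chartDir t) ?_ ?_ (fun j hj => ?_)
        (chartDir_ne_zero t)
      · have e : τ' = τ := Subtype.ext (h.symm.trans (not_not.1 hj))
        rwa [e]
      · change blowMap t = 0
        rw [blowMap_eq_smul, ht0, zero_smul]
      · change chartDir t ∈ (Projectivization.mk ℂ (chartDir t) _).submodule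
        rw [Projectivization.submodule_mk]
        exact Submodule.mem_span_singleton_self _
      · have h0 : chartDir t 0 = 1 := by simp [chartDir]
        have h1 : chartDir t (Fin.last (n + 1)) = τ := by
          simp [chartDir, htτ, Fin.last_pos.ne']
        rw [h0, h1, mul_one]
        exact sub_ne_zero.2 (Ne.symm hj)
    · exact shortSet_mem_nhds hF hb hW hw (fun j => hsep j fun τ _ => hall τ) hC hδ0
  · rintro rfl τ
    have hset : ({lam τ 0} ∪ {z | ∃ i, i ≠ 0 ∧ i ≠ Fin.last (0 + 1) ∧ z = lam τ 0 + lam τ i} : Set ℂ) =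
        {lam τ 0} := by
      refine Set.union_eq_left.2 ?_
      rintro z ⟨i, h0, h1, -⟩
      fin_cases i
      · exact absurd rfl h0
      · exact absurd rfl h1
    rw [SeparationCondition, hset]
    exact separatedByRealLine_singleton_iff (hlam τ 0)
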